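/- Let $\lambda_0\in\mathbb C^d$, let $\Lambda$ be a neighbourhood of $\lambda_0$, and write $x^m=x_1^{m_1}x_2^{m_2}$, $|m|=m_1+m_2$ for $x\in\mathbb C^2$, $m\in\mathbb N^2$ (with $0\in\mathbb N$). For $\lambda\in\Lambda$ let $$f_\lambda(x_1,x_2)=(\mu_1(\lambda)x_1,\mu_2(\lambda)x_2)+\sum_{|m|\ge 2}a_m(\lambda)x^m,\qquad a_m(\lambda)\in\mathbb C^2,$$ where the series converges absolutely on a polydisk $\{|x_1|<R,|x_2|<R\}$, uniformly in the parameter in the sense that $\sum_m \sup_{\lambda\in\Lambda}\|a_m(\lambda)\|\,R^{|m|}<\infty$, and where $\mu_1,\mu_2$ are continuous at $\lambda_0$. Assume that $0$ is a hyperbolic fixed point of the local diffeomorphism $f_{\lambda_0}$, i.e. $\mu_i(\lambda_0)\neq 0$ and $|\mu_i(\lambda_0)|\ne 1$ for $i=1,2$, and that there is a $q:-p$ resonance in modulus at $\lambda_0$, i.e. $|\mu_1(\lambda_0)|^p=|\mu_2(\lambda_0)|^{-q}$ with relatively prime positive integers $p,q$. Let $\alpha_0=(r_0,s_0)$ be the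 unique integer solution of $qr-ps=1$ with $0\le r\le p$, $0\le s\le q$, and let $\alpha_1=(p,q)-\alpha_0$. Let $N\in\mathbb N$. Then there are a neighbourhood $\Lambda'\subset\Lambda$ of $\lambda_0$ and, for $\lambda\in\Lambda'$, an analytic change of variables $h_\lambda$ near $0$ with $h_\lambda(0)=0$ ($h_\lambda$ is analytic and injective on a polydisk at $0$ and has an analytic inverse on a polydisk at $0$, both polydisks being independent of $\lambda$) such that, on a polydisk $\{|x_1|<\delta,|x_2|<\delta\}$ with $\delta>0$ independent of $\lambda$, the map $g_\lambda=h_\lambda^{-1}\circ f_\lambda\circ h_\lambda$ is defined and its components are, for $i=1,2$ and with $u=x_1^px_2^q$, $$g_{\lambda,i}(x_1,x_2)=x_i\Big[\mu_i(\lambda)+b^0_i(u,\lambda)+u\sum_{k=1}^\infty u^{Nk}\big(x^{k\alpha_0}b^{0k}_i(u,\lambda)+x^{k\alpha_1}b^{1k}_i(u,\lambda)\big)\Big],$$ where moreover: (i) the functions $b^0_i,b^{0k}_i,b^{1k}_i$ are analytic in $u$ on the disk $|u|<\delta^{p+q}$; (ii) all the occurring power series, expressed in the variables $x_1,x_2$,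 converge absolutely on the polydisk of radius $\delta$: if $b^0_i=\sum_n c^0_{i,n}(\lambda)u^n$ and $b^{jk}_i=\sum_n c^{jk}_{i,n}(\lambda)u^n$ $(j=0,1)$, then $$\sum_{n\ge0}\sup_{\lambda\in\Lambda'}|c^0_{i,n}(\lambda)|\,\delta^{(p+q)n}<\infty,\qquad \sum_{k\ge 1}\sum_{n\ge 0}\sup_{\lambda\in\Lambda'}|c^{jk}_{i,n}(\lambda)|\,\delta^{(p+q)(1+Nk+n)+k|\alpha_j|}<\infty;$$ (iii) if $f_\lambda(x)$ is analytic in $(\lambda,x)$ near $(\lambda_0,0)$, then $h_\lambda$, $h_\lambda^{-1}$ and $g_\lambda$ are analytic in $(\lambda,x)$, and $b^0_i,b^{0k}_i,b^{1k}_i$ are analytic in $(\lambda,u)$, for $\lambda\in\Lambda'$ and on the polydisks (respectively the disk $|u|<\delta^{p+q}$) above. -/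

import Mathlib

open Topology

/-- The total degree `|m| = m₁ + m₂` of a multi-index. -/
def multiDeg (m : Fin 2 → ℕ) : ℕ := ∑ i, m i

/-- The monomial `x^m = x₁^{m₁} x₂^{m₂}`. -/
def multiPow (x : Fin 2 → ℂ) (m : Fin 2 → ℕ) : ℂ := ∏ i, x i ^ m i

/-- The open polydisk of radius `r` centred at the origin of `ℂ²`. -/
def polydisk (r : ℝ) : Set (Fin 2 → ℂ) := {x | ∀ i, ‖x i‖ < r}

/-- The coefficient functions `c i`, measured in the supremum norm over the parameter set `Λ`,
are absolutely summable against the weights `w i`. -/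
def NormallySummable {P F ι : Type*} [Norm F] (Λ : Set P) (c : ι → P → F) (w : ι → ℝ) : Prop :=
  ∃ M : ι → ℝ, (∀ i, ∀ lam ∈ Λ, ‖c i lam‖ ≤ M i) ∧ Summable fun i => M i * w i

/-- `f_λ(x) = (μ₁(λ) x₁, μ₂(λ) x₂) + ∑_{|m| ≥ 2} a_m(λ) x^m` for `λ ∈ Λ`, the series being
absolutely convergent on the polydisk of radius `R`, for the supremum norm over `Λ`. -/
structure IsPlanarFamily {P : Type*} (Λ : Set P) (R : ℝ) (μ : Fin 2 → P → ℂ)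
    (a : (Fin 2 → ℕ) → P → (Fin 2 → ℂ)) (f : P → (Fin 2 → ℂ) → (Fin 2 → ℂ)) : Prop where
  radius_pos : 0 < R
  summable : NormallySummable Λ (fun m : {m : Fin 2 → ℕ // 2 ≤ multiDeg m} => a m)
    (fun m => R ^ multiDeg m)
  hasSum : ∀ lam ∈ Λ, ∀ x ∈ polydisk R,
    HasSum (fun m : {m : Fin 2 → ℕ // 2 ≤ multiDeg m} => multiPow x m • a m lam)
      (f lam x - fun i => μ i lam * x i)

/-- The linear part `diag(μ₁, μ₂)` is invertible and has no eigenvalue of modulus one. -/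
def IsHyperbolicAt {P : Type*} (μ : Fin 2 → P → ℂ) (lam₀ : P) : Prop :=
  ∀ i, μ i lam₀ ≠ 0 ∧ ‖μ i lam₀‖ ≠ 1

/-- `|μ₁(λ₀)|^p = |μ₂(λ₀)|^{-q}` with `p`, `q` positive and relatively prime. -/
def ResonantInModulus {P : Type*} (p q : ℕ) (μ : Fin 2 → P → ℂ) (lam₀ : P) : Prop :=
  0 < p ∧ 0 < q ∧ Nat.Coprime p q ∧ ‖μ 0 lam₀‖ ^ (p : ℤ) = ‖μ 1 lam₀‖ ^ (-(q : ℤ))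

/-- `(r₀, s₀)` is the solution of `q r - p s = 1` with `0 ≤ r ≤ p` and `0 ≤ s ≤ q`. -/
def IsBezoutPair (p q r₀ s₀ : ℕ) : Prop :=
  (q : ℤ) * r₀ - p * s₀ = 1 ∧ r₀ ≤ p ∧ s₀ ≤ q

/-- The pair exists and is unique. -/
theorem existsUnique_isBezoutPair {p q : ℕ} (hp : 0 < p) (hq : 0 < q) (h : Nat.Coprime p q) :
    ∃! rs : ℕ × ℕ, IsBezoutPair p q rs.1 rs.2 := by
  have hex : ∃ r s : ℕ, IsBezoutPair p q r s := by
    rcases Nat.lt_or_ge 1 p with h1 | h1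
    · obtain ⟨m, hm, hm'⟩ := Nat.exists_mul_mod_eq_one_of_coprime h.symm h1
      have key := Nat.div_add_mod (q * m) p
      rw [hm'] at key
      refine ⟨m, q * m / p, ?_, hm.le, ?_⟩
      · zify at key
        push_cast
        linarith
      · apply Nat.div_le_of_le_mul
        rw [mul_comm p q]
        exact Nat.mul_le_mul_left q hm.le
    · obtain rfl : p = 1 := by omega
      refine ⟨1, q - 1, ?_, le_rfl, by omega⟩
      push_cast [Nat.cast_sub (show 1 ≤ q from hq)]
      ring
  obtain ⟨r, s, hrs⟩ := hex
  refine ⟨(r, s), hrs, ?_⟩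
  rintro ⟨r', s'⟩ ⟨e', hr', hs'⟩
  obtain ⟨e, hr, hs⟩ := hrs
  simp only at e' hr' hs'
  have hpos : ∀ a b : ℕ, (q : ℤ) * a - p * b = 1 → 0 < a := by
    intro a b hab
    rcases Nat.eq_zero_or_pos a with rfl | ha
    · exfalso
      have : (0 : ℤ) ≤ (p : ℤ) * b := by positivity
      simp at hab
      omega
    · exact ha
  have h1 := hpos r s e
  have h2 := hpos r' s' e'
  have hd : (p : ℤ) ∣ (r' : ℤ) - r := by
    have hc : IsCoprime (p : ℤ) (q : ℤ) := Nat.isCoprime_iff_coprime.mpr h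
    apply hc.dvd_of_dvd_mul_left
    exact ⟨(s' : ℤ) - s, by linarith⟩
  have hz : (r' : ℤ) - r = 0 := by
    apply Int.eq_zero_of_abs_lt_dvd hd
    rw [abs_lt]
    constructor <;> omega
  have hrr : r' = r := by omega
  subst hrr
  have hss : (p : ℤ) * s' = p * s := by linarith
  have : (s' : ℤ) = s := mul_left_cancel₀ (by exact_mod_cast hp.ne') hss
  simp only [Prod.mk.injEq, true_and]
  exact_mod_cast this

/-- For every `λ ∈ Λ`, `h_λ` is an analytic change of variables near `0` fixing `0`: it is
analytic and injective on the polydisk of radius `ρ`, and `k_λ` is its analytic inverse on the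
polydisk of radius `σ`. -/
structure IsChangeOfVariables {P : Type*} (Λ : Set P) (ρ σ : ℝ)
    (h k : P → (Fin 2 → ℂ) → (Fin 2 → ℂ)) : Prop where
  radius_pos : 0 < ρ
  radius_pos_inv : 0 < σ
  map_zero : ∀ lam ∈ Λ, h lam 0 = 0
  analytic : ∀ lam ∈ Λ, AnalyticOnNhd ℂ (h lam) (polydisk ρ)
  injOn : ∀ lam ∈ Λ, Set.InjOn (h lam) (polydisk ρ)
  analytic_inv : ∀ lam ∈ Λ, AnalyticOnNhd ℂ (k lam) (polydisk σ)
  mapsTo_inv : ∀ lam ∈ Λ, Set.MapsTo (k lam) (polydisk σ) (polydisk ρ)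
  right_inv : ∀ lam ∈ Λ, ∀ y ∈ polydisk σ, h lam (k lam y) = y

/-- `g_λ = h_λ⁻¹ ∘ f_λ ∘ h_λ` on the polydisk of radius `δ`, all three maps being applied inside
their domains (polydisks of radius `ρ`, `R`, `σ` for `h_λ`, `f_λ`, `k_λ = h_λ⁻¹`). -/
structure IsConjugate {P : Type*} (Λ : Set P) (R ρ σ δ : ℝ)
    (f h k g : P → (Fin 2 → ℂ) → (Fin 2 → ℂ)) : Prop where
  radius_pos : 0 < δ
  radius_le : δ ≤ ρ
  mapsTo : ∀ lam ∈ Λ, Set.MapsTo (h lam) (polydisk ρ) (polydisk R)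
  mapsTo_comp : ∀ lam ∈ Λ, Set.MapsTo (fun x => f lam (h lam x)) (polydisk δ) (polydisk σ)
  conj : ∀ lam ∈ Λ, ∀ x ∈ polydisk δ, g lam x = k lam (f lam (h lam x))

/-- The normal form, with `u = x₁^p x₂^q`:
`g_i = x_i [μ_i + b_i(u) + u ∑_{k ≥ 1} u^{Nk} (x^{kα₀} b₀_{i,k}(u) + x^{kα₁} b₁_{i,k}(u))]`
on the polydisk of radius `δ`, together with the convergence of all power series there. -/
structure HasResonantForm {P : Type*} (p q N : ℕ) (α₀ α₁ : Fin 2 → ℕ) (Λ : Set P) (δ : ℝ)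
    (μ : Fin 2 → P → ℂ) (g : P → (Fin 2 → ℂ) → (Fin 2 → ℂ))
    (b : Fin 2 → P → ℂ → ℂ) (b₀ b₁ : Fin 2 → ℕ → P → ℂ → ℂ) : Prop where
  form : ∀ lam ∈ Λ, ∀ x ∈ polydisk δ, ∀ u : ℂ, u = x 0 ^ p * x 1 ^ q → ∀ i, ∃ S : ℂ,
    HasSum (fun k : ℕ => u ^ (N * (k + 1)) *
      (multiPow x ((k + 1) • α₀) * b₀ i (k + 1) lam u +
        multiPow x ((k + 1) • α₁) * b₁ i (k + 1) lam u)) S ∧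
    g lam x i = x i * (μ i lam + b i lam u + u * S)
  /- Analyticity in `u`; the polydisk of radius `δ` is mapped by `u` into this disk. -/
  analytic : ∀ lam ∈ Λ, ∀ i, AnalyticOnNhd ℂ (b i lam) (Metric.ball 0 (δ ^ (p + q)))
  analytic₀ : ∀ lam ∈ Λ, ∀ i, ∀ k, 1 ≤ k →
    AnalyticOnNhd ℂ (b₀ i k lam) (Metric.ball 0 (δ ^ (p + q)))
  analytic₁ : ∀ lam ∈ Λ, ∀ i, ∀ k, 1 ≤ k →
    AnalyticOnNhd ℂ (b₁ i k lam) (Metric.ball 0 (δ ^ (p + q)))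
  /- Absolute convergence of the series written out in monomials of `x₁, x₂`; the exponent of
  `δ` is the total degree of the monomial. -/
  expansion : ∀ i, ∃ c : ℕ → P → ℂ,
    (∀ lam ∈ Λ, ∀ u ∈ Metric.ball (0 : ℂ) (δ ^ (p + q)),
      HasSum (fun n => c n lam * u ^ n) (b i lam u)) ∧
    NormallySummable Λ c (fun n => δ ^ ((p + q) * n))
  expansion₀ : ∀ i, ∃ c : ℕ × ℕ → P → ℂ,
    (∀ k, ∀ lam ∈ Λ, ∀ u ∈ Metric.ball (0 : ℂ) (δ ^ (p + q)),
      HasSum (fun n => c (k, n) lam * u ^ n) (b₀ i (k + 1) lam u)) ∧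
    NormallySummable Λ c
      (fun kn => δ ^ ((p + q) * (1 + N * (kn.1 + 1) + kn.2) + (kn.1 + 1) * multiDeg α₀))
  expansion₁ : ∀ i, ∃ c : ℕ × ℕ → P → ℂ,
    (∀ k, ∀ lam ∈ Λ, ∀ u ∈ Metric.ball (0 : ℂ) (δ ^ (p + q)),
      HasSum (fun n => c (k, n) lam * u ^ n) (b₁ i (k + 1) lam u)) ∧
    NormallySummable Λ c
      (fun kn => δ ^ ((p + q) * (1 + N * (kn.1 + 1) + kn.2) + (kn.1 + 1) * multiDeg α₁))

/-! Write an exponent occurring in component `i` as `m - e_i = l α₀ + t (p, q)`. Since `q r₀ - p s₀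
= 1`, the pair `(l, t)` is an integral coordinate system. At `λ₀` the multiplier `μ^m / μ_i` has
modulus `c^l` with `c = |μ^{α₀}|`, because `|μ^{(p,q)}| = 1`; moreover `c^q = |μ₁|`, so `c ≠ 1`.
Take the weights `w = t - N l` and `w' = t + (N + 1) l`. Their zero lines are spanned by `α₀ + N (p,
q)` and `α₁ + N (p, q)`. For total degree at least two, `w ≤ 0` forces `l ≥ 1` and `w' ≤ 0` forces
`l ≤ -1`. On each of these half planes the multipliers therefore stay on one side of the unit
circle, at a uniform distance from it, and no small divisors occur (`exists_contraction_bound`,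
`exists_contraction_weights`). What survives, `w ≥ 1` and `w' ≥ 1`, is contained in the set of
exponents of the normal form: the resonant line and two cones (`mem_range_resIndex`).

A contracting half plane is removed in one stroke. Put `h = id + ψ` and `G = μ + γ`, and collect `Φ
= γ - μ ψ`, where `ψ` and `γ` live on complementary sets of exponents. Then `f ∘ h = h ∘ G` becomes
`Φ = F ∘ h - ψ ∘ G`. The first term is small after rescaling, and the second contracts because
`|μ_i⁻¹ μ^m| ≤ θ < 1` on the support of `ψ` (`exists_fixedPoint`, `exists_semiNormalForm`). The
other half plane is expanding, so the same step is applied to the inverse map, whose multipliers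
there are contracting. Lower bounds on weights survive substitution and inversion, so the second
step does not restore what the first removed (`exists_rightInverse`, `exists_conjugation`).

Parameters are handled by taking coefficients in a commutative Banach algebra `C`, a parameter value
being a character `C → ℂ`. Everything is solved once over `C`, which makes radii and bounds uniform.
With `C` the bounded functions on a neighbourhood the norm is the supremum over the parameter. With
`C` the absolutely convergent power series in the parameter the characters depend analytically on
`λ`, and so does everything constructed. Both choices feed `exists_resonantForm_of_characters`. -/

/-! ### Monomials and Lipschitz estimates for them. -/

/-- The monomial `y^m = ∏ i, y i ^ m i`. -/
noncomputable def mpow {σ B : Type*} [CommMonoid B] (y : σ → B) (m : σ →₀ ℕ) : B :=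
  m.prod fun i k => y i ^ k

section mpow

variable {σ B : Type*} [CommMonoid B]

theorem mpow_zero (y : σ → B) : mpow y 0 = 1 := Finsupp.prod_zero_index

theorem mpow_add (y : σ → B) (m n : σ →₀ ℕ) : mpow y (m + n) = mpow y m * mpow y n :=
  Finsupp.prod_add_index' (by simp) (by simp [pow_add])

theorem mpow_single (y : σ → B) (i : σ) (k : ℕ) : mpow y (Finsupp.single i k) = y i ^ k :=
  Finsupp.prod_single_index (by simp)

theorem mpow_eq_prod [Fintype σ] (y : σ → B) (m : σ →₀ ℕ) : mpow y m = ∏ i, y i ^ m i :=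
  Finsupp.prod_fintype _ _ (by simp)

theorem mpow_fin_two (y : Fin 2 → B) (m : Fin 2 →₀ ℕ) : mpow y m = y 0 ^ m 0 * y 1 ^ m 1 := by
  rw [mpow_eq_prod, Fin.prod_univ_two]

theorem mpow_mul (y z : σ → B) (m : σ →₀ ℕ) : mpow (y * z) m = mpow y m * mpow z m := by
  simp [mpow, mul_pow, Finsupp.prod_mul]

theorem mpow_const (c : B) (m : σ →₀ ℕ) : mpow (fun _ => c) m = c ^ m.degree := by
  simp [mpow, Finsupp.prod, Finset.prod_pow_eq_pow_sum, Finsupp.degree_apply]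

theorem map_mpow {B' F : Type*} [CommMonoid B'] [FunLike F B B'] [MonoidHomClass F B B'] (f : F)
    (y : σ → B) (m : σ →₀ ℕ) : f (mpow y m) = mpow (fun i => f (y i)) m := by
  simp [mpow, Finsupp.prod, map_prod]

theorem mpow_nonneg {r : σ → ℝ} (hr : ∀ i, 0 ≤ r i) (m : σ →₀ ℕ) : 0 ≤ mpow r m :=
  Finset.prod_nonneg fun i _ => pow_nonneg (hr i) _

theorem mpow_le_mpow {r r' : σ → ℝ} (hr : ∀ i, 0 ≤ r i) (h : ∀ i, r i ≤ r' i) (m : σ →₀ ℕ) :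
    mpow r m ≤ mpow r' m :=
  Finset.prod_le_prod (fun i _ => pow_nonneg (hr i) _) fun i _ => pow_le_pow_left₀ (hr i) (h i) _

theorem norm_mpow_le {B : Type*} [NormedCommRing B] [NormOneClass B] (y : σ → B) {r : σ → ℝ}
    (h : ∀ i, ‖y i‖ ≤ r i) (m : σ →₀ ℕ) : ‖mpow y m‖ ≤ mpow r m := by
  refine (Finset.norm_prod_le _ _).trans (Finset.prod_le_prod (fun _ _ => norm_nonneg _) ?_)
  exact fun i _ => (norm_pow_le _ _).trans (pow_le_pow_left₀ (norm_nonneg _) (h i) _)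

end mpow

/-- Telescoping would produce the factor `n ρ^(n-1)`. Enlarging the radius by `e` absorbs the `n` at
the cost of `e⁻¹`, so the bound is again a pure power and can be summed against coefficients that
converge at the larger radius. -/
theorem norm_pow_sub_pow_le {B : Type*} [NormedCommRing B] [NormOneClass B] {y z : B} {ρ e : ℝ}
    (hy : ‖y‖ ≤ ρ) (hz : ‖z‖ ≤ ρ) (he : 0 < e) (n : ℕ) :
    ‖y ^ n - z ^ n‖ ≤ e⁻¹ * (ρ + e) ^ n * ‖y - z‖ := by
  have hρ : 0 ≤ ρ := (norm_nonneg y).trans hy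
  induction n with
  | zero => simp; positivity
  | succ n ih =>
    have h1 : y ^ (n + 1) - z ^ (n + 1) = (y ^ n - z ^ n) * y + z ^ n * (y - z) := by ring
    have h2 : ‖z ^ n‖ ≤ (ρ + e) ^ n :=
      (norm_pow_le z n).trans (pow_le_pow_left₀ (norm_nonneg _) (by linarith) _)
    calc ‖y ^ (n + 1) - z ^ (n + 1)‖ ≤ ‖y ^ n - z ^ n‖ * ‖y‖ + ‖z ^ n‖ * ‖y - z‖ := by
          rw [h1]; exact (norm_add_le _ _).trans (add_le_add (norm_mul_le _ _) (norm_mul_le _ _))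
      _ ≤ (e⁻¹ * (ρ + e) ^ n * ‖y - z‖) * ρ + (ρ + e) ^ n * ‖y - z‖ := by gcongr
      _ = e⁻¹ * (ρ + e) ^ (n + 1) * ‖y - z‖ := by field_simp; ring

theorem norm_mpow_sub_mpow_le {B : Type*} [NormedCommRing B] [NormOneClass B] {y z : Fin 2 → B}
    {ρ : Fin 2 → ℝ} {e D : ℝ} (hy : ∀ i, ‖y i‖ ≤ ρ i) (hz : ∀ i, ‖z i‖ ≤ ρ i) (he : 0 < e)
    (hD : ∀ i, ‖y i - z i‖ ≤ D) (m : Fin 2 →₀ ℕ) :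
    ‖mpow y m - mpow z m‖ ≤ 2 * e⁻¹ * mpow (fun i => ρ i + e) m * D := by
  have hρ : ∀ i, 0 ≤ ρ i := fun i => (norm_nonneg _).trans (hy i)
  have hD0 : 0 ≤ D := (norm_nonneg _).trans (hD 0)
  have key : ∀ i, ‖y i ^ m i - z i ^ m i‖ ≤ e⁻¹ * (ρ i + e) ^ m i * D := fun i =>
    (norm_pow_sub_pow_le (hy i) (hz i) he _).trans <| by
      have := hρ i
      gcongr
      exact hD i
  have hpow : ∀ {w : Fin 2 → B}, (∀ i, ‖w i‖ ≤ ρ i) → ∀ i, ‖w i ^ m i‖ ≤ (ρ i + e) ^ m i :=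
    fun hw i => (norm_pow_le _ _).trans (pow_le_pow_left₀ (norm_nonneg _) (by linarith [hw i]) _)
  simp only [mpow_fin_two]
  have h1 : y 0 ^ m 0 * y 1 ^ m 1 - z 0 ^ m 0 * z 1 ^ m 1
      = (y 0 ^ m 0 - z 0 ^ m 0) * y 1 ^ m 1 + z 0 ^ m 0 * (y 1 ^ m 1 - z 1 ^ m 1) := by ring
  rw [h1]
  have h0 := hρ 0
  have h1 := hρ 1
  calc _ ≤ ‖y 0 ^ m 0 - z 0 ^ m 0‖ * ‖y 1 ^ m 1‖ + ‖z 0 ^ m 0‖ * ‖y 1 ^ m 1 - z 1 ^ m 1‖ :=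
        (norm_add_le _ _).trans (add_le_add (norm_mul_le _ _) (norm_mul_le _ _))
    _ ≤ (e⁻¹ * (ρ 0 + e) ^ m 0 * D) * (ρ 1 + e) ^ m 1
        + (ρ 0 + e) ^ m 0 * (e⁻¹ * (ρ 1 + e) ^ m 1 * D) := by
        gcongr
        · exact key 0
        · exact hpow hy 1
        · exact hpow hz 0
        · exact key 1
    _ = _ := by ring

/-! ### Power series in several variables as analytic functions. -/

section analytic

variable {σ : Type*} [Fintype σ]

theorem finite_degree_eq (n : ℕ) : {m : σ →₀ ℕ | m.degree = n}.Finite := by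
  classical
  refine Set.Finite.subset (Finset.finite_toSet (Finset.univ.finsuppAntidiag n)) fun m hm => ?_
  simp only [Set.mem_ofPred_eq] at hm
  simp [Finset.mem_finsuppAntidiag, ← hm, Finsupp.degree_eq_sum]

theorem card_degree_eq_le (n : ℕ) :
    (finite_degree_eq (σ := σ) n).toFinset.card ≤ (n + 1) ^ Fintype.card σ := by
  classical
  have : (Fintype.card (σ → Fin (n + 1))) = (n + 1) ^ Fintype.card σ := by simp
  rw [← this, ← Finset.card_univ]
  refine Finset.card_le_card_of_injOn (fun m i => Fin.ofNat (n + 1) (m i)) (by simp) ?_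
  intro m hm m' hm' h
  simp only [Set.Finite.coe_toFinset, Set.mem_ofPred_eq] at hm hm'
  ext i
  have hi := congrArg Fin.val (congrFun h i)
  have h1 : m i < n + 1 := Nat.lt_succ_of_le (hm ▸ Finsupp.le_degree i m)
  have h2 : m' i < n + 1 := Nat.lt_succ_of_le (hm' ▸ Finsupp.le_degree i m')
  simpa [Fin.ofNat, Nat.mod_eq_of_lt h1, Nat.mod_eq_of_lt h2] using hi

/-- Grouping by degree leaves a geometric series with polynomial weights, since only polynomially
many exponents share a degree. -/
theorem summable_pow_degree {t : ℝ} (h0 : 0 ≤ t) (h1 : t < 1) :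
    Summable fun m : σ →₀ ℕ => t ^ m.degree := by
  rw [← (Equiv.sigmaFiberEquiv (Finsupp.degree (R := ℕ) (σ := σ))).summable_iff]
  rw [summable_sigma_of_nonneg fun _ => by simp; positivity]
  have hfin : ∀ n : ℕ, Finite {m : σ →₀ ℕ // m.degree = n} := fun n => finite_degree_eq n
  refine ⟨fun n => ?_, ?_⟩
  · exact Summable.of_finite
  · refine Summable.of_nonneg_of_le (g := fun n => _)
      (f := fun n : ℕ => ((n : ℝ) + 1) ^ Fintype.card σ * t ^ n)
      (fun n => tsum_nonneg fun _ => by simp; positivity) (fun n => ?_) ?_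
    · have : Fintype {m : σ →₀ ℕ // m.degree = n} := Fintype.ofFinite _
      rw [tsum_fintype]
      have : ∀ m : {m : σ →₀ ℕ // m.degree = n}, t ^ (m : σ →₀ ℕ).degree = t ^ n :=
        fun m => by rw [m.2]
      simp only [Function.comp_apply, Equiv.sigmaFiberEquiv_apply, this, Finset.sum_const,
        nsmul_eq_mul, Finset.card_univ]
      gcongr
      have h3 := card_degree_eq_le (σ := σ) n
      have h4 : Fintype.card {m : σ →₀ ℕ // m.degree = n}
          = (finite_degree_eq (σ := σ) n).toFinset.card :=
        Fintype.card_of_subtype _ fun m => by simp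
      rw [h4]
      exact_mod_cast h3
    · have := summable_pow_mul_geometric_of_norm_lt_one (Fintype.card σ)
        (show ‖t‖ < 1 by rwa [Real.norm_of_nonneg h0])
      rcases h0.eq_or_lt with rfl | h0
      · refine summable_of_ne_finset_zero (s := {0}) fun n hn => ?_
        simp at hn
        simp [hn]
      · have h2 := (summable_nat_add_iff 1).2 this
        refine (h2.mul_right t⁻¹).congr fun n => ?_
        rw [pow_succ]
        push_cast
        field_simp

variable {F : Type*} [NormedAddCommGroup F] [NormedSpace ℂ F]

/-- The exponent is spelled out as a word of length `n`, and the `k`-th argument contributes the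
coordinate named by the `k`-th letter. Without symmetrisation the norm bound carries no
combinatorial factor. -/
theorem exists_multilinear_mpow (m : σ →₀ ℕ) {n : ℕ} (hn : m.degree = n) (v : F) :
    ∃ p : ContinuousMultilinearMap ℂ (fun _ : Fin n => σ → ℂ) F,
      ‖p‖ ≤ ‖v‖ ∧ ∀ x, (p fun _ => x) = mpow x m • v := by
  classical
  have hlen : (Finsupp.toMultiset m).toList.length = n := by
    rw [Multiset.length_toList, Finsupp.card_toMultiset]; exact hn
  let w : Fin n → σ := fun k => (Finsupp.toMultiset m).toList.get (k.cast hlen.symm)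
  let p := ((ContinuousMultilinearMap.mkPiAlgebraFin ℂ n ℂ).compContinuousLinearMap
    fun k => ContinuousLinearMap.proj (φ := fun _ : σ => ℂ) (R := ℂ) (w k)).smulRight v
  have hp : ∀ y, p y = (∏ k, y k (w k)) • v := fun y => by
    simp [p, List.prod_ofFn]
  refine ⟨p, ContinuousMultilinearMap.opNorm_le_bound (norm_nonneg _) fun y => ?_, fun x => ?_⟩
  · rw [hp, norm_smul, norm_prod, mul_comm]
    gcongr with k
    exact norm_le_pi_norm _ _
  · rw [hp]
    congr 1
    have h1 : ∏ k, x (w k) = ((Finsupp.toMultiset m).toList.map x).prod := by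
      rw [← List.prod_ofFn]
      congr 1
      apply List.ext_getElem
      · simp [hlen]
      · intro k h1 h2
        simp [w]
    rw [h1, ← Multiset.prod_coe, ← Multiset.map_coe, Multiset.coe_toList, Finsupp.toMultiset_map,
      Finsupp.prod_toMultiset, Finsupp.prod_mapDomain_index (by simp) (by simp [pow_add])]
    rfl

/-- The Cauchy-type bound gives absolute convergence at every radius below `s`; collecting monomials
of equal degree then yields a `FormalMultilinearSeries`. -/
theorem analyticOnNhd_tsum_mpow [CompleteSpace F] (T : (σ →₀ ℕ) → F) {s K : ℝ} (hs : 0 < s)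
    (hT : ∀ m, ‖T m‖ * s ^ m.degree ≤ K) :
    AnalyticOnNhd ℂ (fun x : σ → ℂ => ∑' m, mpow x m • T m) (Metric.ball 0 s) := by
  choose P hP hPx using fun (n : ℕ) (m : {m : σ →₀ ℕ // m.degree = n}) =>
    exists_multilinear_mpow (σ := σ) m.1 m.2 (T m)
  have hfin : ∀ n : ℕ, Finite {m : σ →₀ ℕ // m.degree = n} := fun n => finite_degree_eq n
  have : ∀ n : ℕ, Fintype {m : σ →₀ ℕ // m.degree = n} := fun n => Fintype.ofFinite _
  let p : FormalMultilinearSeries ℂ (σ → ℂ) F := fun n => ∑ m, P n m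
  let e := Equiv.sigmaFiberEquiv (Finsupp.degree (R := ℕ) (σ := σ))
  have hTr : ∀ {r : ℝ}, 0 ≤ r → ∀ m, ‖T m‖ * r ^ m.degree ≤ K * (r / s) ^ m.degree := by
    intro r hr m
    have : ‖T m‖ * r ^ m.degree = (‖T m‖ * s ^ m.degree) * (r / s) ^ m.degree := by
      rw [div_pow]; field_simp
    rw [this]
    gcongr
    exact hT m
  have hsum : ∀ {r : ℝ}, 0 ≤ r → r < s → Summable fun m => ‖T m‖ * r ^ m.degree := by
    intro r hr hrs
    exact Summable.of_nonneg_of_le (fun _ => by positivity) (hTr hr)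
      ((summable_pow_degree (by positivity) ((div_lt_one hs).2 hrs)).mul_left K)
  have hball : HasFPowerSeriesOnBall (fun x : σ → ℂ => ∑' m, mpow x m • T m) p 0
      (ENNReal.ofReal s) := by
    refine ⟨?_, by simpa using hs, ?_⟩
    · refine ENNReal.le_of_forall_nnreal_lt fun r hr => p.le_radius_of_summable_norm ?_
      have hr' : (r : ℝ) < s := by
        rw [← ENNReal.ofReal_coe_nnreal] at hr
        exact (ENNReal.ofReal_lt_ofReal_iff hs).1 hr
      have h1 := ((e.summable_iff).2 (hsum r.2 hr')).sigma
      refine Summable.of_nonneg_of_le (fun _ => by positivity) (fun n => ?_) h1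
      rw [tsum_fintype]
      calc ‖p n‖ * (r : ℝ) ^ n ≤ (∑ m, ‖P n m‖) * (r : ℝ) ^ n := by
            gcongr; exact norm_sum_le _ _
        _ ≤ (∑ m : {m : σ →₀ ℕ // m.degree = n}, ‖T m‖) * (r : ℝ) ^ n := by
            gcongr with m; exact hP n m
        _ = _ := by
            rw [Finset.sum_mul]
            refine Finset.sum_congr rfl fun m _ => ?_
            simp [e, m.2]
    · intro y hy
      have hy' : ‖y‖ < s := by
        rw [Metric.mem_eball, edist_zero_right, ← ofReal_norm] at hy
        exact (ENNReal.ofReal_lt_ofReal_iff hs).1 hy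
      have h0 : Summable fun m => mpow y m • T m := by
        refine Summable.of_norm_bounded (hsum (norm_nonneg y) hy') fun m => ?_
        rw [norm_smul, mul_comm, ← mpow_const]
        gcongr
        exact norm_mpow_le _ (fun i => norm_le_pi_norm y i) m
      have h1 := ((e.hasSum_iff).2 h0.hasSum).sigma (fun n => hasSum_fintype _)
      rw [zero_add]
      convert h1 using 2 with n
      simp [p, hPx, e]
  have := hball.analyticOnNhd
  rwa [Metric.eball_ofReal] at this

end analytic

/-! ### The Banach algebra of power series with absolutely summable coefficients. -/

section AbsSeriesDef

variable (σ C : Type*) [NormedCommRing C] [NormedAlgebra ℂ C]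

/-- The power series with absolutely summable coefficients. -/
noncomputable def absSubalgebra : Subalgebra ℂ (MvPowerSeries σ C) where
  carrier := {φ | Summable fun m => ‖MvPowerSeries.coeff m φ‖}
  mul_mem' {φ ψ} hφ hψ := by
    classical
    have := summable_sum_mul_antidiagonal_of_summable_mul
      (Summable.mul_of_nonneg hφ hψ (fun _ => norm_nonneg _) fun _ => norm_nonneg _)
    refine this.of_nonneg_of_le (fun _ => norm_nonneg _) fun m => ?_
    rw [MvPowerSeries.coeff_mul]
    exact (norm_sum_le _ _).trans (Finset.sum_le_sum fun _ _ => norm_mul_le _ _)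
  add_mem' {φ ψ} hφ hψ := by
    refine (Summable.add hφ hψ).of_nonneg_of_le (fun _ => norm_nonneg _) fun m => ?_
    rw [map_add]
    exact norm_add_le _ _
  algebraMap_mem' r := by
    classical
    refine summable_of_ne_finset_zero (s := {0}) fun m hm => ?_
    rw [Finset.mem_singleton] at hm
    rw [MvPowerSeries.algebraMap_apply, MvPowerSeries.coeff_C, if_neg hm, norm_zero]

/-- The algebra of power series with absolutely summable coefficients. -/
def AbsSeries : Type _ := absSubalgebra σ C

end AbsSeriesDef

namespace AbsSeries

variable {σ C : Type*} [NormedCommRing C] [NormedAlgebra ℂ C]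

noncomputable instance : CommRing (AbsSeries σ C) := inferInstanceAs (CommRing (absSubalgebra σ C))

noncomputable instance : Algebra ℂ (AbsSeries σ C) :=
  inferInstanceAs (Algebra ℂ (absSubalgebra σ C))

/-- The coefficient of the monomial `m`. -/
noncomputable def coeff (φ : AbsSeries σ C) (m : σ →₀ ℕ) : C := MvPowerSeries.coeff m φ.1

/-- The series with given coefficients. -/
def mk (c : (σ →₀ ℕ) → C) (hc : Summable fun m => ‖c m‖) : AbsSeries σ C := ⟨c, hc⟩

@[simp] theorem coeff_mk (c : (σ →₀ ℕ) → C) (hc) (m) : (mk c hc).coeff m = c m := rfl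

@[ext] theorem ext {φ ψ : AbsSeries σ C} (h : ∀ m, φ.coeff m = ψ.coeff m) : φ = ψ :=
  Subtype.ext (MvPowerSeries.ext h)

theorem summable_norm_coeff (φ : AbsSeries σ C) : Summable fun m => ‖φ.coeff m‖ := φ.2

@[simp] theorem coeff_zero (m) : (0 : AbsSeries σ C).coeff m = 0 := rfl
@[simp] theorem coeff_add (φ ψ : AbsSeries σ C) (m) :
    (φ + ψ).coeff m = φ.coeff m + ψ.coeff m := rfl
@[simp] theorem coeff_neg (φ : AbsSeries σ C) (m) : (-φ).coeff m = -φ.coeff m := rfl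
@[simp] theorem coeff_sub (φ ψ : AbsSeries σ C) (m) :
    (φ - ψ).coeff m = φ.coeff m - ψ.coeff m := by
  rw [sub_eq_add_neg, coeff_add, coeff_neg, ← sub_eq_add_neg]
@[simp] theorem coeff_smul (r : ℂ) (φ : AbsSeries σ C) (m) : (r • φ).coeff m = r • φ.coeff m := rfl

theorem coeff_mul [DecidableEq σ] (φ ψ : AbsSeries σ C) (m) :
    (φ * ψ).coeff m = ∑ k ∈ Finset.HasAntidiagonal.antidiagonal m, φ.coeff k.1 * ψ.coeff k.2 :=
  MvPowerSeries.coeff_mul _ _ _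

theorem coeff_one [DecidableEq σ] (m) : (1 : AbsSeries σ C).coeff m = if m = 0 then 1 else 0 :=
  MvPowerSeries.coeff_one _

noncomputable instance : Norm (AbsSeries σ C) := ⟨fun φ => ∑' m, ‖φ.coeff m‖⟩

theorem norm_def (φ : AbsSeries σ C) : ‖φ‖ = ∑' m, ‖φ.coeff m‖ := rfl

theorem norm_coeff_le (φ : AbsSeries σ C) (m) : ‖φ.coeff m‖ ≤ ‖φ‖ :=
  φ.summable_norm_coeff.le_tsum m fun _ _ => norm_nonneg _

noncomputable instance : NormedAddCommGroup (AbsSeries σ C) :=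
  AddGroupNorm.toNormedAddCommGroup
    { toFun := fun φ => ‖φ‖
      map_zero' := by simp [norm_def]
      add_le' := fun φ ψ => by
        rw [norm_def, norm_def, norm_def, ← φ.summable_norm_coeff.tsum_add ψ.summable_norm_coeff]
        exact (φ + ψ).summable_norm_coeff.tsum_le_tsum (fun m => norm_add_le _ _)
          (φ.summable_norm_coeff.add ψ.summable_norm_coeff)
      neg' := fun φ => by simp [norm_def]
      eq_zero_of_map_eq_zero' := fun φ h => by
        ext m
        have := norm_coeff_le φ m
        rw [show ‖φ‖ = 0 from h] at this
        simpa using this }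

theorem norm_mul_le_mul (φ ψ : AbsSeries σ C) : ‖φ * ψ‖ ≤ ‖φ‖ * ‖ψ‖ := by
  classical
  have h0 : Summable fun x : (σ →₀ ℕ) × (σ →₀ ℕ) => ‖φ.coeff x.1‖ * ‖ψ.coeff x.2‖ :=
    Summable.mul_of_nonneg φ.summable_norm_coeff ψ.summable_norm_coeff
      (fun _ => norm_nonneg _) fun _ => norm_nonneg _
  have h1 : ‖φ‖ * ‖ψ‖ = ∑' m, ∑ k ∈ Finset.HasAntidiagonal.antidiagonal m,
      ‖φ.coeff k.1‖ * ‖ψ.coeff k.2‖ :=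
    Summable.tsum_mul_tsum_eq_tsum_sum_antidiagonal φ.summable_norm_coeff ψ.summable_norm_coeff h0
  have h2 : Summable fun m => ∑ k ∈ Finset.HasAntidiagonal.antidiagonal m,
      ‖φ.coeff k.1‖ * ‖ψ.coeff k.2‖ :=
    summable_sum_mul_antidiagonal_of_summable_mul (f := fun m => ‖φ.coeff m‖)
      (g := fun m => ‖ψ.coeff m‖) h0
  rw [h1]
  refine (φ * ψ).summable_norm_coeff.tsum_le_tsum (fun m => ?_) h2
  rw [coeff_mul]
  exact (norm_sum_le _ _).trans (Finset.sum_le_sum fun _ _ => norm_mul_le _ _)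

noncomputable instance : NormedCommRing (AbsSeries σ C) where
  __ := (inferInstance : NormedAddCommGroup (AbsSeries σ C))
  __ := (inferInstance : CommRing (AbsSeries σ C))
  norm_mul_le := norm_mul_le_mul

noncomputable instance : NormedAlgebra ℂ (AbsSeries σ C) where
  norm_smul_le r φ := by
    rw [norm_def, norm_def, ← tsum_mul_left]
    exact (r • φ).summable_norm_coeff.tsum_le_tsum (fun m => norm_smul_le r (φ.coeff m))
      (φ.summable_norm_coeff.mul_left _)

theorem norm_eq_of_support {φ : AbsSeries σ C} {n : σ →₀ ℕ} (h : ∀ m ≠ n, φ.coeff m = 0) :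
    ‖φ‖ = ‖φ.coeff n‖ := by
  rw [norm_def, tsum_eq_single n]
  intro m hm
  rw [h m hm, norm_zero]

instance [NormOneClass C] : NormOneClass (AbsSeries σ C) where
  norm_one := by
    classical
    rw [norm_eq_of_support (n := 0)]
    · simp [coeff_one]
    · intro m hm
      simp [coeff_one, hm]

/-- The coefficient map is an isometric bijection onto `lp _ 1`, from which completeness is
transported. -/
instance [CompleteSpace C] : CompleteSpace (AbsSeries σ C) := by
  let e : AbsSeries σ C → lp (fun _ : σ →₀ ℕ => C) 1 := fun φ =>
    ⟨φ.coeff, memℓp_gen (by simpa using φ.summable_norm_coeff)⟩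
  have hnorm : ∀ ψ : lp (fun _ : σ →₀ ℕ => C) 1, ‖ψ‖ = ∑' m, ‖ψ m‖ := fun ψ => by
    rw [lp.norm_eq_tsum_rpow (by simp)]
    simp
  have he : Isometry e := by
    refine Isometry.of_dist_eq fun φ ψ => ?_
    rw [dist_eq_norm, dist_eq_norm, hnorm, norm_def]
    refine tsum_congr fun m => ?_
    rw [coeff_sub]
    rfl
  refine (completeSpace_congr (e := Equiv.ofBijective e ⟨he.injective, fun ψ => ?_⟩)
    he.isUniformEmbedding).2 inferInstance
  have h := (lp.memℓp ψ).summable (by simp)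
  simp only [ENNReal.toReal_one, Real.rpow_one] at h
  exact ⟨mk ψ h, rfl⟩

/-- The constant series. -/
noncomputable def const : C →+* AbsSeries σ C where
  toFun c := ⟨MvPowerSeries.C c, by
    classical
    refine summable_of_ne_finset_zero (s := {0}) fun m hm => ?_
    rw [Finset.mem_singleton] at hm
    rw [MvPowerSeries.coeff_C, if_neg hm, norm_zero]⟩
  map_one' := Subtype.ext (map_one _)
  map_mul' _ _ := Subtype.ext (map_mul _ _ _)
  map_zero' := Subtype.ext (map_zero _)
  map_add' _ _ := Subtype.ext (map_add _ _ _)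

theorem coeff_const [DecidableEq σ] (c : C) (m) :
    (const c : AbsSeries σ C).coeff m = if m = 0 then c else 0 :=
  MvPowerSeries.coeff_C _ _

@[simp] theorem coeff_const_mul (c : C) (φ : AbsSeries σ C) (m) :
    (const c * φ).coeff m = c * φ.coeff m :=
  MvPowerSeries.coeff_C_mul _ _ _

@[simp] theorem norm_const (c : C) : ‖(const c : AbsSeries σ C)‖ = ‖c‖ := by
  classical
  rw [norm_eq_of_support (n := 0)]
  · simp [coeff_const]
  · intro m hm
    simp [coeff_const, hm]

theorem norm_const_mul_le (c : C) (φ : AbsSeries σ C) : ‖const c * φ‖ ≤ ‖c‖ * ‖φ‖ := by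
  simpa using norm_mul_le (const c) φ

/-- The variables. -/
noncomputable def X (i : σ) : AbsSeries σ C := ⟨MvPowerSeries.X i, by
  classical
  refine summable_of_ne_finset_zero (s := {Finsupp.single i 1}) fun m hm => ?_
  rw [Finset.mem_singleton] at hm
  rw [MvPowerSeries.coeff_X, if_neg hm, norm_zero]⟩

theorem coeff_X [DecidableEq σ] (i : σ) (m) :
    (X i : AbsSeries σ C).coeff m = if m = Finsupp.single i 1 then 1 else 0 :=
  MvPowerSeries.coeff_X _ _

@[simp] theorem norm_X [NormOneClass C] (i : σ) : ‖(X i : AbsSeries σ C)‖ = 1 := by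
  classical
  rw [norm_eq_of_support (n := Finsupp.single i 1)]
  · simp [coeff_X]
  · intro m hm
    simp [coeff_X, hm]

open Classical in
/-- The truncation of a series to the monomials in `T`. -/
noncomputable def restrict (T : Set (σ →₀ ℕ)) (φ : AbsSeries σ C) : AbsSeries σ C :=
  mk (fun m => if m ∈ T then φ.coeff m else 0) <|
    φ.summable_norm_coeff.of_nonneg_of_le (fun _ => norm_nonneg _) fun m => by
      split_ifs <;> simp

open Classical in
theorem coeff_restrict (T : Set (σ →₀ ℕ)) (φ : AbsSeries σ C) (m) :
    (restrict T φ).coeff m = if m ∈ T then φ.coeff m else 0 := rfl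

theorem norm_restrict_le (T : Set (σ →₀ ℕ)) (φ : AbsSeries σ C) : ‖restrict T φ‖ ≤ ‖φ‖ := by
  refine (restrict T φ).summable_norm_coeff.tsum_le_tsum (fun m => ?_) φ.summable_norm_coeff
  rw [coeff_restrict]
  split_ifs <;> simp

theorem restrict_sub (T : Set (σ →₀ ℕ)) (φ ψ : AbsSeries σ C) :
    restrict T (φ - ψ) = restrict T φ - restrict T ψ := by
  ext m
  simp only [coeff_restrict, coeff_sub]
  split_ifs <;> simp

/-- The continuous linear form reading off a coefficient. -/
noncomputable def coeffCLM (m : σ →₀ ℕ) : AbsSeries σ C →L[ℂ] C :=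
  LinearMap.mkContinuous ⟨⟨fun φ => φ.coeff m, fun _ _ => rfl⟩, fun _ _ => rfl⟩ 1
    fun φ => (norm_coeff_le φ m).trans_eq (one_mul _).symm

@[simp] theorem coeffCLM_apply (m : σ →₀ ℕ) (φ : AbsSeries σ C) : coeffCLM m φ = φ.coeff m := rfl

theorem norm_coeffCLM_le (m : σ →₀ ℕ) : ‖(coeffCLM m : AbsSeries σ C →L[ℂ] C)‖ ≤ 1 :=
  LinearMap.mkContinuous_norm_le _ zero_le_one _

/-- Support conditions are intersections of kernels of continuous functionals; this makes the set on
which the contraction acts complete. -/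
theorem isClosed_support_subset (T : Set (σ →₀ ℕ)) :
    IsClosed {φ : AbsSeries σ C | ∀ m, φ.coeff m ≠ 0 → m ∈ T} := by
  have : {φ : AbsSeries σ C | ∀ m, φ.coeff m ≠ 0 → m ∈ T}
      = ⋂ m ∈ Tᶜ, {φ : AbsSeries σ C | coeffCLM m φ = 0} := by
    ext φ
    simp [not_imp_comm]
  rw [this]
  exact isClosed_biInter fun m _ => isClosed_eq (coeffCLM m).continuous continuous_const

section eval

variable {D : Type*} [NormedCommRing D] [NormOneClass D]

theorem summable_eval (χ : C →+* D) (hχ : ∀ c, ‖χ c‖ ≤ ‖c‖) {x : σ → D} (hx : ∀ i, ‖x i‖ ≤ 1)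
    (φ : AbsSeries σ C) : Summable fun m => ‖χ (φ.coeff m) * mpow x m‖ := by
  refine φ.summable_norm_coeff.of_nonneg_of_le (fun _ => norm_nonneg _) fun m => ?_
  refine (norm_mul_le _ _).trans ?_
  calc _ ≤ ‖φ.coeff m‖ * mpow (fun _ => 1) m := by
        gcongr
        · exact hχ _
        · exact norm_mpow_le _ hx m
    _ = _ := by rw [mpow_const, one_pow, mul_one]

variable [CompleteSpace D]

theorem eval_mul (χ : C →+* D) (hχ : ∀ c, ‖χ c‖ ≤ ‖c‖) {x : σ → D} (hx : ∀ i, ‖x i‖ ≤ 1)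
    (φ ψ : AbsSeries σ C) : ∑' m, χ ((φ * ψ).coeff m) * mpow x m
      = (∑' m, χ (φ.coeff m) * mpow x m) * ∑' m, χ (ψ.coeff m) * mpow x m := by
  classical
  have hφ := summable_eval χ hχ hx φ
  have hψ := summable_eval χ hχ hx ψ
  have h0 : Summable fun k : (σ →₀ ℕ) × (σ →₀ ℕ) =>
      (χ (φ.coeff k.1) * mpow x k.1) * (χ (ψ.coeff k.2) * mpow x k.2) :=
    summable_mul_of_summable_norm (f := fun m => χ (φ.coeff m) * mpow x m)
      (g := fun m => χ (ψ.coeff m) * mpow x m) hφ hψ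
  rw [Summable.tsum_mul_tsum_eq_tsum_sum_antidiagonal
    (f := fun m => χ (φ.coeff m) * mpow x m) (g := fun m => χ (ψ.coeff m) * mpow x m)
    hφ.of_norm hψ.of_norm h0]
  refine tsum_congr fun m => ?_
  rw [coeff_mul, map_sum, Finset.sum_mul]
  refine Finset.sum_congr rfl fun k hk => ?_
  rw [← Finset.HasAntidiagonal.mem_antidiagonal.1 hk, mpow_add, map_mul]
  ring

/-- Evaluation of a series at a point of the closed unit polydisk, the coefficients being mapped
by `χ`. -/
noncomputable def evalHom (χ : C →+* D) (hχ : ∀ c, ‖χ c‖ ≤ ‖c‖) (x : σ → D)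
    (hx : ∀ i, ‖x i‖ ≤ 1) : AbsSeries σ C →+* D where
  toFun φ := ∑' m, χ (φ.coeff m) * mpow x m
  map_zero' := by simp
  map_add' φ ψ := by
    rw [← (summable_eval χ hχ hx φ).of_norm.tsum_add (summable_eval χ hχ hx ψ).of_norm]
    simp [add_mul]
  map_one' := by
    classical
    rw [tsum_eq_single 0]
    · simp [coeff_one, mpow_zero]
    · intro m hm
      simp [coeff_one, hm]
  map_mul' φ ψ := eval_mul χ hχ hx φ ψ

variable (χ : C →+* D) (hχ : ∀ c, ‖χ c‖ ≤ ‖c‖) (x : σ → D) (hx : ∀ i, ‖x i‖ ≤ 1)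

theorem evalHom_apply (φ : AbsSeries σ C) :
    evalHom χ hχ x hx φ = ∑' m, χ (φ.coeff m) * mpow x m := rfl

theorem norm_evalHom_le (φ : AbsSeries σ C) : ‖evalHom χ hχ x hx φ‖ ≤ ‖φ‖ := by
  refine tsum_of_norm_bounded φ.summable_norm_coeff.hasSum fun m => (norm_mul_le _ _).trans ?_
  calc _ ≤ ‖φ.coeff m‖ * mpow (fun _ => 1) m := by
        gcongr
        · exact hχ _
        · exact norm_mpow_le _ hx m
    _ = _ := by rw [mpow_const, one_pow, mul_one]

theorem continuous_evalHom : Continuous (evalHom χ hχ x hx) :=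
  AddMonoidHomClass.continuous_of_bound (evalHom χ hχ x hx) 1
    fun φ => by simpa using norm_evalHom_le χ hχ x hx φ

@[simp] theorem evalHom_const (c : C) : evalHom χ hχ x hx (const c) = χ c := by
  classical
  rw [evalHom_apply, tsum_eq_single 0]
  · simp [coeff_const, mpow_zero]
  · intro m hm
    simp [coeff_const, hm]

@[simp] theorem evalHom_X (i : σ) : evalHom χ hχ x hx (X i) = x i := by
  classical
  rw [evalHom_apply, tsum_eq_single (Finsupp.single i 1)]
  · simp [coeff_X, mpow_single]
  · intro m hm
    simp [coeff_X, hm]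

end eval

end AbsSeries

/-! ### Weights of exponents and the filtration they define. -/

/-- The value of the linear functional `v` at the exponent `m`. -/
def wt (v : Fin 2 → ℤ) (m : Fin 2 →₀ ℕ) : ℤ := v 0 * m 0 + v 1 * m 1

theorem wt_zero (v : Fin 2 → ℤ) : wt v 0 = 0 := by simp [wt]

theorem wt_add (v : Fin 2 → ℤ) (m n : Fin 2 →₀ ℕ) : wt v (m + n) = wt v m + wt v n := by
  simp [wt]; ring

theorem wt_single (v : Fin 2 → ℤ) (i : Fin 2) : wt v (Finsupp.single i 1) = v i := by
  fin_cases i <;> simp [wt]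

section OrdGE

variable {C : Type*}

/-- All monomials `m` with nonzero coefficient satisfy `a ≤ v(m)`. -/
def OrdGE [Zero C] (v : Fin 2 → ℤ) (a : ℤ) (c : (Fin 2 →₀ ℕ) → C) : Prop :=
  ∀ m, c m ≠ 0 → a ≤ wt v m

variable {v : Fin 2 → ℤ} {a b : ℤ}

theorem OrdGE.mono [Zero C] {c : (Fin 2 →₀ ℕ) → C} (h : OrdGE v a c) (hab : b ≤ a) : OrdGE v b c :=
  fun m hm => hab.trans (h m hm)

variable [NormedCommRing C] [NormedAlgebra ℂ C] {φ ψ : AbsSeries (Fin 2) C}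

theorem OrdGE.add (hφ : OrdGE v a φ.coeff) (hψ : OrdGE v a ψ.coeff) : OrdGE v a (φ + ψ).coeff := by
  intro m hm
  by_cases h : φ.coeff m = 0
  · exact hψ m (by simpa [h] using hm)
  · exact hφ m h

theorem OrdGE.neg (hφ : OrdGE v a φ.coeff) : OrdGE v a (-φ).coeff :=
  fun m hm => hφ m (by simpa using hm)

theorem OrdGE.sub (hφ : OrdGE v a φ.coeff) (hψ : OrdGE v a ψ.coeff) : OrdGE v a (φ - ψ).coeff := by
  rw [sub_eq_add_neg]
  exact hφ.add hψ.neg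

theorem OrdGE.mul (hφ : OrdGE v a φ.coeff) (hψ : OrdGE v b ψ.coeff) :
    OrdGE v (a + b) (φ * ψ).coeff := by
  intro m hm
  rw [AbsSeries.coeff_mul] at hm
  obtain ⟨k, hk, hne⟩ := Finset.exists_ne_zero_of_sum_ne_zero hm
  rw [← Finset.HasAntidiagonal.mem_antidiagonal.1 hk, wt_add]
  exact add_le_add (hφ _ (left_ne_zero_of_mul hne)) (hψ _ (right_ne_zero_of_mul hne))

theorem OrdGE.const_mul (c : C) (hφ : OrdGE v a φ.coeff) :
    OrdGE v a (AbsSeries.const c * φ).coeff := fun m hm =>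
  hφ m (right_ne_zero_of_mul (by simpa using hm))

theorem ordGE_one : OrdGE v 0 (1 : AbsSeries (Fin 2) C).coeff := by
  intro m hm
  rw [AbsSeries.coeff_one] at hm
  obtain rfl : m = 0 := by by_contra h; simp [h] at hm
  rw [wt_zero]

theorem ordGE_X (i : Fin 2) : OrdGE v (v i) (AbsSeries.X i : AbsSeries (Fin 2) C).coeff := by
  intro m hm
  rw [AbsSeries.coeff_X] at hm
  obtain rfl : m = Finsupp.single i 1 := by by_contra h; simp [h] at hm
  rw [wt_single]

theorem OrdGE.pow (hφ : OrdGE v a φ.coeff) (n : ℕ) : OrdGE v (n * a) (φ ^ n).coeff := by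
  induction n with
  | zero => simpa using ordGE_one
  | succ n ih =>
    rw [pow_succ]
    convert ih.mul hφ using 1
    push_cast
    ring

theorem OrdGE.mpow {y : Fin 2 → AbsSeries (Fin 2) C} (h : ∀ j, OrdGE v (v j) (y j).coeff)
    (m : Fin 2 →₀ ℕ) : OrdGE v (wt v m) (mpow y m).coeff := by
  rw [mpow_fin_two, show wt v m = m 0 * v 0 + m 1 * v 1 by simp [wt]; ring]
  exact ((h 0).pow _).mul ((h 1).pow _)

theorem OrdGE.restrict (hφ : OrdGE v a φ.coeff) (T : Set (Fin 2 →₀ ℕ)) :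
    OrdGE v a (AbsSeries.restrict T φ).coeff := by
  intro m hm
  rw [AbsSeries.coeff_restrict] at hm
  exact hφ m fun h => hm (by simp [h])

/-- Coefficients are continuous, so a vanishing coefficient survives an infinite sum; a divergent
sum is `0` by convention and satisfies the condition trivially. -/
theorem OrdGE.tsum {ι : Type*} {f : ι → AbsSeries (Fin 2) C} (h : ∀ i, OrdGE v a (f i).coeff) :
    OrdGE v a (∑' i, f i).coeff := by
  by_cases hf : Summable f
  · intro m hm
    by_contra hlt
    apply hm
    have h1 := (AbsSeries.coeffCLM m).map_tsum hf
    rw [AbsSeries.coeffCLM_apply] at h1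
    rw [h1]
    have : ∀ i, AbsSeries.coeffCLM m (f i) = 0 := fun i => by
      by_contra hne
      exact hlt (h i m hne)
    simp [this]
  · rw [tsum_eq_zero_of_not_summable hf]
    intro m hm
    simp at hm

end OrdGE

/-! ### Substitution of series and the contraction argument. -/

section substitution

variable {C : Type*} [NormedCommRing C] [NormedAlgebra ℂ C]

/-- Substitution of `y` into the power series with coefficients `c`. -/
noncomputable def subst (c : (Fin 2 →₀ ℕ) → C) (y : Fin 2 → AbsSeries (Fin 2) C) :
    AbsSeries (Fin 2) C :=
  ∑' m, AbsSeries.const (c m) * mpow y m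

/-- If each `y j` has at least the weight of the variable it replaces, then `y^m` has at least the
weight of `m`. This is why weight conditions are stable under composition with maps near a diagonal
one. -/
theorem OrdGE.subst {v : Fin 2 → ℤ} {a : ℤ} {c : (Fin 2 →₀ ℕ) → C}
    {y : Fin 2 → AbsSeries (Fin 2) C} (hc : OrdGE v a c) (h : ∀ j, OrdGE v (v j) (y j).coeff) :
    OrdGE v a (subst c y).coeff := by
  refine OrdGE.tsum fun m => ?_
  by_cases hm : c m = 0
  · intro n hn
    simp [hm] at hn
  · exact ((OrdGE.mpow h m).mono (hc m hm)).const_mul _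

variable {c c' : (Fin 2 →₀ ℕ) → C} {y z : Fin 2 → AbsSeries (Fin 2) C} {W : (Fin 2 →₀ ℕ) → ℝ}

theorem norm_subst_term_le {u : AbsSeries (Fin 2) C} {m : Fin 2 →₀ ℕ} (hy : c m ≠ 0 → ‖u‖ ≤ W m) :
    ‖AbsSeries.const (c m) * u‖ ≤ ‖c m‖ * W m := by
  by_cases hm : c m = 0
  · simp [hm]
  · refine (AbsSeries.norm_const_mul_le _ _).trans ?_
    gcongr
    exact hy hm

theorem norm_subst_le (hW : Summable fun m => ‖c m‖ * W m)
    (hy : ∀ m, c m ≠ 0 → ‖mpow y m‖ ≤ W m) : ‖subst c y‖ ≤ ∑' m, ‖c m‖ * W m :=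
  tsum_of_norm_bounded hW.hasSum fun m => norm_subst_term_le (hy m)

variable [CompleteSpace C]

theorem summable_subst (hW : Summable fun m => ‖c m‖ * W m)
    (hy : ∀ m, c m ≠ 0 → ‖mpow y m‖ ≤ W m) :
    Summable fun m => AbsSeries.const (c m) * mpow y m :=
  Summable.of_norm_bounded hW fun m => norm_subst_term_le (hy m)

theorem norm_subst_sub_le {W' : (Fin 2 →₀ ℕ) → ℝ} (hW : Summable fun m => ‖c m‖ * W m)
    (hy : ∀ m, c m ≠ 0 → ‖mpow y m‖ ≤ W m) (hz : ∀ m, c m ≠ 0 → ‖mpow z m‖ ≤ W m)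
    (hW' : Summable fun m => ‖c m‖ * W' m)
    (hyz : ∀ m, c m ≠ 0 → ‖mpow y m - mpow z m‖ ≤ W' m) :
    ‖subst c y - subst c z‖ ≤ ∑' m, ‖c m‖ * W' m := by
  rw [subst, subst, ← (summable_subst hW hy).tsum_sub (summable_subst hW hz)]
  refine tsum_of_norm_bounded hW'.hasSum fun m => ?_
  rw [← mul_sub]
  exact norm_subst_term_le (hyz m)

theorem subst_sub_subst (hW : Summable fun m => ‖c m‖ * W m)
    (hy : ∀ m, c m ≠ 0 → ‖mpow y m‖ ≤ W m) (hW' : Summable fun m => ‖c' m‖ * W m)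
    (hy' : ∀ m, c' m ≠ 0 → ‖mpow y m‖ ≤ W m) :
    subst c y - subst c' y = subst (c - c') y := by
  rw [subst, subst, ← (summable_subst hW hy).tsum_sub (summable_subst hW' hy')]
  simp [subst, sub_mul]

/-- The contraction behind both the normal form and the inversion of families of maps. -/
theorem exists_fixedPoint [NormOneClass C] (V : Set (Fin 2 → ℤ))
    (S S' P : Fin 2 → Set (Fin 2 →₀ ℕ)) (ν β μ : Fin 2 → C) (F : Fin 2 → (Fin 2 →₀ ℕ) → C)
    {η e θ L κ E : ℝ} (ρ : Fin 2 → ℝ) (hη : 0 < η) (he : 0 < e) (hθ : 0 ≤ θ)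
    (hL : ∀ i, ‖ν i‖ + ‖β i‖ * η ≤ L) (hκ : ∀ i, ‖β i‖ ≤ κ) (hρ : ∀ i, ‖μ i‖ + η ≤ ρ i)
    (hS' : ∀ i, ∀ m ∈ S' i, (∀ v ∈ V, v i + 1 ≤ wt v m) →
      ‖β i‖ * mpow (fun j => ρ j + e) m ≤ θ)
    (hF : ∀ i, Summable fun m => ‖F i m‖ * (L + 1) ^ m.degree)
    (hE : ∀ i, ∑' m, ‖F i m‖ * (L + 1) ^ m.degree ≤ E)
    (hFV : ∀ v ∈ V, ∀ i, OrdGE v (v i + 1) (F i))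
    (hball : E + θ * η ≤ η) (hlip : 2 * E * κ + θ + 2 * e⁻¹ * θ * η < 1) :
    ∃ Φ : Fin 2 → AbsSeries (Fin 2) C, (∀ i, ‖Φ i‖ ≤ η) ∧
      (∀ v ∈ V, ∀ i, OrdGE v (v i + 1) (Φ i).coeff) ∧
      (∀ i, Summable fun m => AbsSeries.const (F i m) * mpow (fun j =>
        AbsSeries.const (ν j) * AbsSeries.X j
          + AbsSeries.const (β j) * AbsSeries.restrict (S j) (Φ j)) m) ∧
      (∀ i, Summable fun m => AbsSeries.const
        ((AbsSeries.const (β i) * AbsSeries.restrict (S' i) (Φ i)).coeff m) * mpow (fun j =>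
          AbsSeries.const (μ j) * AbsSeries.X j + AbsSeries.restrict (P j) (Φ j)) m) ∧
      ∀ i, Φ i = subst (F i) (fun j => AbsSeries.const (ν j) * AbsSeries.X j
            + AbsSeries.const (β j) * AbsSeries.restrict (S j) (Φ j))
          - subst (AbsSeries.const (β i) * AbsSeries.restrict (S' i) (Φ i)).coeff
            (fun j => AbsSeries.const (μ j) * AbsSeries.X j + AbsSeries.restrict (P j) (Φ j)) := by
  -- In the normal form application `H` is the coordinate change, `G` the conjugated map and `c` the
  -- nonlinear part of the coordinate change, all read off from the single unknown `Φ`.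
  set H : (Fin 2 → AbsSeries (Fin 2) C) → Fin 2 → AbsSeries (Fin 2) C := fun Φ j =>
    AbsSeries.const (ν j) * AbsSeries.X j
      + AbsSeries.const (β j) * AbsSeries.restrict (S j) (Φ j) with hH
  set G : (Fin 2 → AbsSeries (Fin 2) C) → Fin 2 → AbsSeries (Fin 2) C := fun Φ j =>
    AbsSeries.const (μ j) * AbsSeries.X j + AbsSeries.restrict (P j) (Φ j) with hG
  set c : (Fin 2 → AbsSeries (Fin 2) C) → Fin 2 → (Fin 2 →₀ ℕ) → C := fun Φ i =>
    (AbsSeries.const (β i) * AbsSeries.restrict (S' i) (Φ i)).coeff with hc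
  set T : (Fin 2 → AbsSeries (Fin 2) C) → Fin 2 → AbsSeries (Fin 2) C := fun Φ i =>
    subst (F i) (H Φ) - subst (c Φ i) (G Φ) with hT
  set s : Set (Fin 2 → AbsSeries (Fin 2) C) := {Φ | (∀ i, ‖Φ i‖ ≤ η) ∧
    (∀ v ∈ V, ∀ i, OrdGE v (v i + 1) (Φ i).coeff)} with hs
  have hE0 : 0 ≤ E := le_trans (tsum_nonneg fun m => by
    have : 0 ≤ L := le_trans (by positivity) (hL 0)
    positivity) (hE 0)
  have hHn : ∀ Φ ∈ s, ∀ j, ‖H Φ j‖ ≤ L := fun Φ hΦ j => by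
    refine (norm_add_le _ _).trans (le_trans (add_le_add ((AbsSeries.norm_const_mul_le _ _).trans
      ?_) ((AbsSeries.norm_const_mul_le _ _).trans ?_)) (hL j))
    · simp
    · gcongr
      exact (AbsSeries.norm_restrict_le _ _).trans (hΦ.1 j)
  have hGn : ∀ Φ ∈ s, ∀ j, ‖G Φ j‖ ≤ ρ j := fun Φ hΦ j => by
    refine (norm_add_le _ _).trans (le_trans (add_le_add ((AbsSeries.norm_const_mul_le _ _).trans
      ?_) ((AbsSeries.norm_restrict_le _ _).trans (hΦ.1 j))) (hρ j))
    simp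
  have hHV : ∀ Φ ∈ s, ∀ v ∈ V, ∀ j, OrdGE v (v j) (H Φ j).coeff := fun Φ hΦ v hv j =>
    ((ordGE_X j).const_mul _).add
      ((((hΦ.2 v hv j).mono (by linarith)).restrict _).const_mul _)
  have hGV : ∀ Φ ∈ s, ∀ v ∈ V, ∀ j, OrdGE v (v j) (G Φ j).coeff := fun Φ hΦ v hv j =>
    ((ordGE_X j).const_mul _).add (((hΦ.2 v hv j).mono (by linarith)).restrict _)
  have hLnn : 0 ≤ L := le_trans (by positivity) (hL 0)
  have hρnn : ∀ j, 0 ≤ ρ j := fun j => le_trans (by positivity) (hρ j)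
  -- norms of the substituted monomials
  have hHm : ∀ Φ ∈ s, ∀ m, ‖mpow (H Φ) m‖ ≤ (L + 1) ^ m.degree := fun Φ hΦ m => by
    rw [← mpow_const]
    exact norm_mpow_le _ (fun j => (hHn Φ hΦ j).trans (by linarith)) m
  have hGm : ∀ Φ ∈ s, ∀ m, ‖mpow (G Φ) m‖ ≤ mpow (fun j => ρ j + e) m := fun Φ hΦ m =>
    norm_mpow_le _ (fun j => (hGn Φ hΦ j).trans (by linarith)) m
  -- The spectral gap enters here. A nonzero coefficient of `Φ i` sits at an exponent satisfying
  -- every weight condition, so `hS'` applies, and composing with `G` costs only the factor `θ` per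
  -- coefficient.
  have hcb : ∀ Φ : Fin 2 → AbsSeries (Fin 2) C, (∀ v ∈ V, ∀ i, OrdGE v (v i + 1) (Φ i).coeff) →
      ∀ i m, ‖c Φ i m‖ * mpow (fun j => ρ j + e) m ≤ θ * ‖(Φ i).coeff m‖ := fun Φ hΦ i m => by
    simp only [hc, AbsSeries.coeff_const_mul, AbsSeries.coeff_restrict]
    by_cases hm : m ∈ S' i
    · by_cases h0 : (Φ i).coeff m = 0
      · simp [h0]
      · rw [if_pos hm]
        have h1 := hS' i m hm fun v hv => hΦ v hv i m h0
        have h2 : 0 ≤ mpow (fun j => ρ j + e) m :=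
          mpow_nonneg (fun j => by have := hρnn j; positivity) m
        calc _ ≤ ‖β i‖ * ‖(Φ i).coeff m‖ * mpow (fun j => ρ j + e) m := by
              gcongr; exact norm_mul_le _ _
          _ = (‖β i‖ * mpow (fun j => ρ j + e) m) * ‖(Φ i).coeff m‖ := by ring
          _ ≤ _ := by gcongr
    · simp [hm]; positivity
  have hmn : ∀ m, 0 ≤ mpow (fun j => ρ j + e) m := fun m =>
    mpow_nonneg (fun j => by have := hρnn j; positivity) m
  have hcs : ∀ Φ : Fin 2 → AbsSeries (Fin 2) C, (∀ v ∈ V, ∀ i, OrdGE v (v i + 1) (Φ i).coeff) →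
      ∀ i, Summable fun m => ‖c Φ i m‖ * mpow (fun j => ρ j + e) m := fun Φ hΦ i =>
    ((Φ i).summable_norm_coeff.mul_left θ).of_nonneg_of_le
      (fun m => mul_nonneg (norm_nonneg _) (hmn m)) (hcb Φ hΦ i)
  have hct : ∀ Φ : Fin 2 → AbsSeries (Fin 2) C, (∀ v ∈ V, ∀ i, OrdGE v (v i + 1) (Φ i).coeff) →
      ∀ i, ∑' m, ‖c Φ i m‖ * mpow (fun j => ρ j + e) m ≤ θ * ‖Φ i‖ := fun Φ hΦ i => by
    rw [AbsSeries.norm_def, ← tsum_mul_left]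
    exact (hcs Φ hΦ i).tsum_le_tsum (hcb Φ hΦ i) ((Φ i).summable_norm_coeff.mul_left θ)
  have hmaps : Set.MapsTo T s s := fun Φ hΦ => by
    refine ⟨fun i => ?_, fun v hv i => ?_⟩
    · have h1 := norm_subst_le (hF i) fun m _ => hHm Φ hΦ m
      have h2 := norm_subst_le (hcs Φ hΦ.2 i) fun m _ => hGm Φ hΦ m
      have h3 := hct Φ hΦ.2 i
      have h4 : θ * ‖Φ i‖ ≤ θ * η := by gcongr; exact hΦ.1 i
      exact (norm_sub_le _ _).trans (by linarith [hE i])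
    · exact ((hFV v hv i).subst (hHV Φ hΦ v hv)).sub
        (OrdGE.subst (((hΦ.2 v hv i).restrict _).const_mul _) (hGV Φ hΦ v hv))
  -- The summands are the variations of `F ∘ H` through `H`, of the outer series `c` with `G` fixed,
  -- and of the inner map `G` with `c` fixed.
  set K : ℝ := 2 * E * κ + θ + 2 * e⁻¹ * θ * η with hK
  have hκ0 : 0 ≤ κ := (norm_nonneg _).trans (hκ 0)
  have hK0 : 0 ≤ K := by positivity
  have hdist : ∀ Φ ∈ s, ∀ Ψ ∈ s, dist (T Φ) (T Ψ) ≤ K * dist Φ Ψ := fun Φ hΦ Ψ hΨ => by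
    set D := dist Φ Ψ with hD
    have hD0 : 0 ≤ D := dist_nonneg
    have hDi : ∀ i, ‖Φ i - Ψ i‖ ≤ D := fun i => by
      rw [← dist_eq_norm]; exact dist_le_pi_dist Φ Ψ i
    have hHd : ∀ j, ‖H Φ j - H Ψ j‖ ≤ κ * D := fun j => by
      simp only [hH, add_sub_add_left_eq_sub, ← mul_sub, ← AbsSeries.restrict_sub]
      refine (AbsSeries.norm_const_mul_le _ _).trans ?_
      gcongr
      · exact hκ j
      · exact (AbsSeries.norm_restrict_le _ _).trans (hDi j)
    have hGd : ∀ j, ‖G Φ j - G Ψ j‖ ≤ D := fun j => by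
      simp only [hG, add_sub_add_left_eq_sub, ← AbsSeries.restrict_sub]
      exact (AbsSeries.norm_restrict_le _ _).trans (hDi j)
    refine (dist_pi_le_iff (by positivity)).2 fun i => ?_
    have e1 : T Φ i - T Ψ i = (subst (F i) (H Φ) - subst (F i) (H Ψ))
        - (subst (c Φ i) (G Φ) - subst (c Ψ i) (G Φ))
        - (subst (c Ψ i) (G Φ) - subst (c Ψ i) (G Ψ)) := by
      simp only [hT]; ring
    have b1 : ‖subst (F i) (H Φ) - subst (F i) (H Ψ)‖ ≤ 2 * E * κ * D := by
      have hw : ∀ m, ‖F i m‖ * (2 * (1 : ℝ)⁻¹ * mpow (fun _ => L + 1) m * (κ * D))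
          = ‖F i m‖ * (L + 1) ^ m.degree * (2 * κ * D) := fun m => by
        rw [mpow_const]; ring
      refine (norm_subst_sub_le (hF i) (fun m _ => hHm Φ hΦ m) (fun m _ => hHm Ψ hΨ m) ?_
        fun m _ => norm_mpow_sub_mpow_le (hHn Φ hΦ) (hHn Ψ hΨ) one_pos hHd m).trans ?_
      · simp only [hw]
        exact (hF i).mul_right _
      · simp only [hw]
        rw [tsum_mul_right]
        calc _ ≤ E * (2 * κ * D) := by gcongr; exact hE i
          _ = _ := by ring
    -- For fixed `G` the expression is linear in the outer series, and `Φ - Ψ` satisfies the same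
    -- weight conditions; hence the estimate `hct` applies to the difference directly.
    have b2 : ‖subst (c Φ i) (G Φ) - subst (c Ψ i) (G Φ)‖ ≤ θ * D := by
      have hΔ : ∀ v ∈ V, ∀ i, OrdGE v (v i + 1) ((Φ - Ψ) i).coeff := fun v hv i =>
        (hΦ.2 v hv i).sub (hΨ.2 v hv i)
      have hcΔ : c Φ i - c Ψ i = c (Φ - Ψ) i := by
        ext m
        simp only [hc, Pi.sub_apply, AbsSeries.restrict_sub, mul_sub, AbsSeries.coeff_sub]
      rw [subst_sub_subst (hcs Φ hΦ.2 i) (fun m _ => hGm Φ hΦ m) (hcs Ψ hΨ.2 i)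
        (fun m _ => hGm Φ hΦ m), hcΔ]
      refine (norm_subst_le (hcs _ hΔ i) fun m _ => hGm Φ hΦ m).trans ((hct _ hΔ i).trans ?_)
      gcongr
      exact hDi i
    have b3 : ‖subst (c Ψ i) (G Φ) - subst (c Ψ i) (G Ψ)‖ ≤ 2 * e⁻¹ * θ * η * D := by
      have hw : ∀ m, ‖c Ψ i m‖ * (2 * e⁻¹ * mpow (fun j => ρ j + e) m * D)
          = ‖c Ψ i m‖ * mpow (fun j => ρ j + e) m * (2 * e⁻¹ * D) := fun m => by ring
      refine (norm_subst_sub_le (hcs Ψ hΨ.2 i) (fun m _ => hGm Φ hΦ m) (fun m _ => hGm Ψ hΨ m) ?_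
        fun m _ => norm_mpow_sub_mpow_le (hGn Φ hΦ) (hGn Ψ hΨ) he hGd m).trans ?_
      · simp only [hw]
        exact (hcs Ψ hΨ.2 i).mul_right _
      · simp only [hw]
        rw [tsum_mul_right]
        calc _ ≤ (θ * η) * (2 * e⁻¹ * D) := by
              gcongr
              refine (hct Ψ hΨ.2 i).trans ?_
              gcongr
              exact hΨ.1 i
          _ = _ := by ring
    rw [dist_eq_norm, e1]
    calc _ ≤ 2 * E * κ * D + θ * D + 2 * e⁻¹ * θ * η * D :=
          (norm_sub_le _ _).trans (add_le_add ((norm_sub_le _ _).trans (add_le_add b1 b2)) b3)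
      _ = K * D := by rw [hK]; ring
  have hclosed : IsClosed s := by
    have : s = (⋂ i, {Φ : Fin 2 → AbsSeries (Fin 2) C | ‖Φ i‖ ≤ η}) ∩ ⋂ v ∈ V, ⋂ i,
        (fun Φ : Fin 2 → AbsSeries (Fin 2) C => Φ i) ⁻¹'
          {φ | ∀ m, φ.coeff m ≠ 0 → m ∈ {m | v i + 1 ≤ wt v m}} := by
      ext Φ
      simp [hs, OrdGE]
    rw [this]
    refine (isClosed_iInter fun i => isClosed_le (by fun_prop) continuous_const).inter ?_
    exact isClosed_biInter fun v _ => isClosed_iInter fun i =>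
      (AbsSeries.isClosed_support_subset _).preimage (continuous_apply i)
  have hcontr : ContractingWith K.toNNReal (hmaps.restrict T s s) := by
    refine ⟨by simpa using hlip, LipschitzWith.of_dist_le_mul ?_⟩
    rintro ⟨Φ, hΦ⟩ ⟨Ψ, hΨ⟩
    rw [Real.coe_toNNReal _ hK0]
    exact hdist Φ hΦ Ψ hΨ
  have h0 : (0 : Fin 2 → AbsSeries (Fin 2) C) ∈ s :=
    ⟨fun i => by simpa using hη.le, fun v _ i m hm => by simp at hm⟩
  obtain ⟨Φ, hΦ, hfix, -⟩ := hcontr.exists_fixedPoint' hclosed.isComplete hmaps h0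
    (edist_ne_top _ _)
  exact ⟨Φ, hΦ.1, hΦ.2, fun i => summable_subst (hF i) fun m _ => hHm Φ hΦ m,
    fun i => summable_subst (hcs Φ hΦ.2 i) fun m _ => hGm Φ hΦ m, fun i => (congrFun hfix i).symm⟩

end substitution

/-! ### Convergent series over a coefficient algebra and their specialisation by characters. -/

section families

variable {C : Type*} [NormedCommRing C]

/-- The power series with coefficients `c` converges absolutely on the polydisk of radius `s`. -/
def Conv (s : ℝ) (c : (Fin 2 →₀ ℕ) → C) : Prop := Summable fun m => ‖c m‖ * s ^ m.degree

theorem degree_fin_two (m : Fin 2 →₀ ℕ) : m.degree = m 0 + m 1 := by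
  rw [Finsupp.degree_eq_sum, Fin.sum_univ_two]

theorem wt_one (m : Fin 2 →₀ ℕ) : wt (fun _ => 1) m = m.degree := by
  simp [wt, degree_fin_two]

/-- Each occurring monomial has degree at least `n`, so shrinking the radius from `s` to `t` gains
`(t / s) ^ n`. With `n = 2` this makes nonlinear terms small relative to the radius. -/
theorem Conv.bound {s t : ℝ} {c : (Fin 2 →₀ ℕ) → C} (h : Conv s c) (n : ℕ)
    (hc : OrdGE (fun _ => 1) n c) (ht : 0 ≤ t) (hs : 0 < s) (hts : t ≤ s) :
    Conv t c ∧ ∑' m, ‖c m‖ * t ^ m.degree ≤ (t / s) ^ n * ∑' m, ‖c m‖ * s ^ m.degree := by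
  have key : ∀ m, ‖c m‖ * t ^ m.degree ≤ (t / s) ^ n * (‖c m‖ * s ^ m.degree) := fun m => by
    by_cases h0 : c m = 0
    · simp [h0]
    · have h1 := hc m h0
      rw [wt_one] at h1
      have h2 : (t / s) ^ m.degree ≤ (t / s) ^ n :=
        pow_le_pow_of_le_one (by positivity) ((div_le_one hs).2 hts) (by exact_mod_cast h1)
      calc ‖c m‖ * t ^ m.degree = (t / s) ^ m.degree * (‖c m‖ * s ^ m.degree) := by
            rw [div_pow]; field_simp
        _ ≤ _ := by gcongr
  have hconv : Conv t c :=
    (Summable.mul_left ((t / s) ^ n) h).of_nonneg_of_le (fun _ => by positivity) key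
  refine ⟨hconv, ?_⟩
  rw [← tsum_mul_left]
  exact Summable.tsum_le_tsum key hconv (Summable.mul_left _ h)

theorem Conv.mono {s t : ℝ} {c : (Fin 2 →₀ ℕ) → C} (h : Conv s c) (ht : 0 ≤ t) (hts : t ≤ s) :
    Conv t c :=
  Summable.of_nonneg_of_le (fun _ => by positivity) (fun m => by gcongr) h

theorem Conv.of_norm_le {s : ℝ} (hs : 0 ≤ s) {c c' : (Fin 2 →₀ ℕ) → C} (h : Conv s c) {K : ℝ}
    (hc : ∀ m, ‖c' m‖ ≤ K * ‖c m‖) : Conv s c' :=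
  (Summable.mul_left K h).of_nonneg_of_le (fun _ => by positivity) fun m => by
    rw [← mul_assoc]
    gcongr
    exact hc m

variable [NormedAlgebra ℂ C]

/-- The value at `x` of the power series with coefficients `c`, specialised by `χ`. -/
noncomputable def fval (χ : C →ₐ[ℂ] ℂ) (c : (Fin 2 →₀ ℕ) → C) (x : Fin 2 → ℂ) : ℂ :=
  ∑' m, χ (c m) * mpow x m

/-- The map with linear part `diag ν` and nonlinear part `c`. -/
noncomputable def mapOf (χ : C →ₐ[ℂ] ℂ) (ν : Fin 2 → C) (c : Fin 2 → (Fin 2 →₀ ℕ) → C)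
    (x : Fin 2 → ℂ) : Fin 2 → ℂ :=
  fun i => χ (ν i) * x i + fval χ (c i) x

/-- The coefficients of `r⁻¹ φ(r x)`. -/
noncomputable def rescale (r : ℝ) (c : (Fin 2 →₀ ℕ) → C) (m : Fin 2 →₀ ℕ) : C :=
  ((r ^ m.degree * r⁻¹ : ℝ) : ℂ) • c m

theorem rescale_rescale_inv {r : ℝ} (hr : 0 < r) (c : (Fin 2 →₀ ℕ) → C) :
    rescale r (rescale r⁻¹ c) = c := by
  ext m
  rw [rescale, rescale, smul_smul, ← Complex.ofReal_mul]
  have : r ^ m.degree * r⁻¹ * (r⁻¹ ^ m.degree * r⁻¹⁻¹) = 1 := by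
    rw [inv_pow]; field_simp
  rw [this, Complex.ofReal_one, one_smul]

theorem rescale_mul_indicator {r : ℝ} (hr : 0 < r) (b : C) (S : Set (Fin 2 →₀ ℕ))
    (φ : AbsSeries (Fin 2) C) (m : Fin 2 →₀ ℕ) :
    rescale r (fun m => b * S.indicator (rescale r⁻¹ φ.coeff) m) m
      = (AbsSeries.const b * AbsSeries.restrict S φ).coeff m := by
  classical
  rw [AbsSeries.coeff_const_mul, AbsSeries.coeff_restrict]
  by_cases hm : m ∈ S
  · have h := congrFun (rescale_rescale_inv hr φ.coeff) m
    rw [rescale] at h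
    simp only [rescale, Set.indicator_of_mem hm, if_pos hm] at h ⊢
    rw [← mul_smul_comm, h]
  · simp [rescale, hm]

theorem norm_rescale {r : ℝ} (hr : 0 < r) (c : (Fin 2 →₀ ℕ) → C) (m) :
    ‖rescale r c m‖ = r ^ m.degree * r⁻¹ * ‖c m‖ := by
  rw [rescale, norm_smul, Complex.norm_real, Real.norm_of_nonneg (by positivity)]

theorem rescale_ne_zero {r : ℝ} {c : (Fin 2 →₀ ℕ) → C} {m} (h : rescale r c m ≠ 0) : c m ≠ 0 :=
  fun h0 => h (by simp [rescale, h0])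

theorem mpow_smul (r : ℂ) (x : Fin 2 → ℂ) (m : Fin 2 →₀ ℕ) :
    mpow (r • x) m = r ^ m.degree * mpow x m := by
  have : r • x = (fun _ => r) * x := by ext i; simp
  rw [this, mpow_mul, mpow_const]

theorem fval_rescale (χ : C →ₐ[ℂ] ℂ) (r : ℝ) (c : (Fin 2 →₀ ℕ) → C) (x : Fin 2 → ℂ) :
    fval χ (rescale r c) x = (r : ℂ)⁻¹ * fval χ c ((r : ℂ) • x) := by
  rw [fval, fval, ← tsum_mul_left]
  refine tsum_congr fun m => ?_
  rw [rescale, map_smul, mpow_smul]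
  push_cast
  simp only [smul_eq_mul]
  ring

theorem mapOf_rescale (χ : C →ₐ[ℂ] ℂ) {r : ℝ} (hr : 0 < r) (ν : Fin 2 → C)
    (c : Fin 2 → (Fin 2 →₀ ℕ) → C) (x : Fin 2 → ℂ) :
    (r : ℂ) • mapOf χ ν (fun i => rescale r (c i)) x = mapOf χ ν c ((r : ℂ) • x) := by
  ext i
  have hr' : (r : ℂ) ≠ 0 := by exact_mod_cast hr.ne'
  simp only [mapOf, fval_rescale, Pi.smul_apply, smul_eq_mul]
  field_simp

variable [CompleteSpace C] [NormOneClass C]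

theorem norm_char_le (χ : C →ₐ[ℂ] ℂ) (c : C) : ‖χ c‖ ≤ ‖c‖ := AlgHom.norm_apply_le_self χ c

theorem norm_char_coe_le (χ : C →ₐ[ℂ] ℂ) (c : C) : ‖(χ : C →+* ℂ) c‖ ≤ ‖c‖ := norm_char_le χ c

theorem norm_fval_term_le (χ : C →ₐ[ℂ] ℂ) (c : (Fin 2 →₀ ℕ) → C) {x : Fin 2 → ℂ} {t : ℝ}
    (hx : ∀ i, ‖x i‖ ≤ t) (m) : ‖χ (c m) * mpow x m‖ ≤ ‖c m‖ * t ^ m.degree := by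
  rw [norm_mul, ← mpow_const]
  gcongr
  · exact norm_char_le χ _
  · exact norm_mpow_le _ hx m

theorem Conv.summable_fval {c : (Fin 2 →₀ ℕ) → C} {t : ℝ} (h : Conv t c) (χ : C →ₐ[ℂ] ℂ)
    {x : Fin 2 → ℂ} (hx : ∀ i, ‖x i‖ ≤ t) : Summable fun m => χ (c m) * mpow x m :=
  Summable.of_norm_bounded h (norm_fval_term_le χ c hx)

theorem Conv.norm_fval_le {c : (Fin 2 →₀ ℕ) → C} {t : ℝ} (h : Conv t c) (χ : C →ₐ[ℂ] ℂ)
    {x : Fin 2 → ℂ} (hx : ∀ i, ‖x i‖ ≤ t) : ‖fval χ c x‖ ≤ ∑' m, ‖c m‖ * t ^ m.degree :=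
  tsum_of_norm_bounded h.hasSum (norm_fval_term_le χ c hx)

/-- Conjugating by `x ↦ r x` leaves linear parts unchanged and makes a nonlinearity of order two
`O(r)`, which puts it within reach of `exists_fixedPoint` on the unit polydisk. The solution is
scaled back, and the identity between series turns into an identity between functions because
evaluation at a point, composed with a character, is a continuous ring homomorphism. -/
theorem exists_functional_solution (V : Set (Fin 2 → ℤ)) (hV : (fun _ => 1) ∈ V)
    (S S' P : Fin 2 → Set (Fin 2 →₀ ℕ)) (ν β μ : Fin 2 → C) (F : Fin 2 → (Fin 2 →₀ ℕ) → C)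
    {s θ : ℝ} (hs : 0 < s) (hF : ∀ i, Conv s (F i)) (hFV : ∀ v ∈ V, ∀ i, OrdGE v (v i + 1) (F i))
    (ρ : Fin 2 → ℝ) (hρ : ∀ i, ‖μ i‖ < ρ i) (hθ0 : 0 ≤ θ) (hθ : θ < 1)
    (hS' : ∀ i, ∀ m ∈ S' i, (∀ v ∈ V, v i + 1 ≤ wt v m) → ‖β i‖ * mpow ρ m ≤ θ) :
    ∃ r > 0, ∃ Φ : Fin 2 → (Fin 2 →₀ ℕ) → C, (∀ i, Conv r (Φ i)) ∧
      (∀ v ∈ V, ∀ i, OrdGE v (v i + 1) (Φ i)) ∧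
      ∀ (χ : C →ₐ[ℂ] ℂ) (x : Fin 2 → ℂ), (∀ i, ‖x i‖ ≤ r) → ∀ i,
        fval χ (Φ i) x
          = fval χ (F i) (mapOf χ ν (fun j m => β j * (S j).indicator (Φ j) m) x)
          - fval χ (fun m => β i * (S' i).indicator (Φ i) m)
              (mapOf χ μ (fun j => (P j).indicator (Φ j)) x) := by
  classical
  obtain ⟨κ, hκ0, hκ⟩ : ∃ κ : ℝ, 0 ≤ κ ∧ ∀ i, ‖β i‖ ≤ κ :=
    ⟨‖β‖, norm_nonneg _, norm_le_pi_norm β⟩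
  -- The gap between `‖μ i‖` and `ρ i` is split in half: one half allows a perturbation of size `η ≤
  -- e`, the other is the radius loss in the Lipschitz estimate for monomials.
  obtain ⟨e, he, heρ⟩ : ∃ e : ℝ, 0 < e ∧ ∀ i, ‖μ i‖ + e ≤ ρ i - e := by
    refine ⟨min (ρ 0 - ‖μ 0‖) (ρ 1 - ‖μ 1‖) / 2, ?_, ?_⟩
    · have h0 := hρ 0
      have h1 := hρ 1
      have : 0 < min (ρ 0 - ‖μ 0‖) (ρ 1 - ‖μ 1‖) := lt_min (by linarith) (by linarith)
      positivity
    · rw [Fin.forall_fin_two]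
      constructor
      · linarith [min_le_left (ρ 0 - ‖μ 0‖) (ρ 1 - ‖μ 1‖)]
      · linarith [min_le_right (ρ 0 - ‖μ 0‖) (ρ 1 - ‖μ 1‖)]
  -- This size makes the third summand of the Lipschitz constant at most `(1 - θ) / 4`; `E` below
  -- does the same for the first, so that the total stays below one.
  set η : ℝ := min (min e 1) (e * (1 - θ) / 8) with hη
  have hη0 : 0 < η := lt_min (lt_min he one_pos) (by have : 0 < 1 - θ := by linarith
                                                     positivity)
  have hηe : η ≤ e := (min_le_left _ _).trans (min_le_left _ _)
  have hη1 : η ≤ 1 := (min_le_left _ _).trans (min_le_right _ _)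
  have hηθ : 2 * e⁻¹ * θ * η ≤ (1 - θ) / 4 := by
    have h1 : e⁻¹ * η ≤ (1 - θ) / 8 := by
      rw [inv_mul_le_iff₀ he]
      exact (min_le_right _ _).trans_eq (by ring)
    calc 2 * e⁻¹ * θ * η = 2 * (e⁻¹ * η) * θ := by ring
      _ ≤ 2 * ((1 - θ) / 8) * 1 := by
          have : 0 ≤ e⁻¹ * η := by positivity
          gcongr
      _ = _ := by ring
  set L : ℝ := ‖ν‖ + κ with hLdef
  have hL0 : 0 ≤ L := by positivity
  set E : ℝ := min ((1 - θ) * η) ((1 - θ) / (8 * (κ + 1))) with hE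
  have hE0 : 0 < E := lt_min (by have : 0 < 1 - θ := by linarith
                                 positivity) (by have : 0 < 1 - θ := by linarith
                                                 positivity)
  have hEκ : 2 * E * κ ≤ (1 - θ) / 4 := by
    have h1 : E * (8 * (κ + 1)) ≤ 1 - θ := by
      rw [← le_div_iff₀ (by positivity)]
      exact min_le_right _ _
    nlinarith
  obtain ⟨M, hM0, hM⟩ : ∃ M : ℝ, 0 ≤ M ∧ ∀ i, ∑' m, ‖F i m‖ * s ^ m.degree ≤ M := by
    refine ⟨max (∑' m, ‖F 0 m‖ * s ^ m.degree) (∑' m, ‖F 1 m‖ * s ^ m.degree), ?_, ?_⟩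
    · exact le_max_of_le_left (tsum_nonneg fun m => by positivity)
    · rw [Fin.forall_fin_two]
      exact ⟨le_max_left _ _, le_max_right _ _⟩
  -- After rescaling, the series `F` at radius `L + 1` has norm at most `r⁻¹ (r (L + 1) / s)² M`.
  -- This is linear in `r`, which is then taken small enough to bring it below `E`.
  obtain ⟨r, hr0, hr1, hr2⟩ : ∃ r : ℝ, 0 < r ∧ r * (L + 1) ≤ s ∧
      r * ((L + 1) / s) ^ 2 * M ≤ E := by
    refine ⟨min (s / (L + 1)) (E / (((L + 1) / s) ^ 2 * M + 1)), ?_, ?_, ?_⟩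
    · exact lt_min (by positivity) (by positivity)
    · rw [← le_div_iff₀ (by positivity)]
      exact min_le_left _ _
    · have h1 : min (s / (L + 1)) (E / (((L + 1) / s) ^ 2 * M + 1))
          * (((L + 1) / s) ^ 2 * M + 1) ≤ E := by
        rw [← le_div_iff₀ (by positivity)]
        exact min_le_right _ _
      have h2 : 0 < min (s / (L + 1)) (E / (((L + 1) / s) ^ 2 * M + 1)) :=
        lt_min (by positivity) (by positivity)
      nlinarith
  have hb := fun i => (hF i).bound (t := r * (L + 1)) 2 (hFV _ hV i) (by positivity) hs hr1
  have hterm : ∀ i m, ‖rescale r (F i) m‖ * (L + 1) ^ m.degree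
      = r⁻¹ * (‖F i m‖ * (r * (L + 1)) ^ m.degree) := fun i m => by
    rw [norm_rescale hr0, mul_pow]; ring
  have hL : ∀ i, ‖ν i‖ + ‖β i‖ * η ≤ L := by
    intro i
    calc ‖ν i‖ + ‖β i‖ * η ≤ ‖ν‖ + κ * 1 := by
          gcongr
          · exact norm_le_pi_norm ν i
          · exact hκ i
      _ = L := by rw [hLdef, mul_one]
  have hSθ : ∀ i, ∀ m ∈ S' i, (∀ v ∈ V, v i + 1 ≤ wt v m) →
      ‖β i‖ * mpow (fun j => ρ j - e + e) m ≤ θ := by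
    intro i m hm hv
    simpa using hS' i m hm hv
  have hFs : ∀ i, Summable fun m => ‖rescale r (F i) m‖ * (L + 1) ^ m.degree := by
    intro i
    simp only [hterm]
    exact Summable.mul_left _ (hb i).1
  have hFE : ∀ i, ∑' m, ‖rescale r (F i) m‖ * (L + 1) ^ m.degree ≤ E := by
    intro i
    simp only [hterm, tsum_mul_left]
    calc _ ≤ r⁻¹ * ((r * (L + 1) / s) ^ 2 * M) := by
          gcongr
          exact (hb i).2.trans (by gcongr; exact hM i)
      _ = r * ((L + 1) / s) ^ 2 * M := by field_simp
      _ ≤ E := hr2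
  have hrV : ∀ v ∈ V, ∀ i, OrdGE v (v i + 1) (rescale r (F i)) := by
    exact fun v hv i m hm => hFV v hv i m (rescale_ne_zero hm)
  have hball : E + θ * η ≤ η := by
    have := min_le_left ((1 - θ) * η) ((1 - θ) / (8 * (κ + 1)))
    rw [← hE] at this
    linarith
  have hlip : 2 * E * κ + θ + 2 * e⁻¹ * θ * η < 1 := by
    linarith
  obtain ⟨Φ, -, hΦV, hs1, hs2, hΦ⟩ := exists_fixedPoint V S S' P ν β μ
    (fun i => rescale r (F i)) (η := η) (e := e) (θ := θ) (L := L) (κ := κ) (E := E)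
    (fun i => ρ i - e) hη0 he hθ0 hL hκ (fun i => by linarith [heρ i]) hSθ hFs hFE hrV hball hlip
  refine ⟨r, hr0, fun i => rescale r⁻¹ (Φ i).coeff, fun i => ?_, fun v hv i m hm => ?_, ?_⟩
  · refine ((Φ i).summable_norm_coeff.mul_left r).congr fun m => ?_
    rw [norm_rescale (by positivity), inv_pow]
    field_simp
  · exact hΦV v hv i m (rescale_ne_zero hm)
  · intro χ x hx i
    set y : Fin 2 → ℂ := (r : ℂ)⁻¹ • x with hy
    have hr' : (r : ℂ) ≠ 0 := by exact_mod_cast hr0.ne'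
    have hxy : x = (r : ℂ) • y := by rw [hy, smul_smul, mul_inv_cancel₀ hr', one_smul]
    have hy1 : ∀ i, ‖y i‖ ≤ 1 := fun i => by
      simp only [hy, Pi.smul_apply, smul_eq_mul, norm_mul, norm_inv, Complex.norm_real,
        Real.norm_of_nonneg hr0.le]
      rw [inv_mul_le_iff₀ hr0, mul_one]
      exact hx i
    obtain ⟨ev, hevc, hevf, hevC, hevX⟩ : ∃ ev : AbsSeries (Fin 2) C →+* ℂ, Continuous ev ∧
        (∀ φ, ev φ = fval χ φ.coeff y) ∧ (∀ c, ev (AbsSeries.const c) = χ c) ∧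
        ∀ j, ev (AbsSeries.X j) = y j :=
      ⟨AbsSeries.evalHom (χ : C →+* ℂ) (norm_char_coe_le χ) y hy1,
        AbsSeries.continuous_evalHom _ _ _ _, fun _ => rfl,
        fun c => AbsSeries.evalHom_const _ _ _ _ c, fun j => AbsSeries.evalHom_X _ _ _ _ j⟩
    have hsub : ∀ (c : (Fin 2 →₀ ℕ) → C) (z : Fin 2 → AbsSeries (Fin 2) C),
        (Summable fun m => AbsSeries.const (c m) * mpow z m) →
        ev (subst c z) = fval χ c fun j => ev (z j) := fun c z h => by
      have h1 := h.map_tsum ev hevc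
      rw [subst, h1, fval]
      refine tsum_congr fun m => ?_
      rw [map_mul, map_mpow, hevC]
    have h1 := congrArg ev (hΦ i)
    rw [map_sub, hsub _ _ (hs1 i), hsub _ _ (hs2 i), hevf] at h1
    have e1 : (fun j => ev (AbsSeries.const (ν j) * AbsSeries.X j
          + AbsSeries.const (β j) * AbsSeries.restrict (S j) (Φ j)))
        = mapOf χ ν (fun j => rescale r fun m =>
            β j * (S j).indicator (rescale r⁻¹ (Φ j).coeff) m) y := by
      ext j
      rw [map_add, map_mul, hevC, hevX, hevf]
      simp only [mapOf]
      congr 2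
      ext m
      exact (rescale_mul_indicator hr0 (β j) (S j) (Φ j) m).symm
    have e2 : (fun j => ev (AbsSeries.const (μ j) * AbsSeries.X j
          + AbsSeries.restrict (P j) (Φ j)))
        = mapOf χ μ (fun j => rescale r ((P j).indicator (rescale r⁻¹ (Φ j).coeff))) y := by
      ext j
      rw [map_add, map_mul, hevC, hevX, hevf]
      simp only [mapOf]
      congr 2
      ext m
      rw [AbsSeries.coeff_restrict, rescale, Set.indicator_apply]
      split_ifs
      · exact (congrFun (rescale_rescale_inv hr0 (Φ j).coeff) m).symm
      · simp
    have e3 : (AbsSeries.const (β i) * AbsSeries.restrict (S' i) (Φ i)).coeff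
        = rescale r (fun m => β i * (S' i).indicator (rescale r⁻¹ (Φ i).coeff) m) := by
      ext m
      exact (rescale_mul_indicator hr0 (β i) (S' i) (Φ i) m).symm
    rw [e1, e2, e3, fval_rescale, fval_rescale, mapOf_rescale _ hr0, mapOf_rescale _ hr0,
      ← hxy, ← mul_sub] at h1
    have h2 : fval χ (rescale r⁻¹ (Φ i).coeff) x = r * fval χ (Φ i).coeff y := by
      rw [fval_rescale]; push_cast; rw [inv_inv]
    rw [h2, h1, mul_inv_cancel_left₀ hr']

end families

/-! ### Maps on polydisks, removal of a half plane of monomials, and inversion. -/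

theorem polydisk_eq_ball {r : ℝ} (hr : 0 < r) : polydisk r = Metric.ball 0 r := by
  ext x
  rw [mem_ball_zero_iff, pi_norm_lt_iff hr]
  rfl

theorem polydisk_mono {r r' : ℝ} (h : r ≤ r') : polydisk r ⊆ polydisk r' :=
  fun _ hx i => (hx i).trans_le h

theorem isOpen_polydisk (s : ℝ) : IsOpen (polydisk s) := by
  have : polydisk s = ⋂ i, {x : Fin 2 → ℂ | ‖x i‖ < s} := by ext; simp [polydisk]
  rw [this]
  exact isOpen_iInter_of_finite fun i => isOpen_lt (by fun_prop) continuous_const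

theorem analyticOnNhd_tsum_conv {C : Type*} [NormedCommRing C] [NormedAlgebra ℂ C]
    [CompleteSpace C] {c : (Fin 2 →₀ ℕ) → C} {s : ℝ} (hs : 0 < s)
    (hc : Conv s c) :
    AnalyticOnNhd ℂ (fun x : Fin 2 → ℂ => ∑' m, mpow x m • c m) (polydisk s) := by
  rw [polydisk_eq_ball hs]
  exact analyticOnNhd_tsum_mpow c hs fun m => hc.le_tsum m fun _ _ => by positivity

section maps

variable {C : Type*} [NormedCommRing C] [NormedAlgebra ℂ C] [CompleteSpace C] [NormOneClass C]

theorem eventually_mapsTo_mapOf (ν : Fin 2 → C) {c : Fin 2 → (Fin 2 →₀ ℕ) → C} {s : ℝ}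
    (hs : 0 < s) (hc : ∀ i, Conv s (c i)) (h2 : ∀ i, OrdGE (fun _ => 1) (1 + 1) (c i)) {ε : ℝ}
    (hε : 0 < ε) :
    ∀ᶠ t in 𝓝[>] (0 : ℝ), ∀ χ : C →ₐ[ℂ] ℂ, Set.MapsTo (mapOf χ ν c) (polydisk t) (polydisk ε) := by
  have key : ∀ i, ∀ᶠ t in 𝓝[>] (0 : ℝ),
      ‖ν i‖ * t + (t / s) ^ 2 * ∑' m, ‖c i m‖ * s ^ m.degree < ε := fun i => by
    have h : ContinuousAt
        (fun t : ℝ => ‖ν i‖ * t + (t / s) ^ 2 * ∑' m, ‖c i m‖ * s ^ m.degree) 0 := by fun_prop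
    exact (h.eventually_lt continuousAt_const (by simpa using hε)).filter_mono nhdsWithin_le_nhds
  filter_upwards [key 0, key 1, Ioo_mem_nhdsGT hs] with t h0 h1 ht χ x hx i
  have hi : ‖ν i‖ * t + (t / s) ^ 2 * ∑' m, ‖c i m‖ * s ^ m.degree < ε := by
    fin_cases i <;> assumption
  have hb := (hc i).bound 2 (h2 i) ht.1.le hs ht.2.le
  refine lt_of_le_of_lt ?_ hi
  refine (norm_add_le _ _).trans (add_le_add ?_ ((hb.1.norm_fval_le χ fun i => (hx i).le).trans
    hb.2))
  rw [norm_mul]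
  gcongr
  · exact norm_char_le χ _
  · exact (hx i).le

/-- On a polydisk of radius `t` a nonlinearity of order two has Lipschitz constant `O(t)`, so the
identity plus such a term is injective for small `t`. -/
theorem eventually_injOn_mapOf {c : Fin 2 → (Fin 2 →₀ ℕ) → C} {s : ℝ}
    (hs : 0 < s) (hc : ∀ i, Conv s (c i)) (h2 : ∀ i, OrdGE (fun _ => 1) (1 + 1) (c i)) :
    ∀ᶠ t in 𝓝[>] (0 : ℝ), ∀ χ : C →ₐ[ℂ] ℂ,
      Set.InjOn (mapOf χ (fun _ => 1) c) (polydisk t) := by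
  have key : ∀ i, ∀ᶠ t in 𝓝[>] (0 : ℝ),
      t * (8 / s ^ 2 * ∑' m, ‖c i m‖ * s ^ m.degree) < 1 := fun i => by
    have h : ContinuousAt
        (fun t : ℝ => t * (8 / s ^ 2 * ∑' m, ‖c i m‖ * s ^ m.degree)) 0 := by fun_prop
    exact (h.eventually_lt continuousAt_const (by simp)).filter_mono nhdsWithin_le_nhds
  filter_upwards [key 0, key 1, Ioo_mem_nhdsGT (half_pos hs)] with t h0 h1 ht χ x hx y hy hxy
  have ht0 := ht.1
  set D := ‖x - y‖ with hD
  have hDi : ∀ i, ‖x i - y i‖ ≤ D := fun i => norm_le_pi_norm (x - y) i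
  have hlt : ∀ i, ∃ q < (1 : ℝ), ‖x i - y i‖ ≤ q * D := fun i => by
    refine ⟨t * (8 / s ^ 2 * ∑' m, ‖c i m‖ * s ^ m.degree), by fin_cases i <;> assumption, ?_⟩
    -- The Lipschitz estimate is used with slack `e = t`, hence the doubled radius.
    have hb := (hc i).bound (t := 2 * t) 2 (h2 i) (by linarith) hs (by linarith [ht.2])
    have hct : Conv t (c i) := (hc i).mono ht0.le (by linarith [ht.2])
    have e1 : x i - y i = fval χ (c i) y - fval χ (c i) x := by
      have := congrFun hxy i
      simp only [mapOf, map_one, one_mul] at this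
      linear_combination this
    have hsum : Summable fun m => ‖c i m‖ * (2 * t⁻¹ * mpow (fun _ => t + t) m * D) := by
      refine (hb.1.mul_right (2 * t⁻¹ * D)).congr fun m => ?_
      rw [mpow_const, two_mul]; ring
    have e2 : ‖fval χ (c i) y - fval χ (c i) x‖
        ≤ ∑' m, ‖c i m‖ * (2 * t⁻¹ * mpow (fun _ => t + t) m * D) := by
      rw [fval, fval, ← (hct.summable_fval χ fun j => (hy j).le).tsum_sub
        (hct.summable_fval χ fun j => (hx j).le)]
      refine tsum_of_norm_bounded hsum.hasSum fun m => ?_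
      rw [← mul_sub, norm_mul]
      gcongr
      · exact norm_char_le χ _
      · refine norm_mpow_sub_mpow_le (fun j => (hy j).le) (fun j => (hx j).le) ht0 (fun j => ?_) m
        rw [norm_sub_rev]
        exact hDi j
    have e3 : ∑' m, ‖c i m‖ * (2 * t⁻¹ * mpow (fun _ => t + t) m * D)
        = (∑' m, ‖c i m‖ * (2 * t) ^ m.degree) * (2 * t⁻¹ * D) := by
      rw [← tsum_mul_right]
      refine tsum_congr fun m => ?_
      rw [mpow_const, two_mul]; ring
    rw [e1]
    refine e2.trans ?_
    rw [e3]
    calc _ ≤ ((2 * t / s) ^ 2 * ∑' m, ‖c i m‖ * s ^ m.degree) * (2 * t⁻¹ * D) := by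
          gcongr
          exact hb.2
      _ = _ := by field_simp; ring
  choose q hq1 hq using hlt
  by_contra hne
  have hDpos : 0 < D := norm_pos_iff.2 (sub_ne_zero.2 hne)
  have : D < D := by
    conv_lhs => rw [hD]
    rw [pi_norm_lt_iff hDpos]
    intro i
    refine (hq i).trans_lt ?_
    nlinarith [hq1 i]
  exact lt_irrefl _ this

/-- With `Φ = γ - μ ψ`, the equation `f ∘ h = h ∘ G` reads `Φ = F ∘ h - ψ ∘ G`. Splitting the
exponents by the sign of `w(m) - w_i` recovers both unknowns from `Φ`: the part to be removed gives
`ψ` on division by `-μ`, the rest is `γ`. The hypothesis `hw` is the contraction of the removed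
part, and the weights already in `V` are inherited by `ψ` and `γ`. -/
theorem exists_semiNormalForm (V : Set (Fin 2 → ℤ)) (hV : (fun _ => 1) ∈ V) (w : Fin 2 → ℤ)
    {μ μ' : Fin 2 → C} (hμ : ∀ i, μ i * μ' i = 1) {F : Fin 2 → (Fin 2 →₀ ℕ) → C} {s θ : ℝ}
    (hs : 0 < s) (hF : ∀ i, Conv s (F i)) (hFV : ∀ v ∈ V, ∀ i, OrdGE v (v i + 1) (F i))
    (ρ : Fin 2 → ℝ) (hρ : ∀ i, ‖μ i‖ < ρ i) (hθ0 : 0 ≤ θ) (hθ : θ < 1)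
    (hw : ∀ i, ∀ m : Fin 2 →₀ ℕ, 2 ≤ m.degree → wt w m ≤ w i → ‖μ' i‖ * mpow ρ m ≤ θ) :
    ∃ r > 0, ∃ ψ γ : Fin 2 → (Fin 2 →₀ ℕ) → C, (∀ i, Conv r (ψ i)) ∧ (∀ i, Conv r (γ i)) ∧
      (∀ v ∈ V, ∀ i, OrdGE v (v i + 1) (ψ i)) ∧ (∀ v ∈ insert w V, ∀ i, OrdGE v (v i + 1) (γ i)) ∧
      ∀ χ : C →ₐ[ℂ] ℂ, ∀ x ∈ polydisk r,
        mapOf χ μ F (mapOf χ (fun _ => 1) ψ x) = mapOf χ (fun _ => 1) ψ (mapOf χ μ γ x) := by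
  classical
  set S : Fin 2 → Set (Fin 2 →₀ ℕ) := fun i => {m | wt w m ≤ w i} with hS
  obtain ⟨r, hr, Φ, hΦ, hΦV, heq⟩ := exists_functional_solution V hV S S (fun i => (S i)ᶜ)
    (fun _ => 1) (fun i => -μ' i) μ F hs hF hFV ρ hρ hθ0 hθ (fun i m hm hv => by
      have h2 := hv _ hV
      rw [wt_one] at h2
      rw [norm_neg]
      exact hw i m (by exact_mod_cast h2) hm)
  have hψ : ∀ i, Conv r (fun m => -μ' i * (S i).indicator (Φ i) m) := fun i =>
    (hΦ i).of_norm_le hr.le (K := ‖μ' i‖) fun m => by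
      refine (norm_mul_le _ _).trans ?_
      rw [norm_neg]
      gcongr
      exact norm_indicator_le_norm_self _ _
  have hγ : ∀ i, Conv r ((S i)ᶜ.indicator (Φ i)) := fun i =>
    (hΦ i).of_norm_le hr.le (K := 1) fun m => by
      rw [one_mul]
      exact norm_indicator_le_norm_self _ _
  refine ⟨r, hr, fun i m => -μ' i * (S i).indicator (Φ i) m, fun i => (S i)ᶜ.indicator (Φ i),
    hψ, hγ, fun v hv i m hm => ?_, fun v hv i m hm => ?_, fun χ x hx => ?_⟩
  · exact hΦV v hv i m fun h => hm (by simp [Set.indicator_apply, h])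
  · have hmS : m ∈ (S i)ᶜ := Set.mem_of_indicator_ne_zero hm
    rcases hv with rfl | hv
    · simpa [hS] using hmS
    · exact hΦV v hv i m fun h => hm (by simp [Set.indicator_apply, h])
  · ext i
    have hx' : ∀ i, ‖x i‖ ≤ r := fun i => (hx i).le
    have h1 := heq χ x hx' i
    have h2 : fval χ (Φ i) x = -(χ (μ i) * fval χ (fun m => -μ' i * (S i).indicator (Φ i) m) x)
        + fval χ ((S i)ᶜ.indicator (Φ i)) x := by
      rw [fval, fval, fval, ← tsum_mul_left, ← tsum_neg,
        ← (((hψ i).summable_fval χ hx').mul_left _).neg.tsum_add ((hγ i).summable_fval χ hx')]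
      refine tsum_congr fun m => ?_
      have hχ : χ (μ i) * χ (μ' i) = 1 := by rw [← map_mul, hμ, map_one]
      by_cases hm : m ∈ S i
      · simp only [Set.indicator_of_mem hm, Set.indicator_of_notMem (Set.notMem_compl_iff.2 hm),
          map_mul, map_neg, map_zero]
        linear_combination (-χ (Φ i m) * mpow x m) * hχ
      · simp [hm]
    simp only [mapOf, map_one, one_mul] at h1 h2 ⊢
    linear_combination h2 - h1

/-- Writing the inverse as `μ' (x - Φ)`, the equation to be solved is `Φ = γ ∘ (μ' (x - Φ))`. This
is the same fixed-point problem without its composition term, and it retains all weight conditions.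
-/
theorem exists_rightInverse (V : Set (Fin 2 → ℤ)) (hV : (fun _ => 1) ∈ V)
    {μ μ' : Fin 2 → C} (hμ : ∀ i, μ i * μ' i = 1) {γ : Fin 2 → (Fin 2 →₀ ℕ) → C} {s : ℝ}
    (hs : 0 < s) (hγ : ∀ i, Conv s (γ i)) (hγV : ∀ v ∈ V, ∀ i, OrdGE v (v i + 1) (γ i)) :
    ∃ r > 0, ∃ κ : Fin 2 → (Fin 2 →₀ ℕ) → C, (∀ i, Conv r (κ i)) ∧
      (∀ v ∈ V, ∀ i, OrdGE v (v i + 1) (κ i)) ∧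
      ∀ χ : C →ₐ[ℂ] ℂ, ∀ x ∈ polydisk r, mapOf χ μ γ (mapOf χ μ' κ x) = x := by
  classical
  -- The empty sets switch off the second term, so the linear part `0`, the radii `1` and the rate
  -- `0` are mere placeholders there.
  obtain ⟨r, hr, Φ, hΦ, hΦV, heq⟩ := exists_functional_solution V hV (fun _ => Set.univ)
    (fun _ => ∅) (fun _ => ∅) μ' (fun i => -μ' i) 0 γ hs hγ hγV 1 (by simp) le_rfl one_pos (by simp)
  simp only [Set.indicator_univ] at heq
  refine ⟨r, hr, fun i m => -μ' i * Φ i m, fun i => (hΦ i).of_norm_le hr.le (K := ‖μ' i‖)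
    fun m => (norm_mul_le _ _).trans (by rw [norm_neg]), fun v hv i m hm => ?_, fun χ x hx => ?_⟩
  · exact hΦV v hv i m (right_ne_zero_of_mul hm)
  · ext i
    have h1 := heq χ x (fun i => (hx i).le) i
    have h0 : ∀ y, fval χ (fun _ : Fin 2 →₀ ℕ => (0 : C)) y = 0 := fun y => by simp [fval]
    simp only [Set.indicator_empty, mul_zero, h0, sub_zero] at h1
    have hχ : χ (μ i) * χ (μ' i) = 1 := by rw [← map_mul, hμ, map_one]
    have h2 : fval χ (fun m => -μ' i * Φ i m) x = -χ (μ' i) * fval χ (Φ i) x := by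
      simp only [fval, ← tsum_mul_left, map_mul, map_neg, mul_assoc]
    change χ (μ i) * (χ (μ' i) * x i + fval χ (fun m => -μ' i * Φ i m) x) + fval χ (γ i) _ = x i
    rw [← h1, h2]
    linear_combination (x i - fval χ (Φ i) x) * hχ

theorem fval_eq_char_tsum {c : (Fin 2 →₀ ℕ) → C} {s : ℝ} (hc : Conv s c) (χ : C →ₐ[ℂ] ℂ)
    {x : Fin 2 → ℂ} (hx : x ∈ polydisk s) : fval χ c x = χ (∑' m, mpow x m • c m) := by
  have hs : Summable fun m => mpow x m • c m := by
    refine Summable.of_norm_bounded hc fun m => ?_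
    rw [norm_smul, mul_comm, ← mpow_const]
    gcongr
    exact norm_mpow_le _ (fun i => (hx i).le) m
  have hχ : Continuous χ := AddMonoidHomClass.continuous_of_bound χ 1
    fun c => by simpa using norm_char_le χ c
  rw [hs.map_tsum χ hχ, fval]
  refine tsum_congr fun m => ?_
  rw [map_smul, smul_eq_mul, mul_comm]

/-- The series is summed in `C`, where it is an analytic function of `x` alone, and the character is
applied afterwards. Joint analyticity in the parameter thus reduces to that of `(λ, c) ↦ χ_λ(c)`. -/
theorem analyticOnNhd_mapOf_family {P : Type*} [NormedAddCommGroup P] [NormedSpace ℂ P]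
    {χ : P → C →ₐ[ℂ] ℂ} {Λ : Set P}
    (hχ : AnalyticOnNhd ℂ (fun z : P × C => χ z.1 z.2) (Λ ×ˢ Set.univ)) (ν : Fin 2 → C)
    {c : Fin 2 → (Fin 2 →₀ ℕ) → C} {s : ℝ} (hs : 0 < s) (hc : ∀ i, Conv s (c i)) :
    AnalyticOnNhd ℂ (fun z : P × (Fin 2 → ℂ) => mapOf (χ z.1) ν c z.2) (Λ ×ˢ polydisk s) := by
  refine AnalyticOnNhd.pi fun i => ?_
  have hsnd : AnalyticOnNhd ℂ (fun z : P × (Fin 2 → ℂ) => z.2 i) (Λ ×ˢ polydisk s) :=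
    ((ContinuousLinearMap.proj (R := ℂ) (φ := fun _ : Fin 2 => ℂ) i).comp
      (ContinuousLinearMap.snd ℂ P (Fin 2 → ℂ))).analyticOnNhd _
  have h1 : AnalyticOnNhd ℂ (fun z : P × (Fin 2 → ℂ) => χ z.1 (ν i)) (Λ ×ˢ polydisk s) :=
    hχ.comp (g := fun z : P × C => χ z.1 z.2) (f := fun z : P × (Fin 2 → ℂ) => (z.1, ν i))
      (analyticOnNhd_fst.prod analyticOnNhd_const) fun z hz => ⟨hz.1, trivial⟩
  have h2 : AnalyticOnNhd ℂ
      (fun z : P × (Fin 2 → ℂ) => χ z.1 (∑' m, mpow z.2 m • c i m)) (Λ ×ˢ polydisk s) :=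
    hχ.comp (g := fun z : P × C => χ z.1 z.2)
      (f := fun z : P × (Fin 2 → ℂ) => (z.1, ∑' m, mpow z.2 m • c i m))
      (analyticOnNhd_fst.prod ((analyticOnNhd_tsum_conv hs (hc i)).comp analyticOnNhd_snd
        fun z hz => hz.2)) fun z hz => ⟨hz.1, trivial⟩
  intro z hz
  refine ((h1.mul hsnd).add h2 z hz).congr ?_
  have hev : ∀ᶠ y : P × (Fin 2 → ℂ) in 𝓝 z, y.2 ∈ polydisk s :=
    continuous_snd.continuousAt.eventually ((isOpen_polydisk s).mem_nhds hz.2)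
  filter_upwards [hev] with y hy
  simp only [Pi.add_apply, mapOf, fval_eq_char_tsum (hc i) _ hy]

theorem analyticOnNhd_mapOf (χ : C →ₐ[ℂ] ℂ) (ν : Fin 2 → C)
    {c : Fin 2 → (Fin 2 →₀ ℕ) → C} {s : ℝ} (hs : 0 < s) (hc : ∀ i, Conv s (c i)) :
    AnalyticOnNhd ℂ (mapOf χ ν c) (polydisk s) := by
  let χ' : C →L[ℂ] ℂ := χ.toLinearMap.mkContinuous 1 fun c => by simpa using norm_char_le χ c
  have h := analyticOnNhd_mapOf_family (P := ℂ) (χ := fun _ => χ) (Λ := Set.univ)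
    ((χ'.comp (ContinuousLinearMap.snd ℂ ℂ C)).analyticOnNhd _) ν hs hc
  exact h.comp (g := fun z : ℂ × (Fin 2 → ℂ) => mapOf χ ν c z.2)
    (f := fun x => ((0 : ℂ), x)) (analyticOnNhd_const.prod analyticOnNhd_id)
    fun x hx => ⟨trivial, hx⟩

end maps

/-! ### The two-step conjugation. -/

section pipeline

variable {C : Type*} [NormedCommRing C] [NormedAlgebra ℂ C]

theorem mapOf_zero (χ : C →ₐ[ℂ] ℂ) (ν : Fin 2 → C) {c : Fin 2 → (Fin 2 →₀ ℕ) → C}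
    (h2 : ∀ i, OrdGE (fun _ => 1) (1 + 1) (c i)) : mapOf χ ν c 0 = 0 := by
  ext i
  have : fval χ (c i) 0 = 0 := by
    refine (tsum_congr fun m => ?_).trans tsum_zero
    by_cases hm : c i m = 0
    · simp [hm]
    · have h3 := h2 i m hm
      rw [wt_one, degree_fin_two] at h3
      rw [mpow_fin_two]
      rcases Nat.eq_zero_or_pos (m 0) with h | h
      · have : m 1 ≠ 0 := by omega
        simp [this]
      · simp [h.ne']
  simp [mapOf, this]

variable [CompleteSpace C] [NormOneClass C]

/-- The first step yields `f ∘ h₁ = h₁ ∘ g₁` with the half plane of `w₁` removed. Let `K₁` be a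
right inverse of `g₁`, which has the same weights. The second step gives `K₁ ∘ h₂ = h₂ ∘ G₂` with
the half plane of `w₂` removed as well, and the final map `g` is a right inverse of `G₂`. Right
inverses suffice throughout. -/
theorem exists_conjugation {P : Type*} [NormedAddCommGroup P] [NormedSpace ℂ P]
    (χ : P → C →ₐ[ℂ] ℂ) (Λ : Set P) (w₁ w₂ : Fin 2 → ℤ) {μ μ' : Fin 2 → C}
    (hμ : ∀ i, μ i * μ' i = 1) {F : Fin 2 → (Fin 2 →₀ ℕ) → C} {R θ₁ θ₂ : ℝ}
    (hR : 0 < R) (hF : ∀ i, Conv R (F i)) (hF2 : ∀ i, OrdGE (fun _ => 1) (1 + 1) (F i))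
    (ρ₁ ρ₂ : Fin 2 → ℝ) (hρ₁ : ∀ i, ‖μ i‖ < ρ₁ i) (hθ₁0 : 0 ≤ θ₁) (hθ₁ : θ₁ < 1)
    (hw₁ : ∀ i, ∀ m : Fin 2 →₀ ℕ, 2 ≤ m.degree → wt w₁ m ≤ w₁ i → ‖μ' i‖ * mpow ρ₁ m ≤ θ₁)
    (hρ₂ : ∀ i, ‖μ' i‖ < ρ₂ i) (hθ₂0 : 0 ≤ θ₂) (hθ₂ : θ₂ < 1)
    (hw₂ : ∀ i, ∀ m : Fin 2 →₀ ℕ, 2 ≤ m.degree → wt w₂ m ≤ w₂ i → ‖μ i‖ * mpow ρ₂ m ≤ θ₂)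
    (f : P → (Fin 2 → ℂ) → Fin 2 → ℂ)
    (hf : ∀ lam ∈ Λ, ∀ x ∈ polydisk R, f lam x = mapOf (χ lam) μ F x) :
    ∃ (ρ σ δ : ℝ) (h k : P → (Fin 2 → ℂ) → Fin 2 → ℂ) (γ : Fin 2 → (Fin 2 →₀ ℕ) → C),
      IsChangeOfVariables Λ ρ σ h k ∧
      IsConjugate Λ R ρ σ δ f h k (fun lam => mapOf (χ lam) μ γ) ∧
      (∀ i, Conv δ (γ i)) ∧
      (∀ v ∈ ({w₂, w₁, fun _ => 1} : Set (Fin 2 → ℤ)), ∀ i, OrdGE v (v i + 1) (γ i)) ∧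
      (AnalyticOnNhd ℂ (fun z : P × C => χ z.1 z.2) (Λ ×ˢ Set.univ) →
        AnalyticOnNhd ℂ (fun z : P × (Fin 2 → ℂ) => h z.1 z.2) (Λ ×ˢ polydisk ρ) ∧
        AnalyticOnNhd ℂ (fun z : P × (Fin 2 → ℂ) => k z.1 z.2) (Λ ×ˢ polydisk σ)) := by
  have h11 : ∀ i, (1 : Fin 2 → C) i * (1 : Fin 2 → C) i = 1 := fun i => by simp
  have hμ' : ∀ i, μ' i * μ i = 1 := fun i => by rw [mul_comm, hμ]
  obtain ⟨r₁, hr₁, ψ₁, γ₁, cψ₁, cγ₁, oψ₁, oγ₁, e₁⟩ := exists_semiNormalForm {fun _ => 1}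
    rfl w₁ hμ hR hF (by simpa using hF2) ρ₁ hρ₁ hθ₁0 hθ₁ hw₁
  obtain ⟨r₂, hr₂, κ₁, cκ₁, oκ₁, e₂⟩ := exists_rightInverse {w₁, fun _ => 1} (by simp) hμ hr₁
    cγ₁ oγ₁
  obtain ⟨r₃, hr₃, ψ₂, γ₂, cψ₂, cγ₂, oψ₂, oγ₂, e₃⟩ := exists_semiNormalForm {w₁, fun _ => 1}
    (by simp) w₂ hμ' hr₂ cκ₁ oκ₁ ρ₂ hρ₂ hθ₂0 hθ₂ hw₂
  obtain ⟨r₄, hr₄, γ, cγ, oγ, e₄⟩ := exists_rightInverse {w₂, w₁, fun _ => 1} (by simp) hμ' hr₃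
    cγ₂ oγ₂
  obtain ⟨r₅, hr₅, ω₁, cω₁, oω₁, e₅⟩ := exists_rightInverse {fun _ => 1} rfl h11 hr₁ cψ₁ oψ₁
  obtain ⟨r₆, hr₆, ω₂, cω₂, oω₂, e₆⟩ := exists_rightInverse {w₁, fun _ => 1} (by simp) h11 hr₃
    cψ₂ oψ₂
  have dψ₁ := oψ₁ _ rfl
  have dψ₂ := oψ₂ (fun _ => 1) (by simp)
  have dγ := oγ (fun _ => 1) (by simp)
  have dω₁ := oω₁ _ rfl
  have dω₂ := oω₂ (fun _ => 1) (by simp)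
  -- radius of injectivity of `h₁`
  obtain ⟨τ, iτ, mτ, hτ0, hτ⟩ := ((eventually_injOn_mapOf hr₁ cψ₁ dψ₁).and
    ((eventually_mapsTo_mapOf (fun _ => 1) hr₁ cψ₁ dψ₁ hR).and (Ioo_mem_nhdsGT hr₁))).exists
  obtain ⟨ρ, iρ, mρ, hρ0, hρ⟩ := ((eventually_injOn_mapOf hr₃ cψ₂ dψ₂).and
    ((eventually_mapsTo_mapOf (fun _ => 1) hr₃ cψ₂ dψ₂ hτ0).and (Ioo_mem_nhdsGT hr₃))).exists
  obtain ⟨τ', mτ', hτ'0, hτ'⟩ := ((eventually_mapsTo_mapOf 1 hr₆ cω₂ dω₂ hρ0).and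
    (Ioo_mem_nhdsGT hr₆)).exists
  obtain ⟨σ, mσ, hσ0, hσ⟩ := ((eventually_mapsTo_mapOf 1 hr₅ cω₁ dω₁ hτ'0).and
    (Ioo_mem_nhdsGT hr₅)).exists
  obtain ⟨t₁, mt₁, ht₁0, ht₁⟩ := ((eventually_mapsTo_mapOf (fun _ => 1) hr₁ cψ₁ dψ₁ hσ0).and
    (Ioo_mem_nhdsGT hr₁)).exists
  obtain ⟨t₂, mt₂, mt₂', ht₂0, ht₂⟩ := ((eventually_mapsTo_mapOf (fun _ => 1) hr₃ cψ₂ dψ₂ ht₁0).and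
    ((eventually_mapsTo_mapOf (fun _ => 1) hr₃ cψ₂ dψ₂ hr₂).and (Ioo_mem_nhdsGT hρ0))).exists
  obtain ⟨δ, mδ, hδ0, hδ⟩ := ((eventually_mapsTo_mapOf μ hr₄ cγ dγ ht₂0).and
    (Ioo_mem_nhdsGT (lt_min hρ0 hr₄))).exists
  have hδρ : δ ≤ ρ := hδ.le.trans (min_le_left _ _)
  have hδr : δ ≤ r₄ := hδ.le.trans (min_le_right _ _)
  set h₁ : P → (Fin 2 → ℂ) → Fin 2 → ℂ := fun lam => mapOf (χ lam) (fun _ => 1) ψ₁ with hh₁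
  set h₂ : P → (Fin 2 → ℂ) → Fin 2 → ℂ := fun lam => mapOf (χ lam) (fun _ => 1) ψ₂ with hh₂
  set k₁ : P → (Fin 2 → ℂ) → Fin 2 → ℂ := fun lam => mapOf (χ lam) 1 ω₁ with hk₁
  set k₂ : P → (Fin 2 → ℂ) → Fin 2 → ℂ := fun lam => mapOf (χ lam) 1 ω₂ with hk₂
  have hmapsk : ∀ lam, Set.MapsTo (fun x => k₂ lam (k₁ lam x)) (polydisk σ) (polydisk ρ) :=
    fun lam y hy => mτ' (χ lam) (mσ (χ lam) hy)
  have hright : ∀ lam, ∀ y ∈ polydisk σ, h₁ lam (h₂ lam (k₂ lam (k₁ lam y))) = y := by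
    intro lam y hy
    have a1 : h₂ lam (k₂ lam (k₁ lam y)) = k₁ lam y :=
      e₆ (χ lam) _ (polydisk_mono hτ'.le (mσ (χ lam) hy))
    rw [a1]
    exact e₅ (χ lam) y (polydisk_mono hσ.le hy)
  have hinj : ∀ lam, Set.InjOn (fun x => h₁ lam (h₂ lam x)) (polydisk ρ) := fun lam =>
    (iτ (χ lam)).comp (iρ (χ lam)) (mρ (χ lam))
  -- From `G₂ ∘ g = id` follows `h₂ = K₁ ∘ h₂ ∘ g`. Applying `g₁` gives `g₁ ∘ h₂ = h₂ ∘ g`, and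
  -- applying `h₁` gives the claim.
  have hfg : ∀ lam ∈ Λ, ∀ x ∈ polydisk δ, f lam (h₁ lam (h₂ lam x))
      = h₁ lam (h₂ lam (mapOf (χ lam) μ γ x)) := by
    intro lam hlam x hx
    have hxρ : x ∈ polydisk ρ := polydisk_mono hδρ hx
    have hy : mapOf (χ lam) μ γ x ∈ polydisk t₂ := mδ (χ lam) hx
    have a1 := e₄ (χ lam) x (polydisk_mono hδr hx)
    have a2 := e₃ (χ lam) _ (polydisk_mono (ht₂.le.trans hρ.le) hy)
    rw [a1] at a2
    have a3 := e₂ (χ lam) _ (mt₂' (χ lam) hy)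
    rw [a2] at a3
    have a4 := e₁ (χ lam) _ (polydisk_mono hτ.le (mρ (χ lam) hxρ))
    rw [a3] at a4
    rw [hf lam hlam _ (mτ (χ lam) (mρ (χ lam) hxρ))]
    exact a4
  have hhg : ∀ lam, ∀ x ∈ polydisk δ, h₁ lam (h₂ lam (mapOf (χ lam) μ γ x)) ∈ polydisk σ :=
    fun lam x hx => mt₁ (χ lam) (mt₂ (χ lam) (mδ (χ lam) hx))
  refine ⟨ρ, σ, δ, fun lam x => h₁ lam (h₂ lam x), fun lam y => k₂ lam (k₁ lam y), γ,
    ⟨hρ0, hσ0, fun lam _ => ?_, fun lam _ => ?_, fun lam _ => hinj lam, fun lam _ => ?_,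
      fun lam _ => hmapsk lam, fun lam _ => hright lam⟩,
    ⟨hδ0, hδρ, fun lam _ x hx => mτ (χ lam) (mρ (χ lam) hx), fun lam hlam x hx => ?_,
      fun lam hlam x hx => ?_⟩,
    fun i => (cγ i).mono hδ0.le hδr, oγ, fun hχ => ⟨?_, ?_⟩⟩
  · simp only [hh₁, hh₂, mapOf_zero _ _ dψ₁, mapOf_zero _ _ dψ₂]
  · exact ((analyticOnNhd_mapOf (χ lam) _ hr₁ cψ₁).mono (polydisk_mono hτ.le)).comp
      ((analyticOnNhd_mapOf (χ lam) _ hr₃ cψ₂).mono (polydisk_mono hρ.le)) (mρ (χ lam))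
  · exact ((analyticOnNhd_mapOf (χ lam) _ hr₆ cω₂).mono (polydisk_mono hτ'.le)).comp
      ((analyticOnNhd_mapOf (χ lam) _ hr₅ cω₁).mono (polydisk_mono hσ.le)) (mσ (χ lam))
  · change f lam (h₁ lam (h₂ lam x)) ∈ polydisk σ
    rw [hfg lam hlam x hx]
    exact hhg lam x hx
  · have hy : mapOf (χ lam) μ γ x ∈ polydisk ρ := polydisk_mono ht₂.le (mδ (χ lam) hx)
    simp only [hfg lam hlam x hx]
    -- Both sides have the same image under `h`, which is injective on the polydisk of radius `ρ`;
    -- this replaces a left inverse identity.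
    refine hinj lam hy (hmapsk lam (hhg lam x hx)) ?_
    exact (hright lam _ (hhg lam x hx)).symm
  · exact ((analyticOnNhd_mapOf_family hχ _ hr₁ cψ₁)).comp
      (g := fun z : P × (Fin 2 → ℂ) => h₁ z.1 z.2)
      (f := fun z : P × (Fin 2 → ℂ) => (z.1, h₂ z.1 z.2))
      (analyticOnNhd_fst.prod ((analyticOnNhd_mapOf_family hχ _ hr₃ cψ₂).mono
        (Set.prod_mono le_rfl (polydisk_mono hρ.le))))
      fun z hz => ⟨hz.1, polydisk_mono hτ.le (mρ _ hz.2)⟩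
  · exact ((analyticOnNhd_mapOf_family hχ _ hr₆ cω₂)).comp
      (g := fun z : P × (Fin 2 → ℂ) => k₂ z.1 z.2)
      (f := fun z : P × (Fin 2 → ℂ) => (z.1, k₁ z.1 z.2))
      (analyticOnNhd_fst.prod ((analyticOnNhd_mapOf_family hχ _ hr₅ cω₁).mono
        (Set.prod_mono le_rfl (polydisk_mono hσ.le))))
      fun z hz => ⟨hz.1, polydisk_mono hτ'.le (mσ _ hz.2)⟩

end pipeline

/-! ### Power series in one variable. -/

section oneVariable

variable {C : Type*} [NormedCommRing C] [NormedAlgebra ℂ C] [CompleteSpace C]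

theorem analyticOnNhd_tsum_pow {c : ℕ → C} {s : ℝ} (hs : 0 < s)
    (hc : Summable fun n => ‖c n‖ * s ^ n) :
    AnalyticOnNhd ℂ (fun u : ℂ => ∑' n, u ^ n • c n) (Metric.ball 0 s) := by
  have h := analyticOnNhd_tsum_mpow (σ := Unit) (fun m => c (m ())) hs
    (K := ∑' n, ‖c n‖ * s ^ n) fun m => by
      have : m.degree = m () := by rw [Finsupp.degree_eq_sum]; simp
      rw [this]
      exact hc.le_tsum (m ()) fun _ _ => by positivity
  have h2 := h.comp (g := fun x : Unit → ℂ => ∑' m : Unit →₀ ℕ, mpow x m • c (m ()))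
    (f := fun u : ℂ => fun _ : Unit => u) (s := Metric.ball 0 s)
    (AnalyticOnNhd.pi fun _ => analyticOnNhd_id) fun u hu => by
      rw [mem_ball_zero_iff] at hu ⊢
      rw [pi_norm_lt_iff hs]
      exact fun _ => hu
  refine h2.congr Metric.isOpen_ball fun u _ => ?_
  change ∑' m : Unit →₀ ℕ, mpow (fun _ => u) m • c (m ()) = ∑' n, u ^ n • c n
  rw [← (Finsupp.uniqueEquiv (M := ℕ) ()).tsum_eq]
  refine tsum_congr fun m => ?_
  rw [mpow_const, Finsupp.degree_eq_sum]
  simp [Finsupp.uniqueEquiv]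

variable [NormOneClass C]

theorem hasSum_char_pow {c : ℕ → C} {s : ℝ} (hc : Summable fun n => ‖c n‖ * s ^ n)
    (χ : C →ₐ[ℂ] ℂ) {u : ℂ} (hu : u ∈ Metric.ball 0 s) :
    HasSum (fun n => χ (c n) * u ^ n) (χ (∑' n, u ^ n • c n)) := by
  rw [mem_ball_zero_iff] at hu
  have hsum : Summable fun n => u ^ n • c n := by
    refine Summable.of_norm_bounded hc fun n => ?_
    rw [norm_smul, norm_pow, mul_comm]
    gcongr
  have hχ : Continuous χ := AddMonoidHomClass.continuous_of_bound χ 1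
    fun c => by simpa using norm_char_le χ c
  convert hsum.hasSum.map χ hχ using 1
  ext n
  rw [Function.comp_apply, map_smul, smul_eq_mul, mul_comm]

theorem analyticOnNhd_family_pow {P : Type*} [NormedAddCommGroup P] [NormedSpace ℂ P]
    {χ : P → C →ₐ[ℂ] ℂ} {Λ : Set P}
    (hχ : AnalyticOnNhd ℂ (fun z : P × C => χ z.1 z.2) (Λ ×ˢ Set.univ)) {c : ℕ → C} {s : ℝ}
    (hs : 0 < s) (hc : Summable fun n => ‖c n‖ * s ^ n) :
    AnalyticOnNhd ℂ (fun z : P × ℂ => ∑' n, χ z.1 (c n) * z.2 ^ n) (Λ ×ˢ Metric.ball 0 s) := by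
  have h2 : AnalyticOnNhd ℂ (fun z : P × ℂ => χ z.1 (∑' n, z.2 ^ n • c n))
      (Λ ×ˢ Metric.ball 0 s) :=
    hχ.comp (g := fun z : P × C => χ z.1 z.2) (f := fun z : P × ℂ => (z.1, ∑' n, z.2 ^ n • c n))
      (analyticOnNhd_fst.prod ((analyticOnNhd_tsum_pow hs hc).comp analyticOnNhd_snd
        fun z hz => hz.2)) fun z hz => ⟨hz.1, trivial⟩
  intro z hz
  refine (h2 z hz).congr ?_
  have hev : ∀ᶠ y : P × ℂ in 𝓝 z, y.2 ∈ Metric.ball 0 s :=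
    continuous_snd.continuousAt.eventually (Metric.isOpen_ball.mem_nhds hz.2)
  filter_upwards [hev] with y hy
  exact (hasSum_char_pow hc _ hy).tsum_eq.symm

theorem analyticOnNhd_char_pow (χ : C →ₐ[ℂ] ℂ) {c : ℕ → C} {s : ℝ}
    (hs : 0 < s) (hc : Summable fun n => ‖c n‖ * s ^ n) :
    AnalyticOnNhd ℂ (fun u => ∑' n, χ (c n) * u ^ n) (Metric.ball 0 s) := by
  let χ' : C →L[ℂ] ℂ := χ.toLinearMap.mkContinuous 1 fun c => by simpa using norm_char_le χ c
  have h := analyticOnNhd_family_pow (P := ℂ) (χ := fun _ => χ) (Λ := Set.univ)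
    ((χ'.comp (ContinuousLinearMap.snd ℂ ℂ C)).analyticOnNhd _) hs hc
  exact h.comp (g := fun z : ℂ × ℂ => ∑' n, χ (c n) * z.2 ^ n)
    (f := fun u => ((0 : ℂ), u)) (analyticOnNhd_const.prod analyticOnNhd_id)
    fun x hx => ⟨trivial, hx⟩

end oneVariable

/-! ### Lattice geometry of the surviving exponents. -/

/-- The exponent of the monomial `x_i (x₁^p x₂^q)^n x^{k α}`. -/
noncomputable def expo (p q : ℕ) (i : Fin 2) (n k : ℕ) (α : Fin 2 → ℕ) : Fin 2 →₀ ℕ :=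
  Finsupp.single i 1 + Finsupp.equivFunOnFinite.symm fun j => n * ![p, q] j + k * α j

theorem mpow_expo (p q : ℕ) (i : Fin 2) (n k : ℕ) (α : Fin 2 → ℕ) (x : Fin 2 → ℂ) :
    mpow x (expo p q i n k α) = x i * (x 0 ^ p * x 1 ^ q) ^ n * multiPow x (k • α) := by
  rw [expo, mpow_add, mpow_single, mpow_fin_two]
  simp only [multiPow, Fin.prod_univ_two, Finsupp.equivFunOnFinite_symm_apply_apply,
    Pi.smul_apply, smul_eq_mul, Matrix.cons_val_zero, Matrix.cons_val_one, pow_add, mul_pow,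
    ← pow_mul, pow_one, Matrix.cons_val_fin_one]
  ring

theorem wt_expo (v : Fin 2 → ℤ) (p q : ℕ) (i : Fin 2) (n k : ℕ) (α : Fin 2 → ℕ) :
    wt v (expo p q i n k α)
      = v i + n * (v 0 * p + v 1 * q) + k * (v 0 * α 0 + v 1 * α 1) := by
  rw [expo, wt_add, wt_single]
  simp only [wt, Finsupp.equivFunOnFinite_symm_apply_apply, Matrix.cons_val_zero,
    Matrix.cons_val_one, Matrix.cons_val_fin_one]
  push_cast
  ring

theorem degree_expo (p q : ℕ) (i : Fin 2) (n k : ℕ) (α : Fin 2 → ℕ) :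
    (expo p q i n k α).degree = 1 + ((p + q) * n + k * multiDeg α) := by
  have h := wt_expo (fun _ => 1) p q i n k α
  rw [wt_one] at h
  have h2 : multiDeg α = α 0 + α 1 := by rw [multiDeg, Fin.sum_univ_two]
  zify
  rw [h, h2]
  push_cast
  ring

/-- The exponents of the normal form: the multiples of `(p, q)`, and the two cones next to them. -/
noncomputable def resIndex (p q r₀ s₀ N : ℕ) (i : Fin 2) :
    ℕ ⊕ ((ℕ × ℕ) ⊕ (ℕ × ℕ)) → Fin 2 →₀ ℕ
  | .inl n => expo p q i n 0 ![r₀, s₀]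
  | .inr (.inl kn) => expo p q i (1 + N * (kn.1 + 1) + kn.2) (kn.1 + 1) ![r₀, s₀]
  | .inr (.inr kn) => expo p q i (1 + N * (kn.1 + 1) + kn.2) (kn.1 + 1) ![p - r₀, q - s₀]

/-- The functionals `(q, -p)` and `(-s₀, r₀)` form a unimodular pair by the Bezout relation, so the
two coordinates `l` and `t` of `m - e_i` determine `m`. -/
theorem expo_eq_iff {p q r₀ s₀ : ℕ} (hrs : IsBezoutPair p q r₀ s₀) (i : Fin 2) {n k : ℕ}
    {α : Fin 2 → ℕ} {m : Fin 2 →₀ ℕ} :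
    m = expo p q i n k α ↔
      wt ![q, -p] m - (![q, -p] : Fin 2 → ℤ) i = k * (q * α 0 - p * α 1) ∧
      wt ![-s₀, r₀] m - (![-s₀, r₀] : Fin 2 → ℤ) i = n + k * (-s₀ * α 0 + r₀ * α 1) := by
  obtain ⟨hb, -, -⟩ := hrs
  constructor
  · rintro rfl
    rw [wt_expo, wt_expo]
    simp only [Matrix.cons_val_zero, Matrix.cons_val_one, Matrix.cons_val_fin_one]
    constructor
    · ring
    · linear_combination (n : ℤ) * hb
  · rintro ⟨h1, h2⟩
    have e1 := wt_expo ![(q : ℤ), -p] p q i n k α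
    have e2 := wt_expo ![(-s₀ : ℤ), r₀] p q i n k α
    simp only [Matrix.cons_val_zero, Matrix.cons_val_one, Matrix.cons_val_fin_one, wt]
      at h1 h2 e1 e2
    ext j
    zify
    fin_cases j
    · simp only [Fin.zero_eta]
      linear_combination (r₀ : ℤ) * h1 + p * h2 - r₀ * e1 - p * e2 - (m 0) * hb
        + (expo p q i n k α 0) * hb - n * p * hb
    · simp only [Fin.mk_one]
      linear_combination (s₀ : ℤ) * h1 + q * h2 - s₀ * e1 - q * e2 - (m 1) * hb
        + (expo p q i n k α 1) * hb - n * q * hb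

/-- The coordinate `l` is zero on the resonant line, `k` on the cone of `α₀` and `-k` on that of
`α₁`, with `k ≥ 1`. It separates the three families and determines `k`; the coordinate `t` then
determines the remaining index. -/
theorem resIndex_injective {p q r₀ s₀ : ℕ} (hrs : IsBezoutPair p q r₀ s₀) (N : ℕ) (i : Fin 2) :
    Function.Injective (resIndex p q r₀ s₀ N i) := by
  have hb := hrs.1
  have hc1 : (q : ℤ) * (p - r₀ : ℕ) - p * (q - s₀ : ℕ) = -1 := by
    rw [Nat.cast_sub hrs.2.1, Nat.cast_sub hrs.2.2]
    linear_combination -hb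
  have hc2 : -(s₀ : ℤ) * (p - r₀ : ℕ) + r₀ * (q - s₀ : ℕ) = 1 := by
    rw [Nat.cast_sub hrs.2.1, Nat.cast_sub hrs.2.2]
    linear_combination hb
  have key : ∀ j, ∃ n k : ℕ, ∃ a b : ℤ,
      wt ![q, -p] (resIndex p q r₀ s₀ N i j) - (![q, -p] : Fin 2 → ℤ) i = k * a ∧
      wt ![-s₀, r₀] (resIndex p q r₀ s₀ N i j) - (![-s₀, r₀] : Fin 2 → ℤ) i = n + k * b ∧
      match j with
      | .inl n' => n' = n ∧ k = 0
      | .inr (.inl kn) => a = 1 ∧ b = 0 ∧ k = kn.1 + 1 ∧ n = 1 + N * (kn.1 + 1) + kn.2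
      | .inr (.inr kn) => a = -1 ∧ b = 1 ∧ k = kn.1 + 1 ∧ n = 1 + N * (kn.1 + 1) + kn.2 := by
    rintro (n | kn | kn)
    · obtain ⟨h1, h2⟩ := (expo_eq_iff hrs i (n := n) (k := 0) (α := ![r₀, s₀])).1 rfl
      exact ⟨n, 0, _, _, h1, h2, rfl, rfl⟩
    · obtain ⟨h1, h2⟩ := (expo_eq_iff hrs i (n := 1 + N * (kn.1 + 1) + kn.2) (k := kn.1 + 1)
        (α := ![r₀, s₀])).1 rfl
      refine ⟨_, _, _, _, h1, h2, ?_, ?_, rfl, rfl⟩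
      · simpa using hb
      · simp; ring
    · obtain ⟨h1, h2⟩ := (expo_eq_iff hrs i (n := 1 + N * (kn.1 + 1) + kn.2) (k := kn.1 + 1)
        (α := ![p - r₀, q - s₀])).1 rfl
      refine ⟨_, _, _, _, h1, h2, ?_, ?_, rfl, rfl⟩
      · simpa using hc1
      · simpa using hc2
  intro j j' hj
  obtain ⟨n, k, a, b, h1, h2, h3⟩ := key j
  obtain ⟨n', k', a', b', h1', h2', h3'⟩ := key j'
  rw [hj, h1'] at h1
  rw [hj, h2'] at h2
  rcases j with j | ⟨j1, j2⟩ | ⟨j1, j2⟩ <;> rcases j' with j' | ⟨j1', j2'⟩ | ⟨j1', j2'⟩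
  · obtain ⟨rfl, rfl⟩ := h3
    obtain ⟨rfl, rfl⟩ := h3'
    simp at h2
    simp [h2]
  · obtain ⟨rfl, rfl⟩ := h3
    obtain ⟨rfl, rfl, rfl, rfl⟩ := h3'
    push_cast at h1
    omega
  · obtain ⟨rfl, rfl⟩ := h3
    obtain ⟨rfl, rfl, rfl, rfl⟩ := h3'
    push_cast at h1
    omega
  · obtain ⟨rfl, rfl⟩ := h3'
    obtain ⟨rfl, rfl, rfl, rfl⟩ := h3
    push_cast at h1
    omega
  · obtain ⟨rfl, rfl, rfl, rfl⟩ := h3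
    obtain ⟨rfl, rfl, rfl, rfl⟩ := h3'
    obtain rfl : j1' = j1 := by push_cast at h1; omega
    have : j2' = j2 := by push_cast at h2; omega
    rw [this]
  · obtain ⟨rfl, rfl, rfl, rfl⟩ := h3
    obtain ⟨rfl, rfl, rfl, rfl⟩ := h3'
    push_cast at h1
    omega
  · obtain ⟨rfl, rfl⟩ := h3'
    obtain ⟨rfl, rfl, rfl, rfl⟩ := h3
    push_cast at h1
    omega
  · obtain ⟨rfl, rfl, rfl, rfl⟩ := h3
    obtain ⟨rfl, rfl, rfl, rfl⟩ := h3'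
    push_cast at h1
    omega
  · obtain ⟨rfl, rfl, rfl, rfl⟩ := h3
    obtain ⟨rfl, rfl, rfl, rfl⟩ := h3'
    obtain rfl : j1' = j1 := by push_cast at h1; omega
    have : j2' = j2 := by push_cast at h2; omega
    rw [this]

/-- In the coordinates `(l, t)` the hypotheses are `t ≥ 1 + N l` and `t ≥ 1 - (N + 1) l`. The sign
of `l` decides which family contains `m`. -/
theorem mem_range_resIndex {p q r₀ s₀ : ℕ} (hrs : IsBezoutPair p q r₀ s₀) (N : ℕ) (i : Fin 2)
    {m : Fin 2 →₀ ℕ} {w w' : Fin 2 → ℤ} (hw : w = ![-((s₀ : ℤ) + N * q), (r₀ : ℤ) + N * p])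
    (hw' : w' = ![((N : ℤ) + 1) * q - s₀, -(((N : ℤ) + 1) * p - r₀)])
    (h : w i + 1 ≤ wt w m) (h' : w' i + 1 ≤ wt w' m) :
    m ∈ Set.range (resIndex p q r₀ s₀ N i) := by
  set l := wt ![q, -p] m - (![q, -p] : Fin 2 → ℤ) i with hl
  set t := wt ![-s₀, r₀] m - (![-s₀, r₀] : Fin 2 → ℤ) i with ht
  have e1 : wt w m - w i = t - N * l := by
    rw [hw, ht, hl]
    fin_cases i <;> simp [wt] <;> ring
  have e2 : wt w' m - w' i = t + (N + 1) * l := by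
    rw [hw', ht, hl]
    fin_cases i <;> simp [wt] <;> ring
  have hb := hrs.1
  rcases lt_trichotomy l 0 with hneg | h0 | hpos
  -- Since `α₁ = (p, q) - α₀`, the exponent equals `(-l) α₁ + (t + l) (p, q)`. The power of `u` is
  -- therefore `t + l`, and the second inequality bounds it below.
  · obtain ⟨k, hk⟩ : ∃ k : ℕ, -l = k + 1 := ⟨(-l - 1).toNat, by omega⟩
    obtain ⟨n, hn⟩ : ∃ n : ℕ, t + l = 1 + N * (k + 1) + n :=
      ⟨(t + l - 1 - N * (k + 1)).toNat, by
        have : (N : ℤ) * l = -(N * (k + 1)) := by rw [← hk]; ring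
        have h3 : (N + 1 : ℤ) * l = N * l + l := by ring
        omega⟩
    refine ⟨.inr (.inr (k, n)), Eq.symm ((expo_eq_iff hrs i).2 ⟨?_, ?_⟩)⟩
    · rw [← hl]
      simp only [Matrix.cons_val_zero, Matrix.cons_val_one, Matrix.cons_val_fin_one]
      rw [Nat.cast_sub hrs.2.1, Nat.cast_sub hrs.2.2]
      push_cast
      linear_combination -hk + (k + 1) * hb
    · rw [← ht]
      simp only [Matrix.cons_val_zero, Matrix.cons_val_one, Matrix.cons_val_fin_one]
      rw [Nat.cast_sub hrs.2.1, Nat.cast_sub hrs.2.2]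
      push_cast
      linear_combination hn + hk - (k + 1) * hb
  · obtain ⟨n, hn⟩ : ∃ n : ℕ, t = n := ⟨t.toNat, by
      rw [h0] at e1
      omega⟩
    refine ⟨.inl n, Eq.symm ((expo_eq_iff hrs i).2 ⟨?_, ?_⟩)⟩
    · rw [← hl, h0]; simp
    · rw [← ht, hn]; simp
  · obtain ⟨k, hk⟩ : ∃ k : ℕ, l = k + 1 := ⟨(l - 1).toNat, by omega⟩
    obtain ⟨n, hn⟩ : ∃ n : ℕ, t = 1 + N * (k + 1) + n :=
      ⟨(t - 1 - N * (k + 1)).toNat, by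
        rw [hk] at e1
        omega⟩
    refine ⟨.inr (.inl (k, n)), Eq.symm ((expo_eq_iff hrs i).2 ⟨?_, ?_⟩)⟩
    · rw [← hl]
      simp only [Matrix.cons_val_zero, Matrix.cons_val_one, Matrix.cons_val_fin_one]
      push_cast
      linear_combination hk - (k + 1) * hb
    · rw [← ht]
      simp only [Matrix.cons_val_zero, Matrix.cons_val_one, Matrix.cons_val_fin_one]
      push_cast
      linear_combination hn

/-! ### Reading the normal form off the coefficients. -/

section extraction

variable {C : Type*} [NormedCommRing C]

theorem multiPow_norm_le {x : Fin 2 → ℂ} {δ : ℝ} (hx : x ∈ polydisk δ) (m : Fin 2 → ℕ) :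
    ‖multiPow x m‖ ≤ δ ^ multiDeg m := by
  rw [multiPow, multiDeg, norm_prod, ← Finset.prod_pow_eq_pow_sum]
  refine Finset.prod_le_prod (fun _ _ => norm_nonneg _) fun i _ => ?_
  rw [norm_pow]
  exact pow_le_pow_left₀ (norm_nonneg _) (hx i).le _

theorem multiDeg_nsmul (k : ℕ) (α : Fin 2 → ℕ) : multiDeg (k • α) = k * multiDeg α := by
  simp [multiDeg, mul_add]

theorem resonant_mem_ball {p q : ℕ} (hp : 0 < p) {x : Fin 2 → ℂ} {δ : ℝ}
    (hx : x ∈ polydisk δ) : x 0 ^ p * x 1 ^ q ∈ Metric.ball (0 : ℂ) (δ ^ (p + q)) := by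
  have hδ : 0 < δ := (norm_nonneg _).trans_lt (hx 0)
  rw [mem_ball_zero_iff, norm_mul, norm_pow, norm_pow, pow_add]
  calc ‖x 0‖ ^ p * ‖x 1‖ ^ q ≤ ‖x 0‖ ^ p * δ ^ q :=
        mul_le_mul_of_nonneg_left (pow_le_pow_left₀ (norm_nonneg _) (hx 1).le _) (by positivity)
    _ < δ ^ p * δ ^ q := mul_lt_mul_of_pos_right
        (pow_lt_pow_left₀ (hx 0) (norm_nonneg _) hp.ne') (by positivity)

theorem summable_cone_fiber {p q N : ℕ} {α : Fin 2 → ℕ} {δ : ℝ} (hδ : 0 < δ) {c : ℕ × ℕ → C}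
    (hc : Summable fun kn : ℕ × ℕ => ‖c kn‖ *
      δ ^ ((p + q) * (1 + N * (kn.1 + 1) + kn.2) + (kn.1 + 1) * multiDeg α)) (k : ℕ) :
    Summable fun n => ‖c (k, n)‖ * (δ ^ (p + q)) ^ n := by
  have h := (hc.comp_injective (i := fun n : ℕ => (k, n)) fun _ _ h => (Prod.ext_iff.1 h).2).mul_left
    ((δ ^ ((p + q) * (1 + N * (k + 1)) + (k + 1) * multiDeg α))⁻¹)
  refine h.congr fun n => ?_
  have : δ ^ ((p + q) * (1 + N * (k + 1) + n) + (k + 1) * multiDeg α)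
      = δ ^ ((p + q) * (1 + N * (k + 1)) + (k + 1) * multiDeg α) * (δ ^ (p + q)) ^ n := by
    rw [← pow_mul, ← pow_add]; ring_nf
  simp only [Function.comp_apply]
  rw [this]
  field_simp

variable [NormedAlgebra ℂ C] [CompleteSpace C] [NormOneClass C]

/-- The double series converges absolutely, so it may be summed over `n` first, which produces the
coefficient functions of `u`. The common factor `z u` stays outside the inner sum, with `z` standing
for `x_i`. -/
theorem exists_hasSum_cone {p q N : ℕ} (hp : 0 < p) {α : Fin 2 → ℕ} {δ : ℝ}
    {c : ℕ × ℕ → C} (hc : Summable fun kn : ℕ × ℕ => ‖c kn‖ *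
      δ ^ ((p + q) * (1 + N * (kn.1 + 1) + kn.2) + (kn.1 + 1) * multiDeg α))
    (χ : C →ₐ[ℂ] ℂ) {x : Fin 2 → ℂ} (hx : x ∈ polydisk δ) {u : ℂ} (hu : u = x 0 ^ p * x 1 ^ q)
    (z : ℂ) : ∃ S, HasSum (fun k : ℕ => u ^ (N * (k + 1)) *
      (multiPow x ((k + 1) • α) * ∑' n, χ (c (k, n)) * u ^ n)) S ∧
    HasSum (fun kn : ℕ × ℕ => χ (c kn) *
      (z * u ^ (1 + N * (kn.1 + 1) + kn.2) * multiPow x ((kn.1 + 1) • α))) (z * (u * S)) := by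
  have hδ : 0 < δ := (norm_nonneg _).trans_lt (hx 0)
  have hub : u ∈ Metric.ball (0 : ℂ) (δ ^ (p + q)) := hu ▸ resonant_mem_ball hp hx
  have hun : ‖u‖ ≤ δ ^ (p + q) := (mem_ball_zero_iff.1 hub).le
  set T : ℕ × ℕ → ℂ := fun kn => u ^ (N * (kn.1 + 1)) *
    (multiPow x ((kn.1 + 1) • α) * (χ (c kn) * u ^ kn.2)) with hT
  have hsum : Summable T := by
    refine Summable.of_norm_bounded (hc.mul_left (δ ^ (p + q))⁻¹) fun kn => ?_
    have e : (δ ^ (p + q))⁻¹ * (‖c kn‖ *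
        δ ^ ((p + q) * (1 + N * (kn.1 + 1) + kn.2) + (kn.1 + 1) * multiDeg α))
        = (δ ^ (p + q)) ^ (N * (kn.1 + 1)) *
          (δ ^ ((kn.1 + 1) * multiDeg α) * (‖c kn‖ * (δ ^ (p + q)) ^ kn.2)) := by
      have : δ ^ ((p + q) * (1 + N * (kn.1 + 1) + kn.2) + (kn.1 + 1) * multiDeg α)
        = δ ^ (p + q) * ((δ ^ (p + q)) ^ (N * (kn.1 + 1)) * δ ^ ((kn.1 + 1) * multiDeg α)
          * (δ ^ (p + q)) ^ kn.2) := by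
        simp only [← pow_mul, ← pow_add]; ring_nf
      rw [this]
      field_simp
    rw [e, hT]
    simp only [norm_mul, norm_pow]
    have h1 := multiPow_norm_le hx ((kn.1 + 1) • α)
    rw [multiDeg_nsmul] at h1
    have h2 := norm_char_le χ (c kn)
    gcongr
  refine ⟨∑' kn, T kn, ?_, ?_⟩
  · refine hsum.hasSum.prod_fiberwise fun k => ?_
    have h1 := (hasSum_char_pow (summable_cone_fiber hδ hc k) χ hub)
    exact (h1.summable.hasSum.mul_left (multiPow x ((k + 1) • α))).mul_left (u ^ (N * (k + 1)))
  · have e : (fun kn : ℕ × ℕ => χ (c kn) *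
        (z * u ^ (1 + N * (kn.1 + 1) + kn.2) * multiPow x ((kn.1 + 1) • α)))
        = fun kn => z * (u * T kn) := funext fun kn => ?_
    · rw [e]
      exact (hsum.hasSum.mul_left u).mul_left z
    · simp only [hT, pow_add, pow_one]
      ring

/-- By the two weight conditions the coefficients vanish off the range of the injection `resIndex`,
so the power series of the nonlinear part can be reindexed by it and split into the resonant line
and two cones. -/
theorem hasResonantForm {P : Type*} [NormedAddCommGroup P] [NormedSpace ℂ P] {p q r₀ s₀ N : ℕ}
    (hp : 0 < p) (hrs : IsBezoutPair p q r₀ s₀) {δ : ℝ} (hδ : 0 < δ)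
    (χ : P → C →ₐ[ℂ] ℂ) (Λ : Set P) {μ : Fin 2 → P → ℂ} {ν : Fin 2 → C}
    (hν : ∀ i, ∀ lam ∈ Λ, χ lam (ν i) = μ i lam) {γ : Fin 2 → (Fin 2 →₀ ℕ) → C}
    (hγ : ∀ i, Conv δ (γ i)) {w w' : Fin 2 → ℤ} 
    (hw : w = ![-((s₀ : ℤ) + N * q), (r₀ : ℤ) + N * p])
    (hw' : w' = ![((N : ℤ) + 1) * q - s₀, -(((N : ℤ) + 1) * p - r₀)])
    (h1 : ∀ i, OrdGE w (w i + 1) (γ i)) (h2 : ∀ i, OrdGE w' (w' i + 1) (γ i)) :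
    ∃ (b : Fin 2 → P → ℂ → ℂ) (b₀ b₁ : Fin 2 → ℕ → P → ℂ → ℂ),
      HasResonantForm p q N ![r₀, s₀] ![p - r₀, q - s₀] Λ δ μ (fun lam => mapOf (χ lam) ν γ)
        b b₀ b₁ ∧
      (AnalyticOnNhd ℂ (fun z : P × C => χ z.1 z.2) (Λ ×ˢ Set.univ) → ∀ i,
        AnalyticOnNhd ℂ (fun z : P × ℂ => b i z.1 z.2) (Λ ×ˢ Metric.ball 0 (δ ^ (p + q))) ∧
        ∀ j, 1 ≤ j →
          AnalyticOnNhd ℂ (fun z : P × ℂ => b₀ i j z.1 z.2)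
            (Λ ×ˢ Metric.ball 0 (δ ^ (p + q))) ∧
          AnalyticOnNhd ℂ (fun z : P × ℂ => b₁ i j z.1 z.2)
            (Λ ×ˢ Metric.ball 0 (δ ^ (p + q)))) := by
  have hpos : 0 < δ ^ (p + q) := by positivity
  set e := resIndex p q r₀ s₀ N with he
  set c : Fin 2 → ℕ → C := fun i n => γ i (e i (.inl n)) with hcdef
  set c₀ : Fin 2 → ℕ × ℕ → C := fun i kn => γ i (e i (.inr (.inl kn))) with hc₀def
  set c₁ : Fin 2 → ℕ × ℕ → C := fun i kn => γ i (e i (.inr (.inr kn))) with hc₁def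
  -- The degree is lowered by one because the factor `x_i` is taken out of the component `i`.
  have hsum : ∀ i, Summable fun j => ‖γ i (e i j)‖ * δ ^ ((e i j).degree - 1) := fun i => by
    have := ((hγ i).comp_injective (resIndex_injective hrs N i)).mul_left δ⁻¹
    refine this.congr fun j => ?_
    obtain ⟨n, hn⟩ : ∃ n, (e i j).degree = n + 1 := by
      rcases j with j | j | j <;> exact ⟨_, (degree_expo ..).trans (add_comm _ _)⟩
    simp only [Function.comp_apply]
    rw [← he, hn, Nat.add_sub_cancel, pow_succ]
    field_simp
  have hc : ∀ i, Summable fun n => ‖c i n‖ * δ ^ ((p + q) * n) := fun i => by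
    refine ((hsum i).comp_injective Sum.inl_injective).congr fun n => ?_
    simp [hcdef, he, resIndex, degree_expo]
  have hc' : ∀ i, Summable fun n => ‖c i n‖ * (δ ^ (p + q)) ^ n := fun i => by
    simpa only [pow_mul] using hc i
  have hc₀ : ∀ i, Summable fun kn : ℕ × ℕ => ‖c₀ i kn‖ *
      δ ^ ((p + q) * (1 + N * (kn.1 + 1) + kn.2) + (kn.1 + 1) * multiDeg ![r₀, s₀]) := fun i => by
    refine ((hsum i).comp_injective (Sum.inr_injective.comp Sum.inl_injective)).congr fun n => ?_
    simp [hc₀def, he, resIndex, degree_expo]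
  have hc₁ : ∀ i, Summable fun kn : ℕ × ℕ => ‖c₁ i kn‖ *
      δ ^ ((p + q) * (1 + N * (kn.1 + 1) + kn.2)
        + (kn.1 + 1) * multiDeg ![p - r₀, q - s₀]) := fun i => by
    refine ((hsum i).comp_injective (Sum.inr_injective.comp Sum.inr_injective)).congr fun n => ?_
    simp [hc₁def, he, resIndex, degree_expo]
  have hf₀ := fun i => summable_cone_fiber hδ (hc₀ i)
  have hf₁ := fun i => summable_cone_fiber hδ (hc₁ i)
  have hser : ∀ (d : ℕ → C) (_ : Summable fun n => ‖d n‖ * (δ ^ (p + q)) ^ n) (lam : P),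
      ∀ u ∈ Metric.ball (0 : ℂ) (δ ^ (p + q)),
      HasSum (fun n => χ lam (d n) * u ^ n) (∑' n, χ lam (d n) * u ^ n) := fun d hd lam u hu =>
    (hasSum_char_pow hd (χ lam) hu).summable.hasSum
  -- The cone series are indexed from `k = 1` in the normal form and from `0` in the coefficient
  -- arrays, hence `k - 1`; the value at `k = 0` plays no role.
  refine ⟨fun i lam u => ∑' n, χ lam (c i n) * u ^ n,
    fun i k lam u => ∑' n, χ lam (c₀ i (k - 1, n)) * u ^ n,
    fun i k lam u => ∑' n, χ lam (c₁ i (k - 1, n)) * u ^ n, ⟨?_, ?_, ?_, ?_, ?_, ?_, ?_⟩, ?_⟩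
  · intro lam hlam x hx u hu i
    have hub : u ∈ Metric.ball (0 : ℂ) (δ ^ (p + q)) := hu ▸ resonant_mem_ball hp hx
    obtain ⟨S₀, hS₀, hS₀'⟩ := exists_hasSum_cone hp (hc₀ i) (χ lam) hx hu (x i)
    obtain ⟨S₁, hS₁, hS₁'⟩ := exists_hasSum_cone hp (hc₁ i) (χ lam) hx hu (x i)
    refine ⟨S₀ + S₁, ?_, ?_⟩
    · simpa only [Nat.add_sub_cancel, mul_add] using hS₀.add hS₁
    · have hz : HasSum (fun m => χ lam (γ i m) * mpow x m) (fval (χ lam) (γ i) x) :=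
        (Conv.summable_fval (hγ i) (χ lam) fun j => (hx j).le).hasSum
      rw [← (resIndex_injective hrs N i).hasSum_iff fun m hm => ?_] at hz
      · have hb := (hser (c i) (hc' i) lam u hub).mul_left (x i)
        have htot : HasSum ((fun m => χ lam (γ i m) * mpow x m) ∘ e i)
            (x i * ∑' n, χ lam (c i n) * u ^ n + (x i * (u * S₀) + x i * (u * S₁))) := by
          refine HasSum.sum ?_ (HasSum.sum ?_ ?_)
          · refine (congrArg (HasSum · _) (funext fun n => ?_)).mp hb
            simp only [Function.comp_apply, he, resIndex, mpow_expo, hcdef, zero_smul, hu]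
            simp [multiPow]
            ring
          · refine (congrArg (HasSum · _) (funext fun kn => ?_)).mp hS₀'
            simp only [Function.comp_apply, he, resIndex, mpow_expo, hc₀def, hu]
          · refine (congrArg (HasSum · _) (funext fun kn => ?_)).mp hS₁'
            simp only [Function.comp_apply, he, resIndex, mpow_expo, hc₁def, hu]
        simp only [mapOf]
        rw [hν i lam hlam, hz.unique htot]
        ring
      · by_contra hne
        have hne' : γ i m ≠ 0 := fun h0 => hne (by simp [h0])
        exact hm (mem_range_resIndex hrs N i hw hw' (h1 i m hne') (h2 i m hne'))
  · exact fun lam _ i => analyticOnNhd_char_pow (χ lam) hpos (hc' i)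
  · exact fun lam _ i k _ => analyticOnNhd_char_pow (χ lam) hpos (hf₀ i (k - 1))
  · exact fun lam _ i k _ => analyticOnNhd_char_pow (χ lam) hpos (hf₁ i (k - 1))
  · exact fun i => ⟨fun n lam => χ lam (c i n), fun lam _ u hu => hser _ (hc' i) lam u hu,
      fun n => ‖c i n‖, fun n lam _ => norm_char_le _ _, hc i⟩
  · exact fun i => ⟨fun kn lam => χ lam (c₀ i kn), fun k lam _ u hu => hser _ (hf₀ i k) lam u hu,
      fun n => ‖c₀ i n‖, fun n lam _ => norm_char_le _ _, hc₀ i⟩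
  · exact fun i => ⟨fun kn lam => χ lam (c₁ i kn), fun k lam _ u hu => hser _ (hf₁ i k) lam u hu,
      fun n => ‖c₁ i n‖, fun n lam _ => norm_char_le _ _, hc₁ i⟩
  · exact fun hχ i => ⟨analyticOnNhd_family_pow hχ hpos (hc' i), fun k _ =>
      ⟨analyticOnNhd_family_pow hχ hpos (hf₀ i (k - 1)),
        analyticOnNhd_family_pow hχ hpos (hf₁ i (k - 1))⟩⟩

end extraction

/-! ### Uniform contraction on half planes of exponents. -/

/-- The boundary of the half plane has direction `(A, B)` in the coordinates `(j, j')`, along which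
the monomial has size `κ = a_j^A a_{j'}^B`. The determinant condition and the resonance give `κ ^ Q
= a_j < 1`. An `A`-th power of any `μ_i⁻¹ μ^m` in the half plane can be moved to this direction by
increasing the exponent of the expanding variable, which bounds it by a positive power of `κ`. The
strict inequality leaves room for `ε`. -/
theorem exists_contraction_bound {a : Fin 2 → ℝ} (ha : ∀ i, 0 < a i) {j j' : Fin 2} (hj : j ≠ j')
    (hlt : a j < 1) {P Q A B : ℕ} (hQ : Q ≠ 0) (hres : a j ^ P * a j' ^ Q = 1)
    (hdet : Q * A = P * B + 1) {w : Fin 2 → ℤ} (hwj : w j = -B) (hwj' : w j' = A) :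
    ∃ ε > 0, ∃ θ : ℝ, 0 ≤ θ ∧ θ < 1 ∧ ∀ i, ∀ m : Fin 2 →₀ ℕ, 2 ≤ m.degree → wt w m ≤ w i →
      ((a i)⁻¹ + ε) * mpow (fun l => a l + ε) m ≤ θ := by
  have hA : A ≠ 0 := by rintro rfl; simp at hdet
  have hgt : 1 ≤ a j' := by
    by_contra! h
    have h1 : a j ^ P ≤ 1 := pow_le_one₀ (ha j).le hlt.le
    have h2 : a j' ^ Q < 1 := pow_lt_one₀ (ha j').le h hQ
    have h3 : a j ^ P * a j' ^ Q ≤ 1 * a j' ^ Q :=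
      mul_le_mul_of_nonneg_right h1 (pow_pos (ha j') _).le
    linarith
  have hκ : a j ^ A * a j' ^ B < 1 := by
    have h1 : (a j ^ A * a j' ^ B) ^ Q = a j := by
      calc (a j ^ A * a j' ^ B) ^ Q = a j ^ (Q * A) * a j' ^ (Q * B) := by
            rw [mul_pow, ← pow_mul, ← pow_mul, mul_comm A, mul_comm B]
        _ = (a j ^ P * a j' ^ Q) ^ B * a j := by
            rw [hdet, mul_pow, ← pow_mul, ← pow_mul]; ring
        _ = a j := by rw [hres, one_pow, one_mul]
    by_contra! h
    have := one_le_pow₀ h (n := Q)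
    linarith
  have hev1 : ∀ᶠ ε in 𝓝 (0 : ℝ), (a j + ε) ^ A * (a j' + ε) ^ B < 1 := by
    have : Continuous fun ε : ℝ => (a j + ε) ^ A * (a j' + ε) ^ B := by fun_prop
    exact this.continuousAt.eventually_lt continuousAt_const (by simpa using hκ)
  have hev2 : ∀ i, ∀ᶠ ε in 𝓝 (0 : ℝ),
      (((a i)⁻¹ + ε) * (a i + ε)) ^ A * ((a j + ε) ^ A * (a j' + ε) ^ B) < 1 := fun i => by
    have : Continuous fun ε : ℝ =>
      (((a i)⁻¹ + ε) * (a i + ε)) ^ A * ((a j + ε) ^ A * (a j' + ε) ^ B) := by fun_prop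
    refine this.continuousAt.eventually_lt continuousAt_const ?_
    simpa [inv_mul_cancel₀ (ha i).ne'] using hκ
  obtain ⟨ε, ⟨h1, h2⟩, hε⟩ := (((hev1.and (Filter.eventually_all.2 hev2)).filter_mono
    nhdsWithin_le_nhds).and (self_mem_nhdsWithin (a := (0 : ℝ)) (s := Set.Ioi 0))).exists
  have hε : 0 < ε := hε
  set ρ : Fin 2 → ℝ := fun l => a l + ε with hρ
  have hρ0 : ∀ l, 0 < ρ l := fun l => add_pos (ha l) hε
  have hn0 : ∀ l, 0 < (a l)⁻¹ + ε := fun l => add_pos (inv_pos.2 (ha l)) hε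
  set κ := ρ j ^ A * ρ j' ^ B with hκdef
  have hκ0 : 0 < κ := mul_pos (pow_pos (hρ0 _) _) (pow_pos (hρ0 _) _)
  set E : Fin 2 → ℝ := fun i => (((a i)⁻¹ + ε) * ρ i) ^ A * κ with hE
  have hE0 : ∀ i, 0 ≤ E i := fun i =>
    mul_nonneg (pow_nonneg (mul_nonneg (hn0 i).le (hρ0 i).le) _) hκ0.le
  have hM : max (E 0) (E 1) < 1 := max_lt (h2 0) (h2 1)
  have hM0 : 0 ≤ max (E 0) (E 1) := (hE0 0).trans (le_max_left _ _)
  have hle : ∀ i, E i ≤ max (E 0) (E 1) := fun i => by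
    fin_cases i
    · exact le_max_left _ _
    · exact le_max_right _ _
  -- All estimates are made for `A`-th powers, so that the condition on `A m_{j'}` can be used
  -- directly; the rate is therefore an `A`-th root.
  refine ⟨ε, hε, max (E 0) (E 1) ^ ((A : ℝ)⁻¹), Real.rpow_nonneg hM0 _,
    Real.rpow_lt_one hM0 hM (by positivity), fun i m hm hw => ?_⟩
  have hmp : 0 ≤ mpow ρ m := mpow_nonneg (fun l => (hρ0 l).le) m
  rw [← pow_le_pow_iff_left₀ (mul_nonneg (hn0 i).le hmp) (Real.rpow_nonneg hM0 _) hA,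
    Real.rpow_inv_natCast_pow hM0 hA]
  refine le_trans ?_ (hle i)
  have hsplit : mpow ρ m = ρ j ^ m j * ρ j' ^ m j' ∧ wt w m = -B * m j + A * m j' ∧
      m.degree = m j + m j' := by
    rw [degree_fin_two, mpow_fin_two, ← hwj, ← hwj', wt]
    obtain ⟨rfl, rfl⟩ | ⟨rfl, rfl⟩ : (j = 0 ∧ j' = 1) ∨ (j = 1 ∧ j' = 0) := by omega
    · exact ⟨rfl, rfl, rfl⟩
    · exact ⟨mul_comm _ _, add_comm _ _, add_comm _ _⟩
  obtain ⟨hs1, hs2, hs3⟩ := hsplit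
  rw [hs2] at hw
  rw [hs3] at hm
  have hρ1 : 1 ≤ ρ j' := by simp only [hρ]; linarith
  have hκ1 : κ ≤ 1 := h1.le
  rw [hs1]
  -- the exponent of the contracted variable, with the factor `x_i` removed, is positive
  have hcase : ∃ M : ℕ, 1 ≤ M ∧ ((i = j ∧ m j = M + 1 ∧ A * m j' ≤ B * M) ∨
      (i = j' ∧ m j = M ∧ A * m j' ≤ B * M + A)) := by
    by_cases hij : i = j
    · subst hij
      rw [hwj] at hw
      have hpos : 2 ≤ m i := by
        by_contra! hlt
        have h5 : 1 ≤ m j' := by omega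
        have h6 : (A : ℤ) * 1 ≤ A * m j' := by gcongr; exact_mod_cast h5
        have h7 : (B : ℤ) * m i ≤ B * 1 := by gcongr; exact_mod_cast (by omega : m i ≤ 1)
        have : 0 < A := Nat.pos_of_ne_zero hA
        have : (0 : ℤ) < A := by exact_mod_cast this
        linarith
      refine ⟨m i - 1, by omega, Or.inl ⟨rfl, by omega, ?_⟩⟩
      zify [(by omega : 1 ≤ m i)]
      linarith
    · obtain rfl : i = j' := by omega
      rw [hwj'] at hw
      have hpos : 1 ≤ m j := by
        by_contra! hlt
        have h5 : 2 ≤ m i := by omega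
        have h6 : (A : ℤ) * 2 ≤ A * m i := by gcongr; exact_mod_cast h5
        have h7 : m j = 0 := by omega
        rw [h7] at hw
        have : 0 < A := Nat.pos_of_ne_zero hA
        have : (0 : ℤ) < A := by exact_mod_cast this
        simp at hw
        linarith
      refine ⟨m j, hpos, Or.inr ⟨rfl, rfl, ?_⟩⟩
      zify
      linarith
  obtain ⟨M, hM1, hc⟩ := hcase
  have hκM : κ ^ M ≤ κ := by simpa using pow_le_pow_of_le_one hκ0.le hκ1 hM1
  have hfac : 0 ≤ (((a i)⁻¹ + ε) * ρ i) ^ A := pow_nonneg (mul_nonneg (hn0 i).le (hρ0 i).le) _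
  refine le_trans ?_ (mul_le_mul_of_nonneg_left hκM hfac)
  rcases hc with ⟨rfl, hm1, hm2⟩ | ⟨rfl, hm1, hm2⟩
  · calc (((a i)⁻¹ + ε) * (ρ i ^ m i * ρ j' ^ m j')) ^ A
        = (((a i)⁻¹ + ε) * ρ i) ^ A * (ρ i ^ (A * M) * ρ j' ^ (A * m j')) := by
          rw [hm1]; simp only [mul_pow, ← pow_mul]; ring
      _ ≤ (((a i)⁻¹ + ε) * ρ i) ^ A * (ρ i ^ (A * M) * ρ j' ^ (B * M)) := by
          have := (pow_pos (hρ0 i) (A * M)).le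
          exact mul_le_mul_of_nonneg_left (mul_le_mul_of_nonneg_left
            (pow_le_pow_right₀ hρ1 hm2) this) hfac
      _ = _ := by rw [hκdef, mul_pow (ρ i ^ A), ← pow_mul, ← pow_mul]
  · calc (((a i)⁻¹ + ε) * (ρ j ^ m j * ρ i ^ m i)) ^ A
        = ((a i)⁻¹ + ε) ^ A * (ρ j ^ (A * M) * ρ i ^ (A * m i)) := by
          rw [hm1]; simp only [mul_pow, ← pow_mul]; ring
      _ ≤ ((a i)⁻¹ + ε) ^ A * (ρ j ^ (A * M) * ρ i ^ (B * M + A)) := by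
          have := (pow_pos (hρ0 j) (A * M)).le
          exact mul_le_mul_of_nonneg_left (mul_le_mul_of_nonneg_left
            (pow_le_pow_right₀ hρ1 hm2) this) (pow_nonneg (hn0 i).le _)
      _ = _ := by rw [hκdef, mul_pow, mul_pow, ← pow_mul, ← pow_mul]; ring

/-- A Neumann series around the scalar `z`, keeping the explicit norm bound needed to compare the
inverse with `‖z‖⁻¹`. -/
theorem exists_inverse_near_scalar {C : Type*} [NormedCommRing C] [NormedAlgebra ℂ C]
    [CompleteSpace C] [NormOneClass C] {z : ℂ} (hz : z ≠ 0) {η : ℝ} (hη : η < ‖z‖) {ν : C}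
    (hν : ‖ν - algebraMap ℂ C z‖ ≤ η) :
    ∃ ν' : C, ν * ν' = 1 ∧ ‖ν'‖ ≤ ‖z‖⁻¹ * (1 - η / ‖z‖)⁻¹ := by
  have hz0 : 0 < ‖z‖ := norm_pos_iff.2 hz
  set t : C := z⁻¹ • (algebraMap ℂ C z - ν) with ht
  have htn : ‖t‖ ≤ η / ‖z‖ := by
    rw [ht, norm_smul, norm_inv, norm_sub_rev, div_eq_inv_mul]
    gcongr
  have ht1 : ‖t‖ < 1 := htn.trans_lt ((div_lt_one hz0).2 hη)
  have hgeo := mul_neg_geom_series t ht1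
  have hb := tsum_of_norm_bounded (hasSum_geometric_of_lt_one (norm_nonneg t) ht1)
    fun n => norm_pow_le t n
  refine ⟨z⁻¹ • ∑' n : ℕ, t ^ n, ?_, ?_⟩
  · have hν' : ν = z • (1 - t) := by
      rw [ht, smul_sub, smul_smul, mul_inv_cancel₀ hz, one_smul, Algebra.algebraMap_eq_smul_one]
      abel
    rw [hν', smul_mul_smul_comm, mul_inv_cancel₀ hz, one_smul, hgeo]
  · rw [norm_smul, norm_inv]
    have h1 : 0 < 1 - η / ‖z‖ := by rw [sub_pos]; exact (div_lt_one hz0).2 hη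
    gcongr
    refine hb.trans ?_
    gcongr

theorem exists_perturbation_radius {z : ℂ} (hz : z ≠ 0) {ε : ℝ} (hε : 0 < ε) :
    ∀ᶠ η in 𝓝[>] (0 : ℝ), η < ε ∧ η < ‖z‖ ∧ ‖z‖⁻¹ * (1 - η / ‖z‖)⁻¹ < ‖z‖⁻¹ + ε := by
  have hz0 : 0 < ‖z‖ := norm_pos_iff.2 hz
  refine Filter.Eventually.filter_mono nhdsWithin_le_nhds ?_
  refine (eventually_lt_nhds hε).and ((eventually_lt_nhds hz0).and ?_)
  have : ContinuousAt (fun η : ℝ => ‖z‖⁻¹ * (1 - η / ‖z‖)⁻¹) 0 := by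
    refine continuousAt_const.mul (ContinuousAt.inv₀ (by fun_prop) (by simp))
  exact this.eventually_lt continuousAt_const (by simpa using hε)

/-- If `|μ₁| < 1`, the half plane of `w` contracts under the map and that of `w'` under its inverse;
otherwise the roles are exchanged. The order of the two conjugation steps is chosen accordingly. -/
theorem exists_contraction_weights {p q r₀ s₀ : ℕ} (hp : p ≠ 0) (hq : q ≠ 0)
    (hrs : IsBezoutPair p q r₀ s₀) (N : ℕ) {a : Fin 2 → ℝ} (ha : ∀ i, 0 < a i) (ha1 : a 0 ≠ 1)
    (hres : a 0 ^ p * a 1 ^ q = 1) {w w' : Fin 2 → ℤ}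
    (hw : w = ![-((s₀ : ℤ) + N * q), (r₀ : ℤ) + N * p])
    (hw' : w' = ![((N : ℤ) + 1) * q - s₀, -(((N : ℤ) + 1) * p - r₀)]) :
    ∃ w₁ w₂ : Fin 2 → ℤ, ((w₁ = w ∧ w₂ = w') ∨ (w₁ = w' ∧ w₂ = w)) ∧ ∃ ε > 0, ∃ θ₁ θ₂ : ℝ,
      (0 ≤ θ₁ ∧ θ₁ < 1) ∧ (0 ≤ θ₂ ∧ θ₂ < 1) ∧
      (∀ i, ∀ m : Fin 2 →₀ ℕ, 2 ≤ m.degree → wt w₁ m ≤ w₁ i →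
        ((a i)⁻¹ + ε) * mpow (fun l => a l + ε) m ≤ θ₁) ∧
      (∀ i, ∀ m : Fin 2 →₀ ℕ, 2 ≤ m.degree → wt w₂ m ≤ w₂ i →
        (a i + ε) * mpow (fun l => (a l)⁻¹ + ε) m ≤ θ₂) := by
  obtain ⟨hb, hr, hs⟩ := hrs
  set a' : Fin 2 → ℝ := fun i => (a i)⁻¹ with ha'
  have ha'0 : ∀ i, 0 < a' i := fun i => inv_pos.2 (ha i)
  have hres' : a' 0 ^ p * a' 1 ^ q = 1 := by
    simp only [ha', inv_pow, ← mul_inv, hres, inv_one]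
  -- The boundary directions `α₀ + N (p, q)` and `α₁ + N (p, q)` are each unimodular with respect to
  -- `(p, q)`, like `α₀` and `α₁` themselves.
  have hdet : q * (r₀ + N * p) = p * (s₀ + N * q) + 1 := by
    zify; linear_combination hb
  have hr2 : r₀ ≤ (N + 1) * p := hr.trans (Nat.le_mul_of_pos_left p N.succ_pos)
  have hs2 : s₀ ≤ (N + 1) * q := hs.trans (Nat.le_mul_of_pos_left q N.succ_pos)
  have hdet' : p * ((N + 1) * q - s₀) = q * ((N + 1) * p - r₀) + 1 := by
    zify [hr2, hs2]; linear_combination hb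
  have hw0 : w 0 = -((s₀ + N * q : ℕ) : ℤ) := by rw [hw]; push_cast; rfl
  have hw1 : w 1 = ((r₀ + N * p : ℕ) : ℤ) := by rw [hw]; push_cast; rfl
  have hw'1 : w' 1 = -(((N + 1) * p - r₀ : ℕ) : ℤ) := by rw [hw']; push_cast [hr2]; rfl
  have hw'0 : w' 0 = (((N + 1) * q - s₀ : ℕ) : ℤ) := by rw [hw']; push_cast [hs2]; rfl
  have key : ∀ b : Fin 2 → ℝ, (∀ i, 0 < b i) → b 0 ^ p * b 1 ^ q = 1 → b 0 < 1 →
      ∃ ε > 0, ∃ θ₁ θ₂ : ℝ, (0 ≤ θ₁ ∧ θ₁ < 1) ∧ (0 ≤ θ₂ ∧ θ₂ < 1) ∧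
      (∀ i, ∀ m : Fin 2 →₀ ℕ, 2 ≤ m.degree → wt w m ≤ w i →
        ((b i)⁻¹ + ε) * mpow (fun l => b l + ε) m ≤ θ₁) ∧
      (∀ i, ∀ m : Fin 2 →₀ ℕ, 2 ≤ m.degree → wt w' m ≤ w' i →
        (b i + ε) * mpow (fun l => (b l)⁻¹ + ε) m ≤ θ₂) := by
    intro b hb0 hbres hlt
    have hb1 : 1 < b 1 := by
      by_contra! h
      have h1 : b 0 ^ p < 1 := pow_lt_one₀ (hb0 0).le hlt hp
      have h2 : b 1 ^ q ≤ 1 := pow_le_one₀ (hb0 1).le h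
      have h3 : b 0 ^ p * b 1 ^ q ≤ b 0 ^ p * 1 :=
        mul_le_mul_of_nonneg_left h2 (pow_pos (hb0 0) _).le
      linarith
    obtain ⟨ε₁, hε₁, θ₁, h0₁, h1₁, H₁⟩ := exists_contraction_bound hb0 (j := 0) (j' := 1)
      (by decide) hlt hq hbres hdet hw0 hw1
    obtain ⟨ε₂, hε₂, θ₂, h0₂, h1₂, H₂⟩ := exists_contraction_bound (a := fun i => (b i)⁻¹)
      (fun i => inv_pos.2 (hb0 i)) (j := 1) (j' := 0) (by decide) (inv_lt_one_of_one_lt₀ hb1) hp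
      (by simp only [inv_pow, ← mul_inv]; rw [mul_comm, hbres, inv_one]) hdet' hw'1 hw'0
    have hε : 0 < min ε₁ ε₂ := lt_min hε₁ hε₂
    refine ⟨min ε₁ ε₂, hε, θ₁, θ₂, ⟨h0₁, h1₁⟩, ⟨h0₂, h1₂⟩, fun i m hm hwm => ?_,
      fun i m hm hwm => ?_⟩
    · refine le_trans ?_ (H₁ i m hm hwm)
      have := inv_pos.2 (hb0 i)
      refine mul_le_mul (by gcongr; exact min_le_left _ _) ?_ (mpow_nonneg (fun l => ?_) m)
        (by positivity)
      · exact mpow_le_mpow (fun l => (add_pos (hb0 l) hε).le)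
          (fun l => by gcongr; exact min_le_left _ _) m
      · exact (add_pos (hb0 l) hε).le
    · refine le_trans ?_ (H₂ i m hm hwm)
      have := hb0 i
      have hp' : ∀ l, 0 ≤ (b l)⁻¹ + min ε₁ ε₂ := fun l =>
        (add_pos (inv_pos.2 (hb0 l)) hε).le
      simp only [inv_inv]
      refine mul_le_mul (by gcongr; exact min_le_right _ _) ?_ (mpow_nonneg hp' m)
        (by positivity)
      exact mpow_le_mpow hp' (fun l => by gcongr; exact min_le_right _ _) m
  rcases lt_or_gt_of_ne ha1 with hlt | hgt
  · exact ⟨w, w', Or.inl ⟨rfl, rfl⟩, key a ha hres hlt⟩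
  -- Passing to the inverse moduli reduces to `a 0 < 1`; the two resulting estimates are then
  -- exchanged.
  · obtain ⟨ε, hε, θ₁, θ₂, h1, h2, H1, H2⟩ := key a' ha'0 hres' (inv_lt_one_of_one_lt₀ hgt)
    simp only [ha', inv_inv] at H1 H2
    exact ⟨w', w, Or.inr ⟨rfl, rfl⟩, ε, hε, θ₂, θ₁, h2, h1, H2, H1⟩

/-! ### The normal form over an arbitrary coefficient algebra. -/

/-- The tolerance `η` depends only on the multipliers at `λ₀` and the integer data, so it is fixed
before the coefficient algebra. This permits shrinking the parameter domain until the multipliers,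
as elements of `C`, are `η`-close to scalars. -/
theorem exists_resonantForm_of_characters {μ₀ : Fin 2 → ℂ} (hμ₀ : ∀ i, μ₀ i ≠ 0 ∧ ‖μ₀ i‖ ≠ 1)
    {p q r₀ s₀ : ℕ} (hp : 0 < p) (hq : 0 < q) (hres : ‖μ₀ 0‖ ^ p * ‖μ₀ 1‖ ^ q = 1)
    (hrs : IsBezoutPair p q r₀ s₀) (N : ℕ) :
    ∃ η > 0, ∀ {P : Type} [NormedAddCommGroup P] [NormedSpace ℂ P]
      {C : Type} [NormedCommRing C] [NormedAlgebra ℂ C] [CompleteSpace C] [NormOneClass C]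
      (χ : P → C →ₐ[ℂ] ℂ) (Λ : Set P) (μ : Fin 2 → P → ℂ) (ν : Fin 2 → C)
      (_ : ∀ i, ‖ν i - algebraMap ℂ C (μ₀ i)‖ ≤ η) (_ : ∀ i, ∀ lam ∈ Λ, χ lam (ν i) = μ i lam)
      (F : Fin 2 → (Fin 2 →₀ ℕ) → C) (R : ℝ) (_ : 0 < R) (_ : ∀ i, Conv R (F i))
      (_ : ∀ i, OrdGE (fun _ => 1) (1 + 1) (F i)) (f : P → (Fin 2 → ℂ) → Fin 2 → ℂ)
      (_ : ∀ lam ∈ Λ, ∀ x ∈ polydisk R, f lam x = mapOf (χ lam) ν F x),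
    ∃ (ρ σ δ : ℝ) (h k g : P → (Fin 2 → ℂ) → Fin 2 → ℂ)
      (b : Fin 2 → P → ℂ → ℂ) (b₀ b₁ : Fin 2 → ℕ → P → ℂ → ℂ),
      IsChangeOfVariables Λ ρ σ h k ∧ IsConjugate Λ R ρ σ δ f h k g ∧
      HasResonantForm p q N ![r₀, s₀] ![p - r₀, q - s₀] Λ δ μ g b b₀ b₁ ∧
      (AnalyticOnNhd ℂ (fun z : P × C => χ z.1 z.2) (Λ ×ˢ Set.univ) →
        AnalyticOnNhd ℂ (fun z : P × (Fin 2 → ℂ) => h z.1 z.2) (Λ ×ˢ polydisk ρ) ∧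
        AnalyticOnNhd ℂ (fun z : P × (Fin 2 → ℂ) => k z.1 z.2) (Λ ×ˢ polydisk σ) ∧
        AnalyticOnNhd ℂ (fun z : P × (Fin 2 → ℂ) => g z.1 z.2) (Λ ×ˢ polydisk δ) ∧
        ∀ i,
          AnalyticOnNhd ℂ (fun z : P × ℂ => b i z.1 z.2) (Λ ×ˢ Metric.ball 0 (δ ^ (p + q))) ∧
          ∀ j, 1 ≤ j →
            AnalyticOnNhd ℂ (fun z : P × ℂ => b₀ i j z.1 z.2)
              (Λ ×ˢ Metric.ball 0 (δ ^ (p + q))) ∧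
            AnalyticOnNhd ℂ (fun z : P × ℂ => b₁ i j z.1 z.2)
              (Λ ×ˢ Metric.ball 0 (δ ^ (p + q)))) := by
  have ha0 : ∀ i, 0 < ‖μ₀ i‖ := fun i => norm_pos_iff.2 (hμ₀ i).1
  obtain ⟨w, hw⟩ : ∃ w : Fin 2 → ℤ, w = ![-((s₀ : ℤ) + N * q), (r₀ : ℤ) + N * p] := ⟨_, rfl⟩
  obtain ⟨w', hw'⟩ : ∃ w' : Fin 2 → ℤ,
    w' = ![((N : ℤ) + 1) * q - s₀, -(((N : ℤ) + 1) * p - r₀)] := ⟨_, rfl⟩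
  obtain ⟨w₁, w₂, hww, ε, hε, θ₁, θ₂, hθ₁, hθ₂, H₁, H₂⟩ := exists_contraction_weights hp.ne' hq.ne'
    hrs N ha0 (hμ₀ 0).2 hres hw hw'
  obtain ⟨η, hη, hη0⟩ := ((Filter.eventually_all.2 fun i =>
    exists_perturbation_radius (hμ₀ i).1 hε).and self_mem_nhdsWithin).exists
  refine ⟨η, hη0, fun {P} _ _ {C} _ _ _ _ χ Λ μ ν hν hνμ F R hR hF hF2 f hf => ?_⟩
  choose ν' hν' hν'n using fun i => exists_inverse_near_scalar (hμ₀ i).1 (hη i).2.1 (hν i)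
  have hνn : ∀ i, ‖ν i‖ < ‖μ₀ i‖ + ε := fun i => by
    have h1 : ‖ν i‖ ≤ ‖algebraMap ℂ C (μ₀ i)‖ + ‖ν i - algebraMap ℂ C (μ₀ i)‖ := by
      simpa using norm_add_le (algebraMap ℂ C (μ₀ i)) (ν i - algebraMap ℂ C (μ₀ i))
    rw [norm_algebraMap'] at h1
    linarith [hν i, (hη i).1]
  have hν'n' : ∀ i, ‖ν' i‖ < ‖μ₀ i‖⁻¹ + ε := fun i => (hν'n i).trans_lt (hη i).2.2
  obtain ⟨ρ, σ, δ, h, k, γ, hcv, hconj, hγ, hord, han⟩ := exists_conjugation χ Λ w₁ w₂ hν' hR hF hF2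
    (fun i => ‖μ₀ i‖ + ε) (fun i => ‖μ₀ i‖⁻¹ + ε) hνn hθ₁.1 hθ₁.2
    (fun i m hm hwm => le_trans (mul_le_mul_of_nonneg_right (hν'n' i).le
      (mpow_nonneg (fun l => (add_pos (ha0 l) hε).le) m)) (H₁ i m hm hwm))
    hν'n' hθ₂.1 hθ₂.2
    (fun i m hm hwm => le_trans (mul_le_mul_of_nonneg_right (hνn i).le
      (mpow_nonneg (fun l => (add_pos (inv_pos.2 (ha0 l)) hε).le) m)) (H₂ i m hm hwm)) f hf
  obtain ⟨ho, ho'⟩ : (∀ i, OrdGE w (w i + 1) (γ i)) ∧ ∀ i, OrdGE w' (w' i + 1) (γ i) := by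
    obtain ⟨h1, h2⟩ | ⟨h1, h2⟩ := hww
    · exact ⟨hord w (by simp [h1]), hord w' (by simp [h2])⟩
    · exact ⟨hord w (by simp [h2]), hord w' (by simp [h1])⟩
  obtain ⟨b, b₀, b₁, hform, hban⟩ :=
    hasResonantForm hp hrs hconj.radius_pos χ Λ hνμ hγ hw hw' ho ho'
  exact ⟨ρ, σ, δ, h, k, _, b, b₀, b₁, hcv, hconj, hform, fun hχ => ⟨(han hχ).1, (han hχ).2,
    analyticOnNhd_mapOf_family hχ ν hconj.radius_pos hγ, hban hχ⟩⟩

/-! ### Families with bounded coefficients. -/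

theorem multiDeg_eq_degree (m : Fin 2 → ℕ) :
    (Finsupp.equivFunOnFinite.symm m).degree = multiDeg m := by
  rw [degree_fin_two, multiDeg, Fin.sum_univ_two]
  rfl

theorem mpow_equivFunOnFinite_symm (x : Fin 2 → ℂ) (m : Fin 2 → ℕ) :
    mpow x (Finsupp.equivFunOnFinite.symm m) = multiPow x m := by
  rw [mpow_fin_two, multiPow, Fin.prod_univ_two]
  rfl

theorem exists_series_of_subtype {C : Type*} [NormedCommRing C] [NormedAlgebra ℂ C]
    (A : {m : Fin 2 → ℕ // 2 ≤ multiDeg m} → C) {R : ℝ}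
    (hA : Summable fun m => ‖A m‖ * R ^ multiDeg m.1) :
    ∃ F : (Fin 2 →₀ ℕ) → C, Conv R F ∧ OrdGE (fun _ => 1) (1 + 1) F ∧
      ∀ (χ : C →ₐ[ℂ] ℂ) (x : Fin 2 → ℂ) (S : ℂ),
        HasSum (fun m : {m : Fin 2 → ℕ // 2 ≤ multiDeg m} => multiPow x m * χ (A m)) S →
        fval χ F x = S := by
  let e : {m : Fin 2 → ℕ // 2 ≤ multiDeg m} → Fin 2 →₀ ℕ :=
    fun m => Finsupp.equivFunOnFinite.symm m.1
  have he : Function.Injective e := Finsupp.equivFunOnFinite.symm.injective.comp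
    Subtype.val_injective
  let F : (Fin 2 →₀ ℕ) → C := Function.extend e A 0
  have hF : ∀ m, F (e m) = A m := fun m => he.extend_apply _ _ _
  have hF0 : ∀ m, m ∉ Set.range e → F m = 0 := fun m hm => Function.extend_apply' _ _ _ hm
  refine ⟨F, (he.summable_iff fun m hm => ?_).1 ?_, fun m hm => ?_, fun χ x S hS => ?_⟩
  · simp [hF0 m hm]
  · refine hA.congr fun m => ?_
    simp only [Function.comp_apply, hF]
    rw [multiDeg_eq_degree]
  · by_cases hm' : m ∈ Set.range e
    · obtain ⟨m, rfl⟩ := hm'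
      rw [wt_one, multiDeg_eq_degree]
      exact_mod_cast m.2
    · exact absurd (hF0 m hm') hm
  · refine HasSum.tsum_eq ((he.hasSum_iff fun m hm => ?_).1 ?_)
    · rw [hF0 m hm, map_zero, zero_mul]
    · refine (congrArg (HasSum · _) (funext fun m => ?_)).mp hS
      simp only [Function.comp_apply, hF, e, mpow_equivFunOnFinite_symm, mul_comm]

/-- Evaluation of bounded functions at a point. -/
noncomputable def boundedEval {ι : Type*} (s : ι) : lp (fun _ : ι => ℂ) ⊤ →ₐ[ℂ] ℂ where
  toFun c := c s
  map_one' := rfl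
  map_mul' _ _ := rfl
  map_zero' := rfl
  map_add' _ _ := rfl
  commutes' _ := rfl

/-- The coefficient algebra is `lp _ ⊤` over the small neighbourhood `Λ'`. Its norm is the supremum
over the parameter, so the hypothesis on the family is convergence in this algebra, and continuity
of the multipliers makes them close to constants. -/
theorem exists_resonantForm_of_bounded {P : Type} [NormedAddCommGroup P] [NormedSpace ℂ P]
    {lam₀ : P} {Λ : Set P} (hΛ : Λ ∈ 𝓝 lam₀) {R : ℝ}
    {μ : Fin 2 → P → ℂ} {a : (Fin 2 → ℕ) → P → (Fin 2 → ℂ)} {f : P → (Fin 2 → ℂ) → (Fin 2 → ℂ)}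
    (hf : IsPlanarFamily Λ R μ a f) (hμ : ∀ i, ContinuousAt (μ i) lam₀)
    (hhyp : IsHyperbolicAt μ lam₀) {p q : ℕ} (hp : 0 < p) (hq : 0 < q)
    (hres : ‖μ 0 lam₀‖ ^ p * ‖μ 1 lam₀‖ ^ q = 1) {r₀ s₀ : ℕ} (hrs : IsBezoutPair p q r₀ s₀)
    (N : ℕ) :
    ∃ (Λ' : Set P) (ρ σ δ : ℝ) (h k g : P → (Fin 2 → ℂ) → (Fin 2 → ℂ))
      (b : Fin 2 → P → ℂ → ℂ) (b₀ b₁ : Fin 2 → ℕ → P → ℂ → ℂ),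
      Λ' ∈ 𝓝 lam₀ ∧ Λ' ⊆ Λ ∧ IsChangeOfVariables Λ' ρ σ h k ∧
      IsConjugate Λ' R ρ σ δ f h k g ∧
      HasResonantForm p q N ![r₀, s₀] ![p - r₀, q - s₀] Λ' δ μ g b b₀ b₁ := by
  obtain ⟨η, hη, H⟩ := exists_resonantForm_of_characters (μ₀ := fun i => μ i lam₀) hhyp hp hq hres
    hrs N
  have hev : ∀ i, ∀ᶠ lam in 𝓝 lam₀, dist (μ i lam) (μ i lam₀) < η := fun i =>
    (hμ i).eventually (Metric.ball_mem_nhds _ hη)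
  set Λ' := Λ ∩ {lam | ∀ i, dist (μ i lam) (μ i lam₀) < η} with hΛ'
  have hΛ'n : Λ' ∈ 𝓝 lam₀ := Filter.inter_mem hΛ (Filter.eventually_all.2 hev)
  let l₀ : Λ' := ⟨lam₀, mem_of_mem_nhds hΛ'n⟩
  have : Nonempty Λ' := ⟨l₀⟩
  obtain ⟨M, hM, hMs⟩ := hf.summable
  classical
  -- Outside `Λ'` any character will do, since every conclusion is restricted to `Λ'`; evaluation at
  -- `λ₀` serves as default.
  let χ : P → lp (fun _ : Λ' => ℂ) ⊤ →ₐ[ℂ] ℂ := fun lam =>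
    if h : lam ∈ Λ' then boundedEval ⟨lam, h⟩ else boundedEval l₀
  have hχ : ∀ lam (h : lam ∈ Λ') c, χ lam c = c ⟨lam, h⟩ := fun lam h c => by
    simp only [χ, dif_pos h]; rfl
  let ν : Fin 2 → lp (fun _ : Λ' => ℂ) ⊤ := fun i =>
    ⟨fun lam => μ i lam, memℓp_infty ⟨‖μ i lam₀‖ + η, by
      rintro _ ⟨lam, rfl⟩
      have := lam.2.2 i
      rw [dist_eq_norm] at this
      calc ‖μ i lam‖ = ‖μ i lam₀ + (μ i lam - μ i lam₀)‖ := by congr 1; ring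
        _ ≤ ‖μ i lam₀‖ + ‖μ i lam - μ i lam₀‖ := norm_add_le _ _
        _ ≤ _ := by gcongr⟩⟩
  have hbd : ∀ i m, ∀ lam : Λ', ‖a m.1 lam i‖ ≤ M m := fun i m lam =>
    (norm_le_pi_norm _ i).trans (hM m lam lam.2.1)
  let A : Fin 2 → {m : Fin 2 → ℕ // 2 ≤ multiDeg m} → lp (fun _ : Λ' => ℂ) ⊤ := fun i m =>
    ⟨fun lam => a m lam i, memℓp_infty ⟨M m, by rintro _ ⟨lam, rfl⟩; exact hbd i m lam⟩⟩
  have hA : ∀ i m, ‖A i m‖ ≤ M m := fun i m => lp.norm_le_of_forall_le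
    ((norm_nonneg _).trans (hbd i m l₀)) (hbd i m)
  choose F hFc hFo hFv using fun i => exists_series_of_subtype (A i) (R := R)
    (hMs.of_nonneg_of_le (fun m => mul_nonneg (norm_nonneg _) (pow_nonneg hf.radius_pos.le _))
      fun m => mul_le_mul_of_nonneg_right (hA i m) (pow_nonneg hf.radius_pos.le _))
  have hν : ∀ i, ‖ν i - algebraMap ℂ _ (μ i lam₀)‖ ≤ η := fun i => by
    refine lp.norm_le_of_forall_le hη.le fun lam => ?_
    have := lam.2.2 i
    rw [dist_eq_norm] at this
    exact this.le
  have hfF : ∀ lam ∈ Λ', ∀ x ∈ polydisk R, f lam x = mapOf (χ lam) ν F x := fun lam h x hx => by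
    ext i
    have hs := Pi.hasSum.1 (hf.hasSum lam h.1 x hx) i
    rw [mapOf, hFv i (χ lam) x _ ?_, hχ lam h]
    · exact (add_sub_cancel _ _).symm
    · refine (congrArg (HasSum · _) (funext fun m => ?_)).mp hs
      rw [hχ lam h]
      rfl
  obtain ⟨ρ, σ, δ, h, k, g, b, b₀, b₁, h1, h2, h3, -⟩ := H χ Λ' μ ν hν
    (fun i lam h => hχ lam h _) F R hf.radius_pos hFc hFo f hfF
  exact ⟨Λ', ρ, σ, δ, h, k, g, b, b₀, b₁, hΛ'n, Set.inter_subset_left, h1, h2, h3⟩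

/-! ### Families analytic in the parameter. -/

namespace AbsSeries

variable {σ : Type*}

/-- The character of evaluation at a point of the closed unit polydisk. -/
noncomputable def evalChar (y : σ → ℂ) (hy : ∀ i, ‖y i‖ ≤ 1) : AbsSeries σ ℂ →ₐ[ℂ] ℂ :=
  { evalHom (RingHom.id ℂ) (fun _ => le_rfl) y hy with
    commutes' := fun r => by
      have : algebraMap ℂ (AbsSeries σ ℂ) r = const r := by
        classical
        ext m
        rw [Algebra.algebraMap_eq_smul_one, coeff_smul, coeff_one, coeff_const]
        split_ifs <;> simp
      rw [this]
      exact evalHom_const _ _ _ _ r }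

theorem evalChar_apply (y : σ → ℂ) (hy : ∀ i, ‖y i‖ ≤ 1) (φ : AbsSeries σ ℂ) :
    evalChar y hy φ = ∑' m, φ.coeff m * mpow y m := rfl

theorem evalChar_X (y : σ → ℂ) (hy : ∀ i, ‖y i‖ ≤ 1) (i : σ) : evalChar y hy (X i) = y i :=
  evalHom_X (RingHom.id ℂ) (fun _ => le_rfl) y hy i

/-- The series `φ(t y)`. -/
noncomputable def dilate (t : ℂ) (ht : ‖t‖ ≤ 1) (φ : AbsSeries σ ℂ) : AbsSeries σ ℂ :=
  mk (fun m => t ^ m.degree * φ.coeff m) <|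
    φ.summable_norm_coeff.of_nonneg_of_le (fun _ => norm_nonneg _) fun m => by
      rw [norm_mul, norm_pow]
      exact mul_le_of_le_one_left (norm_nonneg _) (pow_le_one₀ (norm_nonneg _) ht)

theorem norm_dilate_le (t : ℂ) (ht : ‖t‖ ≤ 1) (φ : AbsSeries σ ℂ) : ‖dilate t ht φ‖ ≤ ‖φ‖ := by
  refine Summable.tsum_le_tsum (fun m => ?_) (summable_norm_coeff _) (summable_norm_coeff _)
  rw [dilate, coeff_mk, norm_mul, norm_pow]
  exact mul_le_of_le_one_left (norm_nonneg _) (pow_le_one₀ (norm_nonneg _) ht)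

theorem evalChar_dilate (t : ℂ) (ht : ‖t‖ ≤ 1) (y : σ → ℂ) (hy : ∀ i, ‖y i‖ ≤ 1)
    (hty : ∀ i, ‖t * y i‖ ≤ 1) (φ : AbsSeries σ ℂ) :
    evalChar y hy (dilate t ht φ) = evalChar (fun i => t * y i) hty φ := by
  rw [evalChar_apply, evalChar_apply]
  refine tsum_congr fun m => ?_
  have : (fun i => t * y i) = (fun _ => t) * y := rfl
  rw [dilate, coeff_mk, this, mpow_mul, mpow_const]
  ring

theorem evalChar_zero (hy : ∀ i, ‖(0 : σ → ℂ) i‖ ≤ 1) (φ : AbsSeries σ ℂ) :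
    evalChar 0 hy φ = φ.coeff 0 := by
  rw [evalChar_apply, tsum_eq_single 0]
  · simp [mpow_zero]
  · intro m hm
    obtain ⟨i, hi⟩ := Finsupp.ne_iff.1 hm
    have : mpow (0 : σ → ℂ) m = 0 :=
      Finset.prod_eq_zero (Finsupp.mem_support_iff.2 hi) (by simpa using hi)
    rw [this, mul_zero]

/-- Every nonconstant monomial picks up a factor `t` at least once. Dilation is how a multiplier is
brought close to its value at `λ₀` in the norm of the algebra. -/
theorem norm_dilate_sub_le (t : ℂ) (ht : ‖t‖ ≤ 1) (φ : AbsSeries σ ℂ) :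
    ‖dilate t ht φ - algebraMap ℂ _ (φ.coeff 0)‖ ≤ ‖t‖ * ‖φ‖ := by
  classical
  rw [norm_def, norm_def, ← tsum_mul_left]
  refine Summable.tsum_le_tsum (fun m => ?_) (summable_norm_coeff _)
    (φ.summable_norm_coeff.mul_left _)
  rw [coeff_sub, dilate, coeff_mk, Algebra.algebraMap_eq_smul_one, coeff_smul, coeff_one]
  split_ifs with h
  · subst h
    simp
    positivity
  · have hd : m.degree ≠ 0 := by simpa [Finsupp.degree_eq_zero_iff] using h
    rw [smul_zero, sub_zero, norm_mul, norm_pow]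
    gcongr
    exact pow_le_of_le_one (norm_nonneg _) ht hd

/-- The evaluation functional at `y` is the sum of `y^m` times the coefficient functionals, whose
norms are at most one. It is thus an analytic function of `y` in the open unit polydisk with values
in the dual, and the pairing with the dual is bilinear. -/
theorem analyticOnNhd_evalChar [Fintype σ] {P : Type*} [NormedAddCommGroup P] [NormedSpace ℂ P]
    {Y : P → σ → ℂ} (hY : ∀ lam i, ‖Y lam i‖ ≤ 1) {Λ : Set P} (hYa : AnalyticOnNhd ℂ Y Λ)
    (hYΛ : ∀ lam ∈ Λ, Y lam ∈ Metric.ball 0 1) :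
    AnalyticOnNhd ℂ (fun z : P × AbsSeries σ ℂ => evalChar (Y z.1) (hY z.1) z.2)
      (Λ ×ˢ Set.univ) := by
  set T : (σ →₀ ℕ) → AbsSeries σ ℂ →L[ℂ] ℂ := fun m => coeffCLM m
  have hT : AnalyticOnNhd ℂ (fun y : σ → ℂ => ∑' m, mpow y m • T m) (Metric.ball 0 1) :=
    analyticOnNhd_tsum_mpow T one_pos (K := 1) fun m => by
      simpa using norm_coeffCLM_le (C := ℂ) m
  have happ : ∀ y ∈ Metric.ball (0 : σ → ℂ) 1, ∀ φ,
      (∑' m, mpow y m • T m) φ = ∑' m, φ.coeff m * mpow y m := by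
    intro y hy φ
    have hs : Summable fun m => mpow y m • T m := by
      refine Summable.of_norm_bounded (summable_pow_degree (norm_nonneg y)
        (mem_ball_zero_iff.1 hy)) fun m => ?_
      rw [norm_smul, ← mpow_const]
      exact (mul_le_of_le_one_right (norm_nonneg _) (norm_coeffCLM_le m)).trans
        (norm_mpow_le y (norm_le_pi_norm y) m)
    have := (ContinuousLinearMap.apply ℂ ℂ φ).map_tsum hs
    simp only [ContinuousLinearMap.apply_apply] at this
    rw [this]
    refine tsum_congr fun m => ?_
    simp [T, mul_comm]
  intro z hz
  have h1 : AnalyticAt ℂ (fun z : P × AbsSeries σ ℂ => (∑' m, mpow (Y z.1) m • T m) z.2) z := by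
    have hb := (ContinuousLinearMap.id ℂ (AbsSeries σ ℂ →L[ℂ] ℂ)).analyticAt_bilinear
      (∑' m, mpow (Y z.1) m • T m, z.2)
    have hp : AnalyticAt ℂ (fun z : P × AbsSeries σ ℂ => ∑' m, mpow (Y z.1) m • T m) z :=
      (hT _ (hYΛ _ hz.1)).comp_of_eq ((hYa _ hz.1).comp_of_eq analyticAt_fst rfl) rfl
    exact hb.comp_of_eq (f := fun z : P × AbsSeries σ ℂ => (∑' m, mpow (Y z.1) m • T m, z.2))
      (hp.prod analyticAt_snd) rfl
  refine h1.congr ?_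
  have hcont : ContinuousAt (fun z : P × AbsSeries σ ℂ => Y z.1) z :=
    (hYa _ hz.1).continuousAt.comp continuousAt_fst
  filter_upwards [hcont.eventually (Metric.isOpen_ball.mem_nhds (hYΛ _ hz.1))] with y hy
  rw [happ _ hy, evalChar_apply]

end AbsSeries

section germ

variable {d : ℕ}

/-- The coordinate vectors of the product of the parameter space and the phase space. -/
noncomputable def coordVec : Fin d ⊕ Fin 2 → (Fin d → ℂ) × (Fin 2 → ℂ)
  | .inl j => (Pi.single j 1, 0)
  | .inr j => (0, Pi.single j 1)

theorem norm_coordVec (s : Fin d ⊕ Fin 2) : ‖(coordVec s : (Fin d → ℂ) × (Fin 2 → ℂ))‖ ≤ 1 := by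
  rcases s with j | j <;> simp [coordVec, Prod.norm_def, Pi.norm_single]

theorem sum_smul_coordVec (y : Fin d → ℂ) (x : Fin 2 → ℂ) :
    ∑ s : Fin d ⊕ Fin 2, Sum.elim y x s • coordVec s = (y, x) := by
  rw [Fintype.sum_sum_type]
  simp only [coordVec, Sum.elim_inl, Sum.elim_inr]
  ext j
  · simp [Prod.fst_sum, Finset.sum_apply, Pi.single_apply]
  · fin_cases j <;> simp [Prod.snd_sum]

/-- The coordinate functions of the product of the parameter space and the phase space. -/
noncomputable def coordFun : Fin d ⊕ Fin 2 → AbsSeries (Fin 2) (AbsSeries (Fin d) ℂ)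
  | .inl j => AbsSeries.const (AbsSeries.X j)
  | .inr j => AbsSeries.X j

theorem norm_coordFun (s : Fin d ⊕ Fin 2) : ‖coordFun s‖ ≤ 1 := by
  rcases s with j | j <;> simp [coordFun]

/-- Each homogeneous term of the joint expansion is expanded over words in the `d + 2` coordinates
and reassembled as a series in `x` with coefficients that are series in the rescaled parameter. -/
theorem exists_absSeries_of_analyticAt {g : (Fin d → ℂ) × (Fin 2 → ℂ) → ℂ}
    {z₀ : (Fin d → ℂ) × (Fin 2 → ℂ)} (hg : AnalyticAt ℂ g z₀) :
    ∀ᶠ r : ℝ in 𝓝[>] (0 : ℝ), ∃ D : AbsSeries (Fin 2) (AbsSeries (Fin d) ℂ), ∀ y hy x,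
      (∀ i, ‖x i‖ ≤ 1) →
      g (z₀ + (r : ℂ) • (y, x)) = ∑' m, AbsSeries.evalChar y hy (D.coeff m) * mpow x m := by
  obtain ⟨p, ρ, hp⟩ := hg
  -- There are `K ^ n` words of length `n`, so the radius has to be divided by `K` to keep the
  -- expansion absolutely convergent.
  set K : ℝ := (Fintype.card (Fin d ⊕ Fin 2) : ℝ) with hK
  have hK1 : 1 ≤ K := by rw [hK]; simp; linarith [(Nat.cast_nonneg d : (0 : ℝ) ≤ d)]
  obtain ⟨s, hs0, hsρ⟩ := ENNReal.lt_iff_exists_nnreal_btwn.1 hp.r_pos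
  have hs0 : 0 < (s : ℝ) := by exact_mod_cast hs0
  filter_upwards [Ioo_mem_nhdsGT (div_pos hs0 (zero_lt_one.trans_le hK1))] with r hr
  have hr0 : 0 < r := hr.1
  have hrK : K * r ≤ s := by
    have := hr.2.le
    rw [le_div_iff₀ (zero_lt_one.trans_le hK1)] at this
    linarith
  have hrs : r ≤ s := (le_mul_of_one_le_left hr0.le hK1).trans hrK
  have hpsum : Summable fun n => ‖p n‖ * (s : ℝ) ^ n :=
    p.summable_norm_mul_pow (hsρ.trans_le hp.r_le)
  set t : ℕ → AbsSeries (Fin 2) (AbsSeries (Fin d) ℂ) := fun n =>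
    ∑ v : Fin n → Fin d ⊕ Fin 2,
      ((r : ℂ) ^ n * p n fun k => coordVec (v k)) • ∏ k, coordFun (v k) with ht
  have htn : ∀ n, ‖t n‖ ≤ ‖p n‖ * (s : ℝ) ^ n := fun n => by
    have h1 : ∀ v : Fin n → Fin d ⊕ Fin 2,
        ‖((r : ℂ) ^ n * p n fun k => coordVec (v k)) • ∏ k, coordFun (v k)‖ ≤ r ^ n * ‖p n‖ := by
      intro v
      have hprod : ‖∏ k, coordFun (v k)‖ ≤ 1 :=
        (Finset.norm_prod_le _ _).trans (Finset.prod_le_one (fun _ _ => norm_nonneg _)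
          fun k _ => norm_coordFun _)
      have hpn : ‖p n fun k => coordVec (v k)‖ ≤ ‖p n‖ := by
        refine ((p n).le_opNorm _).trans (mul_le_of_le_one_right (norm_nonneg _) ?_)
        exact Finset.prod_le_one (fun _ _ => norm_nonneg _) fun k _ => norm_coordVec _
      rw [norm_smul, norm_mul, norm_pow, Complex.norm_real, Real.norm_of_nonneg hr0.le]
      refine (mul_le_of_le_one_right (by positivity) hprod).trans ?_
      gcongr
    calc ‖t n‖ ≤ ∑ v : Fin n → Fin d ⊕ Fin 2, r ^ n * ‖p n‖ :=
          (norm_sum_le _ _).trans (Finset.sum_le_sum fun v _ => h1 v)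
      _ = ‖p n‖ * (K * r) ^ n := by
          rw [Finset.sum_const, Finset.card_univ, Fintype.card_fun, Fintype.card_fin,
            nsmul_eq_mul, mul_pow, hK]
          push_cast
          ring
      _ ≤ _ := by
          have : 0 ≤ K * r := by positivity
          gcongr
  have hts : Summable t := Summable.of_norm_bounded hpsum htn
  refine ⟨∑' n, t n, fun y hy x hx => ?_⟩
  set χ := AbsSeries.evalChar y hy with hχ
  set Φ := AbsSeries.evalHom (χ : AbsSeries (Fin d) ℂ →+* ℂ) (norm_char_coe_le χ) x hx with hΦ
  have hΦc : ∀ s : Fin d ⊕ Fin 2, Φ (coordFun s) = Sum.elim y x s := by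
    rintro (j | j)
    · simp only [coordFun, Sum.elim_inl, hΦ, AbsSeries.evalHom_const]
      exact AbsSeries.evalChar_X y hy j
    · simp only [coordFun, Sum.elim_inr, hΦ, AbsSeries.evalHom_X]
  have hΦs : ∀ (c : ℂ) φ, Φ (c • φ) = c * Φ φ := by
    intro c φ
    simp only [hΦ, AbsSeries.evalHom_apply]
    rw [← tsum_mul_left]
    refine tsum_congr fun m => ?_
    rw [AbsSeries.coeff_smul, RingHom.coe_coe, map_smul, smul_eq_mul, mul_assoc]
  have hyx : ‖((r : ℂ) • (y, x) : (Fin d → ℂ) × (Fin 2 → ℂ))‖ ≤ r := by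
    rw [norm_smul, Complex.norm_real, Real.norm_of_nonneg hr0.le]
    refine mul_le_of_le_one_right hr0.le ?_
    rw [Prod.norm_def]
    exact max_le ((pi_norm_le_iff_of_nonneg zero_le_one).2 hy)
      ((pi_norm_le_iff_of_nonneg zero_le_one).2 hx)
  have hmem : ((r : ℂ) • (y, x) : (Fin d → ℂ) × (Fin 2 → ℂ)) ∈ Metric.eball 0 ρ := by
    rw [Metric.mem_eball, edist_zero_right]
    refine lt_of_le_of_lt ?_ hsρ
    rw [← ofReal_norm, ← ENNReal.ofReal_coe_nnreal]
    exact ENNReal.ofReal_le_ofReal (hyx.trans hrs)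
  have hG := hp.hasSum hmem
  have hΦt : ∀ n, Φ (t n) = p n fun _ => (r : ℂ) • (y, x) := fun n => by
    have h1 : (p n fun _ => (r : ℂ) • (y, x)) = (r : ℂ) ^ n * p n fun _ => (y, x) := by
      have := (p n).toMultilinearMap.map_smul_univ (fun _ => (r : ℂ)) fun _ => (y, x)
      simpa using this
    have h2 : (p n fun _ => (y, x))
        = ∑ v : Fin n → Fin d ⊕ Fin 2, (∏ k, Sum.elim y x (v k)) * p n fun k => coordVec (v k) := by
      rw [← sum_smul_coordVec y x]
      have := (p n).toMultilinearMap.map_sum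
        (fun (_ : Fin n) (s : Fin d ⊕ Fin 2) => Sum.elim y x s • coordVec s)
      refine this.trans (Finset.sum_congr rfl fun v _ => ?_)
      exact (p n).toMultilinearMap.map_smul_univ (fun k => Sum.elim y x (v k))
        fun k => coordVec (v k)
    rw [h1, h2, ht, map_sum, Finset.mul_sum]
    refine Finset.sum_congr rfl fun v _ => ?_
    rw [hΦs, map_prod]
    simp only [hΦc]
    ring
  have h3 := hts.hasSum.map Φ (AbsSeries.continuous_evalHom _ _ _ _)
  have h4 : HasSum (fun n => p n fun _ => (r : ℂ) • (y, x)) (Φ (∑' n, t n)) := by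
    simpa only [Function.comp_def, hΦt] using h3
  exact hG.unique h4

end germ

section lowOrder

variable {C : Type*} [NormedCommRing C]

/-- The part of order at least two. -/
noncomputable def highPart (c : (Fin 2 →₀ ℕ) → C) (m : Fin 2 →₀ ℕ) : C :=
  if 2 ≤ m.degree then c m else 0

theorem ordGE_highPart (c : (Fin 2 →₀ ℕ) → C) : OrdGE (fun _ => 1) (1 + 1) (highPart c) := by
  intro m hm
  rw [wt_one]
  by_contra! h
  exact hm (if_neg (by omega))

theorem conv_highPart {c : (Fin 2 →₀ ℕ) → C} {s : ℝ} (hs : 0 ≤ s) (hc : Conv s c) :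
    Conv s (highPart c) := hc.of_norm_le hs (K := 1) fun m => by
  rw [highPart]
  split_ifs <;> simp

variable [NormedAlgebra ℂ C] [CompleteSpace C] [NormOneClass C]

theorem fval_eq_affine_add {c : (Fin 2 →₀ ℕ) → C} {s : ℝ} (hs : 0 ≤ s) (hc : Conv s c)
    (χ : C →ₐ[ℂ] ℂ) {x : Fin 2 → ℂ} (hx : ∀ i, ‖x i‖ ≤ s) :
    fval χ c x = χ (c 0) + (χ (c (Finsupp.single 0 1)) * x 0 + χ (c (Finsupp.single 1 1)) * x 1)
      + fval χ (highPart c) x := by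
  have h1 := hc.summable_fval χ hx
  have h2 := (conv_highPart hs hc).summable_fval χ hx
  rw [← sub_eq_iff_eq_add, fval, fval, ← h1.tsum_sub h2]
  have h01 : (Finsupp.single 0 1 : Fin 2 →₀ ℕ) ≠ Finsupp.single 1 1 := fun h => by
    simpa using DFunLike.congr_fun h 0
  have h0 : ∀ j : Fin 2, (0 : Fin 2 →₀ ℕ) ≠ Finsupp.single j 1 := fun j h => by
    simpa using DFunLike.congr_fun h j
  rw [tsum_eq_sum (s := {0, Finsupp.single 0 1, Finsupp.single 1 1})]
  · rw [Finset.sum_insert (by simp [h0]), Finset.sum_insert (by simpa using h01),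
      Finset.sum_singleton]
    simp [highPart, degree_fin_two, mpow_zero, mpow_single]
  · intro m hm
    simp only [Finset.mem_insert, Finset.mem_singleton, not_or] at hm
    have hdeg : 2 ≤ m.degree := by
      by_contra! hlt
      rw [degree_fin_two] at hlt
      have : (m 0 = 0 ∧ m 1 = 0) ∨ (m 0 = 1 ∧ m 1 = 0) ∨ (m 0 = 0 ∧ m 1 = 1) := by omega
      rcases this with h | h | h
      · exact hm.1 (Finsupp.ext fun j => by fin_cases j <;> simp [h])
      · exact hm.2.1 (Finsupp.ext fun j => by fin_cases j <;> simp [h])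
      · exact hm.2.2 (Finsupp.ext fun j => by fin_cases j <;> simp [h])
    simp [highPart, hdeg]

theorem norm_fval_le_sq {c : (Fin 2 →₀ ℕ) → C} {s t : ℝ} (hs : 0 < s) (hc : Conv s c)
    (h2 : OrdGE (fun _ => 1) (1 + 1) c) (χ : C →ₐ[ℂ] ℂ) (ht : 0 ≤ t) (hts : t ≤ s)
    {x : Fin 2 → ℂ} (hx : ∀ i, ‖x i‖ ≤ t) :
    ‖fval χ c x‖ ≤ ((∑' m, ‖c m‖ * s ^ m.degree) / s ^ 2) * t ^ 2 := by
  obtain ⟨h3, h4⟩ := hc.bound 2 (by exact_mod_cast h2) ht hs hts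
  refine (h3.norm_fval_le χ hx).trans (h4.trans_eq ?_)
  rw [div_pow]
  ring

theorem eq_zero_of_norm_le_mul {z : ℂ} {s K : ℝ} (hs : 0 < s)
    (h : ∀ t, 0 < t → t < s → ‖z‖ ≤ K * t) : z = 0 := by
  have hlim : Filter.Tendsto (fun t : ℝ => K * t) (𝓝[>] 0) (𝓝 0) := by
    have : Continuous fun t : ℝ => K * t := by fun_prop
    simpa using this.continuousAt.tendsto.mono_left (nhdsWithin_le_nhds (a := 0) (s := Set.Ioi 0))
  have := ge_of_tendsto hlim (by
    filter_upwards [Ioo_mem_nhdsGT hs] with t ht using h t ht.1 ht.2)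
  simpa using this

/-- Both expansions agree up to `O(|x|²)`. Letting `x` tend to zero, first at the origin and then
along the axes, identifies the constant and linear terms. -/
theorem linear_coeff_unique {c : (Fin 2 →₀ ℕ) → C} {A : (Fin 2 →₀ ℕ) → ℂ} {s : ℝ} (hs : 0 < s)
    (hc : Conv s c) (hA : Conv s A) (hA2 : OrdGE (fun _ => 1) (1 + 1) A) (χ : C →ₐ[ℂ] ℂ)
    {i : Fin 2} {β : ℂ}
    (h : ∀ x ∈ polydisk s, fval χ c x = β * x i + fval (AlgHom.id ℂ ℂ) A x) :
    χ (c 0) = 0 ∧ ∀ j, χ (c (Finsupp.single j 1)) = if i = j then β else 0 := by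
  obtain ⟨K, hK⟩ : ∃ K : ℝ, ∀ t, 0 < t → t < s → ∀ x : Fin 2 → ℂ, (∀ l, ‖x l‖ ≤ t) →
      ‖χ (c 0) + (χ (c (Finsupp.single 0 1)) * x 0 + χ (c (Finsupp.single 1 1)) * x 1)
        - β * x i‖ ≤ K * t ^ 2 := by
    refine ⟨(∑' m, ‖A m‖ * s ^ m.degree) / s ^ 2
      + (∑' m, ‖highPart c m‖ * s ^ m.degree) / s ^ 2, fun t ht hts x hx => ?_⟩
    have h1 := norm_fval_le_sq hs (conv_highPart hs.le hc) (ordGE_highPart c) χ ht.le hts.le hx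
    have h2 := norm_fval_le_sq hs hA hA2 (AlgHom.id ℂ ℂ) ht.le hts.le hx
    have h3 := h x fun l => (hx l).trans_lt hts
    rw [fval_eq_affine_add hs.le hc χ fun l => (hx l).trans hts.le] at h3
    have h4 : χ (c 0) + (χ (c (Finsupp.single 0 1)) * x 0 + χ (c (Finsupp.single 1 1)) * x 1)
        - β * x i = fval (AlgHom.id ℂ ℂ) A x - fval χ (highPart c) x := by
      linear_combination h3
    rw [h4]
    rw [add_mul]
    exact (norm_sub_le _ _).trans (add_le_add h2 h1)
  have h0 : χ (c 0) = 0 := by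
    refine eq_zero_of_norm_le_mul hs (K := |K| * s) fun t ht hts => ?_
    have := hK t ht hts 0 (by simpa using ht.le)
    simp only [Pi.zero_apply, mul_zero, add_zero, sub_zero] at this
    calc _ ≤ K * t ^ 2 := this
      _ ≤ |K| * (s * t) := by
        rw [pow_two]
        exact mul_le_mul (le_abs_self K) (mul_le_mul_of_nonneg_right hts.le ht.le)
          (by positivity) (abs_nonneg K)
      _ = _ := by ring
  refine ⟨h0, fun j => ?_⟩
  rw [← sub_eq_zero]
  refine eq_zero_of_norm_le_mul hs (K := K) fun t ht hts => ?_
  have := hK t ht hts (Pi.single j (t : ℂ)) fun l => by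
    by_cases hl : l = j
    · subst hl; simp [abs_of_pos ht]
    · simp [hl, ht.le]
  rw [h0, zero_add] at this
  have e : χ (c (Finsupp.single 0 1)) * (Pi.single j (t : ℂ) : Fin 2 → ℂ) 0
      + χ (c (Finsupp.single 1 1)) * (Pi.single j (t : ℂ) : Fin 2 → ℂ) 1
      - β * (Pi.single j (t : ℂ) : Fin 2 → ℂ) i
      = (χ (c (Finsupp.single j 1)) - if i = j then β else 0) * t := by
    fin_cases j <;> fin_cases i <;> simp <;> ring
  rw [e, norm_mul, Complex.norm_real, Real.norm_of_nonneg ht.le] at this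
  refine le_of_mul_le_mul_right (this.trans_eq ?_) ht
  ring

end lowOrder

theorem IsConjugate.mono {P : Type*} {Λ : Set P} {R R' ρ σ δ : ℝ}
    {f h k g : P → (Fin 2 → ℂ) → (Fin 2 → ℂ)} (H : IsConjugate Λ R ρ σ δ f h k g) (hR : R ≤ R') :
    IsConjugate Λ R' ρ σ δ f h k g :=
  ⟨H.radius_pos, H.radius_le, fun lam hlam _ hx => polydisk_mono hR (H.mapsTo lam hlam hx),
    H.mapsTo_comp, H.conj⟩

theorem IsPlanarFamily.exists_series {P : Type*} {Λ : Set P} {R : ℝ} {μ : Fin 2 → P → ℂ}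
    {a : (Fin 2 → ℕ) → P → (Fin 2 → ℂ)} {f : P → (Fin 2 → ℂ) → (Fin 2 → ℂ)}
    (hf : IsPlanarFamily Λ R μ a f) {lam : P} (hlam : lam ∈ Λ) (i : Fin 2) :
    ∃ A : (Fin 2 →₀ ℕ) → ℂ, Conv R A ∧ OrdGE (fun _ => 1) (1 + 1) A ∧
      ∀ x ∈ polydisk R, f lam x i = μ i lam * x i + fval (AlgHom.id ℂ ℂ) A x := by
  obtain ⟨M, hM, hMs⟩ := hf.summable
  obtain ⟨A, hA, hA2, hAv⟩ := exists_series_of_subtype (fun m => a m.1 lam i) (R := R)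
    (hMs.of_nonneg_of_le (fun m => mul_nonneg (norm_nonneg _) (pow_nonneg hf.radius_pos.le _))
      fun m => mul_le_mul_of_nonneg_right ((norm_le_pi_norm _ i).trans (hM m lam hlam))
        (pow_nonneg hf.radius_pos.le _))
  refine ⟨A, hA, hA2, fun x hx => ?_⟩
  rw [hAv (AlgHom.id ℂ ℂ) x _ (Pi.hasSum.1 (hf.hasSum lam hlam x hx) i)]
  exact (add_sub_cancel _ _).symm

/-- The coefficient algebra consists of the absolutely convergent series in the parameter. The
expansion of the germ has its own constant and linear coefficients in this algebra; they are
compared with the prescribed linear part only after specialisation, which is all that is needed. -/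
theorem exists_resonantForm_of_analytic {d : ℕ} {lam₀ : Fin d → ℂ} {Λ : Set (Fin d → ℂ)}
    (hΛ : Λ ∈ 𝓝 lam₀) {R : ℝ} {μ : Fin 2 → (Fin d → ℂ) → ℂ}
    {a : (Fin 2 → ℕ) → (Fin d → ℂ) → (Fin 2 → ℂ)} {f : (Fin d → ℂ) → (Fin 2 → ℂ) → (Fin 2 → ℂ)}
    (hf : IsPlanarFamily Λ R μ a f)
    (han : AnalyticAt ℂ (fun z : (Fin d → ℂ) × (Fin 2 → ℂ) => f z.1 z.2) (lam₀, 0))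
    (hhyp : IsHyperbolicAt μ lam₀) {p q : ℕ} (hp : 0 < p) (hq : 0 < q)
    (hres : ‖μ 0 lam₀‖ ^ p * ‖μ 1 lam₀‖ ^ q = 1) {r₀ s₀ : ℕ} (hrs : IsBezoutPair p q r₀ s₀)
    (N : ℕ) :
    ∃ (Λ' : Set (Fin d → ℂ)) (ρ σ δ : ℝ) (h k g : (Fin d → ℂ) → (Fin 2 → ℂ) → (Fin 2 → ℂ))
      (b : Fin 2 → (Fin d → ℂ) → ℂ → ℂ) (b₀ b₁ : Fin 2 → ℕ → (Fin d → ℂ) → ℂ → ℂ),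
      Λ' ∈ 𝓝 lam₀ ∧ Λ' ⊆ Λ ∧ IsChangeOfVariables Λ' ρ σ h k ∧
      IsConjugate Λ' R ρ σ δ f h k g ∧
      HasResonantForm p q N ![r₀, s₀] ![p - r₀, q - s₀] Λ' δ μ g b b₀ b₁ ∧
      AnalyticOnNhd ℂ (fun z : (Fin d → ℂ) × (Fin 2 → ℂ) => h z.1 z.2) (Λ' ×ˢ polydisk ρ) ∧
      AnalyticOnNhd ℂ (fun z : (Fin d → ℂ) × (Fin 2 → ℂ) => k z.1 z.2) (Λ' ×ˢ polydisk σ) ∧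
      AnalyticOnNhd ℂ (fun z : (Fin d → ℂ) × (Fin 2 → ℂ) => g z.1 z.2) (Λ' ×ˢ polydisk δ) ∧
      ∀ i,
        AnalyticOnNhd ℂ (fun z : (Fin d → ℂ) × ℂ => b i z.1 z.2)
          (Λ' ×ˢ Metric.ball 0 (δ ^ (p + q))) ∧
        ∀ j, 1 ≤ j →
          AnalyticOnNhd ℂ (fun z : (Fin d → ℂ) × ℂ => b₀ i j z.1 z.2)
            (Λ' ×ˢ Metric.ball 0 (δ ^ (p + q))) ∧
          AnalyticOnNhd ℂ (fun z : (Fin d → ℂ) × ℂ => b₁ i j z.1 z.2)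
            (Λ' ×ˢ Metric.ball 0 (δ ^ (p + q))) := by
  obtain ⟨η, hη, H⟩ := exists_resonantForm_of_characters (μ₀ := fun i => μ i lam₀) hhyp hp hq hres
    hrs N
  have hcomp : ∀ i, AnalyticAt ℂ (fun z : (Fin d → ℂ) × (Fin 2 → ℂ) => f z.1 z.2 i) (lam₀, 0) :=
    analyticAt_pi_iff.1 han
  obtain ⟨r, hD, hr0, hrR⟩ := ((Filter.eventually_all.2 fun i =>
    exists_absSeries_of_analyticAt (hcomp i)).and (Ioo_mem_nhdsGT hf.radius_pos)).exists
  choose D hD using hD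
  -- Shrinking the parameter polydisk by `t` makes the nonconstant part of each linear coefficient
  -- smaller than `η`; the factor `r⁻¹` comes from undoing the scaling in `x`.
  obtain ⟨t, ht, ht0, ht1⟩ : ∃ t : ℝ, (∀ i, r⁻¹ * (t * ‖D i‖) < η) ∧ 0 < t ∧ t < 1 := by
    have hev : ∀ i, ∀ᶠ t in 𝓝[>] (0 : ℝ), r⁻¹ * (t * ‖D i‖) < η := fun i => by
      have : Continuous fun t : ℝ => r⁻¹ * (t * ‖D i‖) := by fun_prop
      exact (this.continuousAt.eventually_lt continuousAt_const (by simpa using hη)).filter_mono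
        nhdsWithin_le_nhds
    exact ((Filter.eventually_all.2 hev).and (Ioo_mem_nhdsGT one_pos)).exists
  have htn : ‖(t : ℂ)‖ ≤ 1 := by
    rw [Complex.norm_real, Real.norm_of_nonneg ht0.le]
    exact ht1.le
  have htr : 0 < t * r := mul_pos ht0 hr0
  have hrc : (r : ℂ) ≠ 0 := by exact_mod_cast hr0.ne'
  have htc : (t : ℂ) ≠ 0 := by exact_mod_cast ht0.ne'
  classical
  -- The normalised parameter maps the ball of radius `t r` to the unit ball. The default `0`
  -- elsewhere makes it a legitimate evaluation point for every `lam`.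
  let Y : (Fin d → ℂ) → Fin d → ℂ := fun lam =>
    if lam ∈ Metric.ball lam₀ (t * r) then ((t * r : ℝ) : ℂ)⁻¹ • (lam - lam₀) else 0
  have hYmem : ∀ lam ∈ Metric.ball lam₀ (t * r), Y lam = ((t * r : ℝ) : ℂ)⁻¹ • (lam - lam₀) :=
    fun lam h => if_pos h
  have hYball : ∀ lam, Y lam ∈ Metric.ball 0 1 := fun lam => by
    by_cases h : lam ∈ Metric.ball lam₀ (t * r)
    · rw [hYmem lam h, mem_ball_zero_iff, norm_smul, norm_inv, Complex.norm_real,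
        Real.norm_of_nonneg htr.le, inv_mul_lt_iff₀ htr, mul_one]
      rwa [Metric.mem_ball, dist_eq_norm] at h
    · have : Y lam = 0 := if_neg h
      simp [this]
  have hY : ∀ lam i, ‖Y lam i‖ ≤ 1 := fun lam i =>
    (norm_le_pi_norm _ i).trans (mem_ball_zero_iff.1 (hYball lam)).le
  have htY : ∀ lam i, ‖(t : ℂ) * Y lam i‖ ≤ 1 := fun lam i => by
    rw [norm_mul]
    exact mul_le_one₀ htn (norm_nonneg _) (hY lam i)
  let χ : (Fin d → ℂ) → AbsSeries (Fin d) ℂ →ₐ[ℂ] ℂ := fun lam =>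
    AbsSeries.evalChar (Y lam) (hY lam)
  set Λ' := Λ ∩ Metric.ball lam₀ (t * r) with hΛ'
  have hΛ'n : Λ' ∈ 𝓝 lam₀ := Filter.inter_mem hΛ (Metric.ball_mem_nhds _ htr)
  have hlam₀ : lam₀ ∈ Λ' := mem_of_mem_nhds hΛ'n
  let c : Fin 2 → (Fin 2 →₀ ℕ) → AbsSeries (Fin d) ℂ := fun i m =>
    ((r : ℂ)⁻¹ ^ m.degree) • AbsSeries.dilate t htn ((D i).coeff m)
  have hcc : ∀ i, Conv r (c i) := fun i => by
    refine (D i).summable_norm_coeff.of_nonneg_of_le (fun m => by positivity) fun m => ?_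
    simp only [c]
    rw [norm_smul, norm_pow, norm_inv, Complex.norm_real, Real.norm_of_nonneg hr0.le]
    calc r⁻¹ ^ m.degree * ‖AbsSeries.dilate (t : ℂ) htn ((D i).coeff m)‖ * r ^ m.degree
        = ‖AbsSeries.dilate (t : ℂ) htn ((D i).coeff m)‖ := by
          rw [inv_pow]; field_simp
      _ ≤ _ := AbsSeries.norm_dilate_le _ _ _
  have hval : ∀ lam ∈ Metric.ball lam₀ (t * r), ∀ x ∈ polydisk r, ∀ i,
      f lam x i = fval (χ lam) (c i) x := by
    intro lam hlam x hx i
    have h1 := hD i (fun j => (t : ℂ) * Y lam j) (htY lam) ((r : ℂ)⁻¹ • x) fun l => by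
      rw [Pi.smul_apply, norm_smul, norm_inv, Complex.norm_real, Real.norm_of_nonneg hr0.le,
        inv_mul_le_iff₀ hr0, mul_one]
      exact (hx l).le
    have h2 : ((lam₀, 0) : (Fin d → ℂ) × (Fin 2 → ℂ)) + (r : ℂ) •
        ((fun j => (t : ℂ) * Y lam j), (r : ℂ)⁻¹ • x) = (lam, x) := by
      rw [hYmem lam hlam]
      ext j
      · simp only [Prod.fst_add, Prod.smul_fst, Pi.add_apply, Pi.smul_apply, smul_eq_mul,
          Pi.sub_apply]
        push_cast
        field_simp
        ring
      · simp [hrc]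
    rw [h2] at h1
    refine h1.trans (tsum_congr fun m => ?_)
    simp only [c, χ]
    rw [map_smul, AbsSeries.evalChar_dilate _ _ _ _ (htY lam), mpow_smul, smul_eq_mul]
    ring
  have hlow : ∀ lam ∈ Λ', ∀ i, χ lam (c i 0) = 0 ∧
      ∀ j, χ lam (c i (Finsupp.single j 1)) = if i = j then μ i lam else 0 := fun lam hlam i => by
    obtain ⟨A, hA, hA2, hAv⟩ := hf.exists_series hlam.1 i
    refine linear_coeff_unique hr0 (hcc i) (hA.mono hr0.le hrR.le) hA2 (χ lam) fun x hx => ?_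
    rw [← hval lam hlam.2 x hx i, hAv x (polydisk_mono hrR.le hx)]
  -- The multipliers are lifted to the algebra as the diagonal linear coefficients of the expansion;
  -- by `hlow` they specialise to `μ` on `Λ'`.
  let ν : Fin 2 → AbsSeries (Fin d) ℂ := fun i => c i (Finsupp.single i 1)
  have hνμ : ∀ i, ∀ lam ∈ Λ', χ lam (ν i) = μ i lam := fun i lam hlam => by
    simpa using (hlow lam hlam i).2 i
  have hν : ∀ i, ‖ν i - algebraMap ℂ _ (μ i lam₀)‖ ≤ η := fun i => by
    have hY0 : Y lam₀ = 0 := by rw [hYmem _ hlam₀.2, sub_self, smul_zero]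
    have h1 := hνμ i lam₀ hlam₀
    have h2 : χ lam₀ (ν i) = (ν i).coeff 0 := by
      have h3 : ∀ y hy, y = 0 → AbsSeries.evalChar y hy (ν i) = (ν i).coeff 0 := by
        rintro y hy rfl
        exact AbsSeries.evalChar_zero hy _
      exact h3 _ _ hY0
    rw [← h1, h2]
    have hdeg : (Finsupp.single i 1 : Fin 2 →₀ ℕ).degree = 1 := by simp
    simp only [ν, c]
    rw [hdeg, pow_one, AbsSeries.coeff_smul, smul_eq_mul, map_mul, ← Algebra.smul_def, ← smul_sub,
      norm_smul, norm_inv, Complex.norm_real, Real.norm_of_nonneg hr0.le]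
    have h4 := AbsSeries.norm_dilate_sub_le (t : ℂ) htn ((D i).coeff (Finsupp.single i 1))
    have h5 : (AbsSeries.dilate (t : ℂ) htn ((D i).coeff (Finsupp.single i 1))).coeff 0
        = ((D i).coeff (Finsupp.single i 1)).coeff 0 := by simp [AbsSeries.dilate]
    rw [h5]
    rw [Complex.norm_real, Real.norm_of_nonneg ht0.le] at h4
    refine le_trans ?_ (ht i).le
    gcongr
    exact h4.trans (by gcongr; exact AbsSeries.norm_coeff_le _ _)
  have hfF : ∀ lam ∈ Λ', ∀ x ∈ polydisk r,
      f lam x = mapOf (χ lam) ν (fun i => highPart (c i)) x := fun lam hlam x hx => by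
    ext i
    rw [hval lam hlam.2 x hx i, fval_eq_affine_add hr0.le (hcc i) (χ lam) fun l => (hx l).le,
      (hlow lam hlam i).1, (hlow lam hlam i).2, (hlow lam hlam i).2, mapOf, hνμ i lam hlam]
    fin_cases i <;> simp
  obtain ⟨ρ, σ, δ, h, k, g, b, b₀, b₁, h1, h2, h3, h4⟩ := H χ Λ' μ ν hν hνμ
    (fun i => highPart (c i)) r hr0 (fun i => conv_highPart hr0.le (hcc i))
    (fun i => ordGE_highPart (c i)) f hfF
  refine ⟨Λ', ρ, σ, δ, h, k, g, b, b₀, b₁, hΛ'n, Set.inter_subset_left, h1, h2.mono hrR.le, h3,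
    h4 (AbsSeries.analyticOnNhd_evalChar hY ?_ fun lam _ => hYball lam)⟩
  have haff : AnalyticOnNhd ℂ (fun lam : Fin d → ℂ => ((t * r : ℝ) : ℂ)⁻¹ • (lam - lam₀))
      (Metric.ball lam₀ (t * r)) :=
    fun lam _ => by fun_prop
  exact (haff.congr Metric.isOpen_ball fun lam h => (hYmem lam h).symm).mono Set.inter_subset_right

/-! ### Conclusion. -/

theorem theorem1 {d : ℕ} (lam₀ : Fin d → ℂ) (Λ : Set (Fin d → ℂ)) (hΛ : Λ ∈ 𝓝 lam₀) (R : ℝ)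
    (μ : Fin 2 → (Fin d → ℂ) → ℂ) (a : (Fin 2 → ℕ) → (Fin d → ℂ) → (Fin 2 → ℂ))
    (f : (Fin d → ℂ) → (Fin 2 → ℂ) → (Fin 2 → ℂ))
    (hf : IsPlanarFamily Λ R μ a f)
    (hμ : ∀ i, ContinuousAt (μ i) lam₀)
    (hhyp : IsHyperbolicAt μ lam₀)
    (p q : ℕ) (hres : ResonantInModulus p q μ lam₀)
    (r₀ s₀ : ℕ) (hrs : IsBezoutPair p q r₀ s₀)
    (N : ℕ) :
    ∃ (Λ' : Set (Fin d → ℂ)) (ρ σ δ : ℝ)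
      (h k g : (Fin d → ℂ) → (Fin 2 → ℂ) → (Fin 2 → ℂ))
      (b : Fin 2 → (Fin d → ℂ) → ℂ → ℂ) (b₀ b₁ : Fin 2 → ℕ → (Fin d → ℂ) → ℂ → ℂ),
      Λ' ∈ 𝓝 lam₀ ∧ Λ' ⊆ Λ ∧
      IsChangeOfVariables Λ' ρ σ h k ∧
      IsConjugate Λ' R ρ σ δ f h k g ∧
      HasResonantForm p q N ![r₀, s₀] ![p - r₀, q - s₀] Λ' δ μ g b b₀ b₁ ∧
      (AnalyticAt ℂ (fun z : (Fin d → ℂ) × (Fin 2 → ℂ) => f z.1 z.2) (lam₀, 0) →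
        AnalyticOnNhd ℂ (fun z : (Fin d → ℂ) × (Fin 2 → ℂ) => h z.1 z.2) (Λ' ×ˢ polydisk ρ) ∧
        AnalyticOnNhd ℂ (fun z : (Fin d → ℂ) × (Fin 2 → ℂ) => k z.1 z.2) (Λ' ×ˢ polydisk σ) ∧
        AnalyticOnNhd ℂ (fun z : (Fin d → ℂ) × (Fin 2 → ℂ) => g z.1 z.2) (Λ' ×ˢ polydisk δ) ∧
        ∀ i,
          AnalyticOnNhd ℂ (fun z : (Fin d → ℂ) × ℂ => b i z.1 z.2)
            (Λ' ×ˢ Metric.ball 0 (δ ^ (p + q))) ∧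
          ∀ j, 1 ≤ j →
            AnalyticOnNhd ℂ (fun z : (Fin d → ℂ) × ℂ => b₀ i j z.1 z.2)
              (Λ' ×ˢ Metric.ball 0 (δ ^ (p + q))) ∧
            AnalyticOnNhd ℂ (fun z : (Fin d → ℂ) × ℂ => b₁ i j z.1 z.2)
              (Λ' ×ˢ Metric.ball 0 (δ ^ (p + q)))) := by
  obtain ⟨hp, hq, -, hmod⟩ := hres
  have hmod' : ‖μ 0 lam₀‖ ^ p * ‖μ 1 lam₀‖ ^ q = 1 := by
    rw [zpow_natCast, zpow_neg, zpow_natCast] at hmod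
    rw [hmod, inv_mul_cancel₀]
    exact pow_ne_zero _ (norm_ne_zero_iff.2 (hhyp 1).1)
  -- The two coefficient algebras produce different data, and the analyticity claim is an
  -- implication about the data chosen. Splitting on its premise lets each case use its own algebra,
  -- the implication being vacuous in the second.
  by_cases han : AnalyticAt ℂ (fun z : (Fin d → ℂ) × (Fin 2 → ℂ) => f z.1 z.2) (lam₀, 0)
  · obtain ⟨Λ', ρ, σ, δ, h, k, g, b, b₀, b₁, h1, h2, h3, h4, h5, h6⟩ :=
      exists_resonantForm_of_analytic hΛ hf han hhyp hp hq hmod' hrs N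
    exact ⟨Λ', ρ, σ, δ, h, k, g, b, b₀, b₁, h1, h2, h3, h4, h5, fun _ => h6⟩
  · obtain ⟨Λ', ρ, σ, δ, h, k, g, b, b₀, b₁, h1, h2, h3, h4, h5⟩ :=
      exists_resonantForm_of_bounded hΛ hf hμ hhyp hp hq hmod' hrs N
    exact ⟨Λ', ρ, σ, δ, h, k, g, b, b₀, b₁, h1, h2, h3, h4, h5, fun h6 => absurd h6 han⟩
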